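/- Let $\nu>0$, $1\le p,q\le\infty$, $s_p=2-\frac3p$ and $s\in[s_p,0]$. Fix a smooth $\varphi:\mathbb R^3\to[0,1]$ supported in $\{3/4\le|\xi|\le 8/3\}$ with $\sum_{j\in\mathbb Z}\varphi(2^{-j}\xi)=1$ for $\xi\ne0$, let $\dot\Delta_j$ be the Fourier multiplier with symbol $\varphi(2^{-j}\xi)$, $\|f\|_{FL^p}=\|\hat f\|_{L^p}$, and $$\|f\|_{F\dot B^\sigma_{p,q}}=\big\|2^{j\sigma}\|\dot\Delta_jf\|_{FL^p}\big\|_{\ell^q(\mathbb Z)},\qquad \|u\|_{\widetilde L^r(I;F\dot B^\sigma_{p,q})}=\big\|2^{j\sigma}\|\dot\Delta_ju\|_{L^r(I;FL^p)}\big\|_{\ell^q(\mathbb Z)}.$$ (Elements of $F\dot B^s_{p,q}$ are identified with their representative whose Fourier transform is locally integrable.) A mild solution on $[0,T^*)$, $0<T^*\le\infty$, of the Navier–Stokes equations on $\mathbb R^3$ with divergence-free data $u_0\in F\dot B^s_{p,q}$ is a $u$ with $$u(t)=e^{\nu t\Delta}u_0-\int_0^te^{\nu(t-\tau)\Delta}\mathbb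 P\,\mathrm{div}(u\otimes u)(\tau)\,d\tau,\qquad 0\le t<T^*,$$ where the integral converges absolutely on the Fourier side. Consider mild solutions $u\in C([0,T^*);F\dot B^s_{p,q})\cap\bigcap_{1\le r\le\infty}\widetilde L^r_{loc}([0,T^*);F\dot B^{s+2/r}_{p,q})$ (if $q=\infty$, norm continuity is required only on $(0,T^*)$), in either of the following situations. (A) $u$ is any such solution, and either $s=s_p$, $q<\infty$, and $q\le2$ if $p=1$; or $s>s_p$ and $(s,p)\neq(0,1)$. (B) $s=s_p$ (with $q\le 2$ if $p=1$, and $q=\infty$ allowed if $p>1$), $T^*=\infty$, $\|u_0\|_{F\dot B^{s_p}_{p,q}}<\eta_0$, and $\|u\|_{\widetilde L^r([0,\infty);F\dot B^{s_p+2/r}_{p,q})}\le C\|u_0\|_{F\dot B^{s_p}_{p,q}}$ for all $r\in[1,\infty]$. Here $C$ is arbitrary, and the claim is that for each $C$ there is $\eta_0=\eta_0(C,\nu,p,q,\varphi)>0$, independent of $u_0$ and $u$, for which the conclusions below hold. Then: 1. $\|t\,u(t)\|_{\widetilde L^\infty([0,T];F\dot B^{s+2}_{p,q})}<\infty$ for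 every $T<T^*$. 2. If $q<\infty$, then $\|t\,u(t)\|_{\widetilde L^\infty([0,T];F\dot B^{s+2}_{p,q})}\to0$ as $T\to0^+$. 3. For every $T<T^*$ and every $(\alpha,\eta)\in\{0,1\}\times[1,p]$, $$\sup_{0\le t<T}t^{\frac\alpha2-\frac s2+\frac3{2\eta}-\frac3{2p}}\|\nabla^\alpha u(t)\|_{FL^\eta}<\infty$$ (with $0\cdot\infty=0$ at $t=0$), except for $(\alpha,\eta)=(1,1)$ when $s=s_p$, and except for $(\alpha,\eta)=(0,p)$ when $s=0$ and $q>p$. -/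

import Mathlib

open MeasureTheory Filter Topology
open scoped ENNReal NNReal SchwartzMap FourierTransform LineDeriv

namespace FourierHerz

noncomputable section

/-- Physical (and frequency) space. -/
abbrev R3 : Type := EuclideanSpace ℝ (Fin 3)

/-- Values of vector fields. Complex values are allowed; real fields are a special case. -/
abbrev C3 : Type := EuclideanSpace ℂ (Fin 3)

/-- `φ` is the frequency profile of a homogeneous Littlewood–Paley decomposition: smooth, supported
in the annulus `3/4 ≤ ‖ξ‖ ≤ 8/3`, with values in `[0,1]`, and `∑_j φ (2^{-j} ξ) = 1` off zero. -/
structure IsDyadicPartition (φ : R3 → ℝ) : Prop where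
  contDiff : ContDiff ℝ (⊤ : ℕ∞) φ
  tsupport_subset : tsupport φ ⊆ {ξ | 3 / 4 ≤ ‖ξ‖ ∧ ‖ξ‖ ≤ 8 / 3}
  nonneg : ∀ ξ, 0 ≤ φ ξ
  le_one : ∀ ξ, φ ξ ≤ 1
  hasSum : ∀ ξ, ξ ≠ 0 → HasSum (fun j : ℤ => φ ((2 : ℝ) ^ (-j) • ξ)) 1

/-- The dyadic block `Δ̇_j f`, the Fourier multiplier with symbol `φ (2^{-j} ξ)`. -/
def dyadicBlock (φ : R3 → ℝ) (j : ℤ) (f : 𝓢'(R3, C3)) : 𝓢'(R3, C3) :=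
  TemperedDistribution.fourierMultiplierCLM C3
    (fun ξ => ((φ ((2 : ℝ) ^ (-j) • ξ) : ℝ) : ℂ)) f

/-- The Fourier transform of the tempered distribution `f` is the locally integrable function `g`. -/
def HasFourierFunction (f : 𝓢'(R3, C3)) (g : R3 → C3) : Prop :=
  LocallyIntegrable g ∧
    ∀ ψ : 𝓢(R3, ℂ), Integrable (fun ξ => ψ ξ • g ξ) ∧ (𝓕 f) ψ = ∫ ξ, ψ ξ • g ξ

/-- `‖f‖_{FL^p} = ‖f̂‖_{L^p}`; it is `∞` if `f̂` is not a function. -/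
def normFL (p : ℝ≥0∞) (f : 𝓢'(R3, C3)) : ℝ≥0∞ :=
  ⨅ (g : R3 → C3) (_ : HasFourierFunction f g), eLpNorm g p volume

/-- `‖∇^α f‖_{FL^p}`, for `α = 0` and `α = 1` (sum over the three partial derivatives). -/
def normGradFL (α : Fin 2) (p : ℝ≥0∞) (f : 𝓢'(R3, C3)) : ℝ≥0∞ :=
  if α = 0 then normFL p f
  else ∑ i : Fin 3, normFL p (∂_{(EuclideanSpace.single i (1 : ℝ) : R3)} f)

/-- The `ℓ^q(ℤ)` norm of a sequence in `[0,∞]`. -/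
def normSeq (q : ℝ≥0∞) (a : ℤ → ℝ≥0∞) : ℝ≥0∞ :=
  if q = ∞ then ⨆ j, a j else (∑' j, a j ^ q.toReal) ^ (1 / q.toReal)

/-- The homogeneous Fourier–Herz norm `‖f‖_{FḂ^s_{p,q}}`. -/
def normFB (φ : R3 → ℝ) (s : ℝ) (p q : ℝ≥0∞) (f : 𝓢'(R3, C3)) : ℝ≥0∞ :=
  normSeq q fun j => (2 : ℝ≥0∞) ^ ((j : ℝ) * s) * normFL p (dyadicBlock φ j f)

/-- The Chemin–Lerner norm `‖u‖_{L̃^r(I; FḂ^s_{p,q})}`. -/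
def normCL (φ : R3 → ℝ) (I : Set ℝ) (r : ℝ≥0∞) (s : ℝ) (p q : ℝ≥0∞)
    (u : ℝ → 𝓢'(R3, C3)) : ℝ≥0∞ :=
  normSeq q fun j => (2 : ℝ≥0∞) ^ ((j : ℝ) * s) *
    eLpNorm (fun t => normFL p (dyadicBlock φ j (u t))) r (volume.restrict I)

/-- `f ∈ FḂ^s_{p,q}`. For `s < 3(1-1/p)` a class of distributions modulo polynomials with finite norm
has exactly one representative whose Fourier transform is a locally integrable function, and
elements of the space are identified with that representative. -/
def MemFB (φ : R3 → ℝ) (s : ℝ) (p q : ℝ≥0∞) (f : 𝓢'(R3, C3)) : Prop :=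
  (∃ g, HasFourierFunction f g) ∧ normFB φ s p q f < ∞

/-- `div f = 0` in the sense of distributions. -/
def IsDivFree (f : 𝓢'(R3, C3)) : Prop :=
  ∀ ψ : 𝓢(R3, ℂ), ∑ i : Fin 3, ((∂_{(EuclideanSpace.single i (1 : ℝ) : R3)} f) ψ) i = 0

/-- The critical regularity `s_p = 2 - 3/p`. -/
def critExp (p : ℝ≥0∞) : ℝ := 2 - 3 * (p⁻¹).toReal

/-- The symbol of the Leray projector: `a ↦ a - ξ (ξ·a)/|ξ|²`. -/
def lerayHat (ξ : R3) (a : C3) : C3 :=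
  WithLp.toLp 2 fun i => a i - (ξ i : ℂ) * (∑ l, (ξ l : ℂ) * a l) / ((‖ξ‖ : ℝ) : ℂ) ^ 2

/-- The symbol `e^{-4π²νt|ξ|²}` of `e^{νtΔ}` (Fourier transform normalised by `e^{-2πi x·ξ}`). -/
def heatHat (ν t : ℝ) (ξ : R3) : ℝ := Real.exp (-(4 * Real.pi ^ 2 * ν * t * ‖ξ‖ ^ 2))

/-- For `a = û` integrable, the Fourier transform of `ℙ div(u ⊗ u)`: the product `u_k u_l` of the
bounded continuous functions `u_k`, `u_l` has Fourier transform `a_k * a_l`. -/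
def nonlinearHat (a : R3 → C3) (ξ : R3) : C3 :=
  lerayHat ξ (WithLp.toLp 2 fun l =>
    ∑ k : Fin 3, (2 * Real.pi * Complex.I) * (ξ k : ℂ) * ∫ η, a (ξ - η) k * a η l)

/-- The time interval `[0, T*)`, where `0 < T* ≤ ∞`. -/
def timeInterval (Tstar : ℝ≥0∞) : Set ℝ := {t | 0 ≤ t ∧ ENNReal.ofReal t < Tstar}

/-- `u` is a mild solution on `[0,T*)` of the Navier–Stokes equations with data `u₀`:
`u(t) = e^{νtΔ}u₀ - ∫₀ᵗ e^{ν(t-τ)Δ} ℙ div(u ⊗ u)(τ) dτ` for every `t ∈ [0,T*)`, written for the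
Fourier transforms; the integrals in this formula are required to converge absolutely. -/
def IsMildSolution (ν : ℝ) (u₀ : 𝓢'(R3, C3)) (Tstar : ℝ≥0∞) (u : ℝ → 𝓢'(R3, C3)) : Prop :=
  ∃ (v₀ : R3 → C3) (v : ℝ → R3 → C3),
    HasFourierFunction u₀ v₀ ∧
    (∀ t ∈ timeInterval Tstar, HasFourierFunction (u t) (v t)) ∧
    Measurable (Function.uncurry v) ∧
    (∀ᵐ τ, τ ∈ timeInterval Tstar → Integrable (v τ)) ∧
    ∀ t ∈ timeInterval Tstar, ∀ᵐ ξ,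
      IntegrableOn (fun τ => heatHat ν (t - τ) ξ • nonlinearHat (v τ) ξ) (Set.Ioc 0 t) ∧
      v t ξ = heatHat ν t ξ • v₀ ξ
        - ∫ τ in Set.Ioc 0 t, heatHat ν (t - τ) ξ • nonlinearHat (v τ) ξ

/-- `u ∈ C([0,T*); FḂ^s_{p,q})`. As usual for `q = ∞`, where `e^{νtΔ}` is not strongly continuous at
`t = 0`, norm continuity is then only required on `(0,T*)`. -/
def ContinuousInFB (φ : R3 → ℝ) (s : ℝ) (p q : ℝ≥0∞) (Tstar : ℝ≥0∞)
    (u : ℝ → 𝓢'(R3, C3)) : Prop :=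
  ∀ t₀ ∈ timeInterval Tstar, MemFB φ s p q (u t₀) ∧
    ((q = ∞ → 0 < t₀) →
      Tendsto (fun t => normFB φ s p q (u t - u t₀)) (𝓝[timeInterval Tstar] t₀) (𝓝 0))

/-- The class in which mild solutions are constructed:
`C([0,T*); FḂ^s_{p,q}) ∩ L̃^r_loc([0,T*); FḂ^{s+2/r}_{p,q})` for all `r ∈ [1,∞]`. -/
def InSolutionClass (φ : R3 → ℝ) (s : ℝ) (p q : ℝ≥0∞) (Tstar : ℝ≥0∞)
    (u : ℝ → 𝓢'(R3, C3)) : Prop :=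
  ContinuousInFB φ s p q Tstar u ∧
    ∀ r : ℝ≥0∞, 1 ≤ r → ∀ T ∈ timeInterval Tstar,
      normCL φ (Set.Icc 0 T) r (s + 2 * (r⁻¹).toReal) p q u < ∞

/-- `‖t u(t)‖_{L̃^∞([0,T]; FḂ^{s+2}_{p,q})}`. -/
def smoothingNorm (φ : R3 → ℝ) (s : ℝ) (p q : ℝ≥0∞) (T : ℝ) (u : ℝ → 𝓢'(R3, C3)) : ℝ≥0∞ :=
  normCL φ (Set.Icc 0 T) ∞ (s + 2) p q fun t => (t : ℂ) • u t

/-- The smoothing estimate, its vanishing as `T → 0+` if `q < ∞`, and the weighted decay bounds. -/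
structure SmoothingAndDecay (φ : R3 → ℝ) (s : ℝ) (p q : ℝ≥0∞) (Tstar : ℝ≥0∞)
    (u : ℝ → 𝓢'(R3, C3)) : Prop where
  smoothing : ∀ T ∈ timeInterval Tstar, smoothingNorm φ s p q T u < ∞
  vanishing : q ≠ ∞ → Tendsto (fun T => smoothingNorm φ s p q T u) (𝓝[>] 0) (𝓝 0)
  decay : ∀ T ∈ timeInterval Tstar, ∀ (α : Fin 2) (η : ℝ≥0∞), 1 ≤ η → η ≤ p →
    ¬ (s = critExp p ∧ α = 1 ∧ η = 1) →
    ¬ (s = 0 ∧ α = 0 ∧ η = p ∧ p < q) →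
    (⨆ t ∈ Set.Ico 0 T,
      ENNReal.ofReal
          (t ^ (((α : ℕ) : ℝ) / 2 - s / 2 + 3 / 2 * (η⁻¹).toReal - 3 / 2 * (p⁻¹).toReal)) *
        normGradFL α η (u t)) < ∞

end

end FourierHerz

/-!
The whole argument takes place on the Fourier side, for the modulus `w(t, ξ) = |û(t, ξ)|` with
values in `[0, ∞]`. Taking absolute values in Duhamel's formula gives (`isDuhamelBounded_of_mild`)
`w(t) ≤ e^{-κt|ξ|²} w(0) + ∫₀ᵗ e^{-κ(t-τ)|ξ|²} K |ξ| (w * w)(τ) dτ`, with `κ = 4π²ν`.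

*Smoothing.* Let `y_j` be the `L^∞` norm over `[0, T]` of `t ‖φ_j w(t)‖_p`. In the `j`-th dyadic
piece of Duhamel's formula, write `t = (t - τ) + τ`: the factor `t - τ` together with `4^j` is
absorbed by the heat kernel, and the factor `τ` falls on the nonlinear term, where it is given to
the factor of higher frequency. The paraproduct decomposition of `w * w` (`blockNorm_conv_le`),
estimated by the inequalities of Young and Bernstein, then bounds `4^j y_j` by known norms of the
solution plus an expression linear in the sequence `4^k y_k`. Its coefficients are the
scale-invariant `L^∞` norms of the low frequencies below `2^k`, and the scale-invariant `L¹` norms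
of the frequencies about `2^k`. For large `k` both are small: by dominated convergence if `q < ∞`,
by the spare regularity `s - s_p > 0` in the subcritical case, and by assumption for small global
solutions. The linear expression can therefore be absorbed at high frequencies, while at low
frequencies `y_j` is bounded trivially by `T` times a norm of the solution
(`exists_smoothing_threshold`). Absorption requires the unknown to be finite a priori, so it is
done for the truncated weight `min (4^j, 4^n)`, with bounds independent of `n`. The sum over the
high-high interactions is geometric for `s > -1`; in the remaining case `s = -1`, `p = 1`, they
are summable in the output frequency, and `ℓ² · ℓ² ⊆ ℓ¹` is used instead, whence the restriction
`q ≤ 2` (`exists_normSeq_highHigh_le`).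

*Conclusions.* If `q < ∞`, each `y_j` is `O(T)`, and dominated convergence gives the vanishing as
`T → 0`. For the decay, continuity in time turns essential suprema into bounds at every time
(`blockNorm_le_of_continuous`). The norm of `∇^α u(t)` is at most a sum of dyadic pieces, weighted
by `2^{jσ}` relative to the solution norm, where `σ/2` is the exponent of `t` in the claim. If
`0 < σ < 2`, interpolation between the bounds `1` and `(t 4^j)⁻¹` sums the series
(`exists_decay_bound`). The value `σ = 2` is the excluded pair `(1, 1)` with `s = s_p`, and
`σ = 0` occurs only for `s = 0`, `(α, η) = (0, p)`, where the embedding of `ℓ^q` in `ℓ^p` for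
`q ≤ p` suffices.
-/

namespace FourierHerz

/-! ### Minkowski's and Young's inequalities -/

/-- Minkowski's integral inequality: the `L^p` norm of an integral is at most the integral of the
`L^p` norms. -/
theorem eLpNorm_lintegral_le {α β : Type*} [MeasurableSpace α] [MeasurableSpace β]
    {μ : Measure α} {ν : Measure β} [SFinite μ] [SFinite ν] {F : α → β → ℝ≥0∞}
    (hF : Measurable (Function.uncurry F)) {p : ℝ≥0∞} (hp : 1 ≤ p) (hp' : p ≠ ∞) :
    eLpNorm (fun y => ∫⁻ x, F x y ∂μ) p ν ≤ ∫⁻ x, eLpNorm (F x) p ν ∂μ := by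
  have hp0 : p ≠ 0 := (zero_lt_one.trans_le hp).ne'
  obtain ⟨r, hr1, hr⟩ : ∃ r : ℝ, 1 ≤ r ∧ p.toReal = r :=
    ⟨_, by simpa using ENNReal.toReal_mono hp' hp, rfl⟩
  have hr0 : 0 < r := by linarith
  simp_rw [eLpNorm_eq_lintegral_rpow_enorm_toReal hp0 hp', hr, enorm_eq_self]
  set n : α → ℝ≥0∞ := fun x => (∫⁻ y, F x y ^ r ∂ν) ^ (1 / r) with hn
  have hFx : ∀ x, Measurable (F x) := fun x => hF.comp measurable_prodMk_left
  have hnm : Measurable n :=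
    (Measurable.lintegral_prod_right' (f := fun z : α × β => F z.1 z.2 ^ r)
      (hF.pow_const r)).pow_const _
  set N := ∫⁻ x, n x ∂μ with hN
  have hnr : ∀ x, n x ^ r = ∫⁻ y, F x y ^ r ∂ν := fun x => by
    simp only [hn]; rw [← ENNReal.rpow_mul, one_div, inv_mul_cancel₀ hr0.ne', ENNReal.rpow_one]
  by_cases hNtop : N = ∞
  · rw [hNtop]; exact le_top
  have hfin : ∀ᵐ x ∂μ, n x < ∞ := ae_lt_top hnm hNtop
  -- weighted form of `F`, so that Hölder's inequality can be applied with the weight `n`, which is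
  -- the inner norm; this avoids duality
  have hpt : ∀ᵐ y ∂ν, ∀ᵐ x ∂μ,
      F x y ≤ n x ^ (1 - 1 / r) * (F x y ^ r * n x ^ (1 - r)) ^ (1 / r) := by
    rw [← Measure.ae_ae_comm (p := fun x y =>
      F x y ≤ n x ^ (1 - 1 / r) * (F x y ^ r * n x ^ (1 - r)) ^ (1 / r))]
    · filter_upwards [hfin] with x hx
      by_cases h0 : n x = 0
      · have : ∫⁻ y, F x y ^ r ∂ν = 0 := by rw [← hnr, h0, ENNReal.zero_rpow_of_pos hr0]
        rw [lintegral_eq_zero_iff ((hFx x).pow_const r)] at this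
        filter_upwards [this] with y hy
        have hy' : F x y = 0 := by
          simpa [hr0, hr0.le, not_lt.2 hr0.le] using hy
        rw [hy']; exact zero_le
      · refine ae_of_all _ fun y => le_of_eq ?_
        rw [ENNReal.mul_rpow_of_nonneg _ _ (by positivity), ← ENNReal.rpow_mul (F x y) r,
          ← ENNReal.rpow_mul (n x) (1 - r), mul_one_div_cancel hr0.ne', ENNReal.rpow_one,
          mul_left_comm, ← ENNReal.rpow_add _ _ h0 hx.ne]
        have : (1 - 1 / r + (1 - r) * (1 / r)) = 0 := by field_simp; ring
        rw [this, ENNReal.rpow_zero, mul_one]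
    · have hnm' : Measurable fun z : α × β => n z.1 := hnm.comp measurable_fst
      exact measurableSet_le hF ((hnm'.pow_const _).mul
        (((hF.pow_const r).mul (hnm'.pow_const _)).pow_const _))
  have hjensen : ∀ᵐ y ∂ν, (∫⁻ x, F x y ∂μ) ^ r ≤
      N ^ (r - 1) * ∫⁻ x, F x y ^ r * n x ^ (1 - r) ∂μ := by
    filter_upwards [hpt] with y hy
    have hFy : Measurable fun x => F x y := hF.comp measurable_prodMk_right
    calc (∫⁻ x, F x y ∂μ) ^ r
        ≤ (N ^ (1 - 1 / r) * (∫⁻ x, F x y ^ r * n x ^ (1 - r) ∂μ) ^ (1 / r)) ^ r := by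
          refine ENNReal.rpow_le_rpow ((lintegral_mono_ae hy).trans ?_) hr0.le
          have h1 : 1 / r ≤ 1 := by rw [div_le_one hr0]; exact hr1
          exact ENNReal.lintegral_mul_norm_pow_le hnm.aemeasurable
            ((hFy.pow_const _).mul (hnm.pow_const _)).aemeasurable (by linarith) (by positivity)
            (by ring)
      _ = _ := by
          rw [ENNReal.mul_rpow_of_nonneg _ _ hr0.le, ← ENNReal.rpow_mul, ← ENNReal.rpow_mul,
            one_div_mul_cancel hr0.ne', ENNReal.rpow_one]
          congr 2; field_simp
  calc (∫⁻ y, (∫⁻ x, F x y ∂μ) ^ r ∂ν) ^ (1 / r)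
      ≤ (N ^ (r - 1) * N) ^ (1 / r) := by
        refine ENNReal.rpow_le_rpow ((lintegral_mono_ae hjensen).trans ?_) (by positivity)
        have hm : Measurable fun z : α × β => F z.1 z.2 ^ r * n z.1 ^ (1 - r) :=
          (hF.pow_const r).mul ((hnm.comp measurable_fst).pow_const _)
        rw [lintegral_const_mul _ (hm.lintegral_prod_left')]
        gcongr
        rw [lintegral_lintegral_swap (f := fun y x => F x y ^ r * n x ^ (1 - r))
          (hm.comp measurable_swap).aemeasurable]
        refine lintegral_mono_ae ?_
        filter_upwards [hfin] with x hx
        rw [lintegral_mul_const _ ((hFx x).pow_const r), ← hnr]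
        by_cases h0 : n x = 0
        · rw [h0, ENNReal.zero_rpow_of_pos hr0, zero_mul]
        · rw [← ENNReal.rpow_add _ _ h0 hx.ne]; simp
    _ = N := by
        rcases eq_or_ne N 0 with h0 | h0
        · simp [h0, hr0]
        · nth_rewrite 2 [← ENNReal.rpow_one N]
          rw [← ENNReal.rpow_add _ _ h0 hNtop, ← ENNReal.rpow_mul]
          have : (r - 1 + 1) * (1 / r) = 1 := by field_simp; ring
          rw [this, ENNReal.rpow_one]

/-- Countable form of Minkowski's inequality. -/
theorem eLpNorm_tsum_le {ι β : Type*} [Countable ι] [MeasurableSpace β] {ν : Measure β} [SFinite ν]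
    {F : ι → β → ℝ≥0∞} (hF : ∀ i, Measurable (F i)) {p : ℝ≥0∞} (hp : 1 ≤ p) (hp' : p ≠ ∞) :
    eLpNorm (fun y => ∑' i, F i y) p ν ≤ ∑' i, eLpNorm (F i) p ν := by
  let _ : MeasurableSpace ι := ⊤
  have : DiscreteMeasurableSpace ι := ⟨fun _ => trivial⟩
  have := eLpNorm_lintegral_le (μ := (Measure.count : Measure ι)) (ν := ν) (F := F)
    (measurable_from_prod_countable_right hF) hp hp'
  simpa [lintegral_count] using this

theorem eLpNorm_const_mul {α : Type*} [MeasurableSpace α] {μ : Measure α} {p : ℝ≥0∞} (hp : 1 ≤ p)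
    (hp' : p ≠ ∞) (c : ℝ≥0∞) {f : α → ℝ≥0∞} (hf : Measurable f) :
    eLpNorm (fun x => c * f x) p μ = c * eLpNorm f p μ := by
  have hp0 := (zero_lt_one.trans_le hp).ne'
  have h0 : 0 < p.toReal := ENNReal.toReal_pos hp0 hp'
  simp only [eLpNorm_eq_lintegral_rpow_enorm_toReal hp0 hp', enorm_eq_self,
    ENNReal.mul_rpow_of_nonneg _ _ h0.le]
  rw [lintegral_const_mul _ (hf.pow_const _), ENNReal.mul_rpow_of_nonneg _ _ (by positivity),
    ← ENNReal.rpow_mul, mul_one_div_cancel h0.ne', ENNReal.rpow_one]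

/-- Young's inequality `L¹ * L^p ⊆ L^p` for nonnegative functions. -/
theorem eLpNorm_conv_le {f g : R3 → ℝ≥0∞} (hf : Measurable f) (hg : Measurable g) {p : ℝ≥0∞}
    (hp : 1 ≤ p) (hp' : p ≠ ∞) :
    eLpNorm (fun ξ => ∫⁻ η, f (ξ - η) * g η) p volume ≤
      eLpNorm f 1 volume * eLpNorm g p volume := by
  have h1 : (fun ξ => ∫⁻ η, f (ξ - η) * g η) = fun ξ => ∫⁻ η, f η * g (ξ - η) := by
    funext ξ
    rw [← lintegral_sub_left_eq_self (fun η => f η * g (ξ - η)) ξ]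
    simp
  rw [h1]
  refine (eLpNorm_lintegral_le (F := fun η ξ => f η * g (ξ - η)) ?_ hp hp').trans ?_
  · exact (hf.comp measurable_fst).mul (hg.comp (measurable_snd.sub measurable_fst))
  · rw [eLpNorm_one_eq_lintegral_enorm, ← lintegral_mul_const _ (by simpa using hf)]
    refine lintegral_mono fun η => ?_
    have h2 : eLpNorm (fun ξ => g (ξ - η)) p volume = eLpNorm g p volume :=
      eLpNorm_comp_measurePreserving (g := g) hg.aestronglyMeasurable
        (measurePreserving_sub_right volume η)
    have hgη : Measurable fun ξ => g (ξ - η) := hg.comp (measurable_id.sub_const η)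
    rw [← h2, enorm_eq_self]
    exact (eLpNorm_const_mul hp hp' (f η) hgη).le

/-! ### Sequence norms -/

theorem normSeq_top (a : ℤ → ℝ≥0∞) : normSeq ∞ a = ⨆ j, a j := by simp [normSeq]

theorem normSeq_of_ne_top {q : ℝ≥0∞} (hq : q ≠ ∞) (a : ℤ → ℝ≥0∞) :
    normSeq q a = (∑' j, a j ^ q.toReal) ^ (1 / q.toReal) := by simp [normSeq, hq]

theorem normSeq_eq_eLpNorm {q : ℝ≥0∞} (hq : q ≠ 0) (a : ℤ → ℝ≥0∞) :
    normSeq q a = eLpNorm a q Measure.count := by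
  rcases eq_or_ne q ∞ with rfl | h
  · simp [normSeq_top, eLpNorm_exponent_top]
  · rw [normSeq_of_ne_top h, eLpNorm_eq_lintegral_rpow_enorm_toReal hq h, lintegral_count]
    simp

section

variable {q : ℝ≥0∞}

theorem one_le_toReal (hq : 1 ≤ q) (hq' : q ≠ ∞) : 1 ≤ q.toReal := by
  simpa using ENNReal.toReal_mono hq' hq

theorem normSeq_mono {a b : ℤ → ℝ≥0∞} (h : ∀ j, a j ≤ b j) : normSeq q a ≤ normSeq q b := by
  rcases eq_or_ne q ∞ with rfl | hq
  · simpa [normSeq_top] using iSup_mono h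
  · rw [normSeq_of_ne_top hq, normSeq_of_ne_top hq]
    exact ENNReal.rpow_le_rpow
      (ENNReal.tsum_le_tsum fun j => ENNReal.rpow_le_rpow (h j) (by positivity)) (by positivity)

theorem le_normSeq (hq : 1 ≤ q) (a : ℤ → ℝ≥0∞) (j : ℤ) : a j ≤ normSeq q a := by
  rw [normSeq_eq_eLpNorm (zero_lt_one.trans_le hq).ne']
  simpa using enorm_le_eLpNorm_count a j (zero_lt_one.trans_le hq).ne'

theorem normSeq_add_le (hq : 1 ≤ q) (a b : ℤ → ℝ≥0∞) :
    normSeq q (fun j => a j + b j) ≤ normSeq q a + normSeq q b := by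
  simp only [normSeq_eq_eLpNorm (zero_lt_one.trans_le hq).ne']
  exact eLpNorm_add_le (f := a) (g := b) (measurable_of_countable _).aestronglyMeasurable
    (measurable_of_countable _).aestronglyMeasurable hq

theorem normSeq_const_mul (hq : 1 ≤ q) (c : ℝ≥0∞) (a : ℤ → ℝ≥0∞) :
    normSeq q (fun j => c * a j) = c * normSeq q a := by
  rcases eq_or_ne q ∞ with rfl | hq'
  · simp [normSeq_top, ENNReal.mul_iSup]
  · have h := one_le_toReal hq hq'
    have h0 : 0 < q.toReal := by linarith
    rw [normSeq_of_ne_top hq', normSeq_of_ne_top hq']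
    simp_rw [ENNReal.mul_rpow_of_nonneg _ _ h0.le]
    rw [ENNReal.tsum_mul_left, ENNReal.mul_rpow_of_nonneg _ _ (by positivity), ← ENNReal.rpow_mul,
      mul_one_div_cancel h0.ne', ENNReal.rpow_one]

theorem normSeq_mul_le (hq : 1 ≤ q) (a b : ℤ → ℝ≥0∞) :
    normSeq q (fun j => a j * b j) ≤ normSeq q a * normSeq q b := by
  rw [← normSeq_const_mul hq]
  exact normSeq_mono fun j => by gcongr; exact le_normSeq hq a j

theorem normSeq_tsum_le (hq : 1 ≤ q) (F : ℤ → ℤ → ℝ≥0∞) :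
    normSeq q (fun j => ∑' m, F m j) ≤ ∑' m, normSeq q (F m) := by
  rcases eq_or_ne q ∞ with rfl | hq'
  · simp only [normSeq_top]
    exact iSup_le fun j => ENNReal.tsum_le_tsum fun m => le_iSup (F m) j
  · simp only [normSeq_eq_eLpNorm (zero_lt_one.trans_le hq).ne']
    exact eLpNorm_tsum_le (fun _ => measurable_of_countable _) hq hq'

theorem normSeq_shift (a : ℤ → ℝ≥0∞) (m : ℤ) : normSeq q (fun j => a (m + j)) = normSeq q a := by
  rcases eq_or_ne q ∞ with rfl | hq
  · simp only [normSeq_top]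
    exact (Equiv.addLeft m).iSup_congr fun _ => rfl
  · rw [normSeq_of_ne_top hq, normSeq_of_ne_top hq]
    congr 1
    exact (Equiv.addLeft m).tsum_eq (fun j => a j ^ q.toReal)

/-- Discrete Young inequality `ℓ¹ * ℓ^q ⊆ ℓ^q`. -/
theorem normSeq_conv_le (hq : 1 ≤ q) (K x : ℤ → ℝ≥0∞) :
    normSeq q (fun j => ∑' k, K (k - j) * x k) ≤ (∑' m, K m) * normSeq q x := by
  have h : (fun j => ∑' k, K (k - j) * x k) = fun j => ∑' m, K m * x (m + j) := by
    funext j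
    rw [← (Equiv.addRight j).tsum_eq (fun k => K (k - j) * x k)]
    simp
  rw [h, ← ENNReal.tsum_mul_right]
  refine (normSeq_tsum_le hq fun m j => K m * x (m + j)).trans
    (ENNReal.tsum_le_tsum fun m => ?_)
  rw [normSeq_const_mul hq, normSeq_shift]

/-- The embedding `ℓ^q ⊆ ℓ^r` for `q ≤ r`. -/
theorem normSeq_anti {r : ℝ≥0∞} (hq : 1 ≤ q) (hqr : q ≤ r) (a : ℤ → ℝ≥0∞) :
    normSeq r a ≤ normSeq q a := by
  rcases eq_or_ne r ∞ with rfl | hr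
  · rw [normSeq_top]; exact iSup_le (le_normSeq hq a)
  · have hq' : q ≠ ∞ := ne_top_of_le_ne_top hr hqr
    have h1 := one_le_toReal hq hq'
    have h2 : q.toReal ≤ r.toReal := ENNReal.toReal_mono hr hqr
    set N := normSeq q a with hN
    rcases eq_or_ne N ∞ with hN' | hN'
    · rw [hN']; exact le_top
    have hNq : ∑' j, a j ^ q.toReal = N ^ q.toReal := by
      rw [hN, normSeq_of_ne_top hq', ← ENNReal.rpow_mul, one_div_mul_cancel (by linarith),
        ENNReal.rpow_one]
    rw [normSeq_of_ne_top hr, one_div, ENNReal.rpow_inv_le_iff (by linarith)]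
    calc ∑' j, a j ^ r.toReal ≤ ∑' j, N ^ (r.toReal - q.toReal) * a j ^ q.toReal := by
          refine ENNReal.tsum_le_tsum fun j => ?_
          have : r.toReal = (r.toReal - q.toReal) + q.toReal := by ring
          conv_lhs => rw [this]
          rw [ENNReal.rpow_add_of_nonneg _ _ (by linarith) (by linarith)]
          gcongr
          exact le_normSeq hq a j
      _ = N ^ r.toReal := by
          rw [ENNReal.tsum_mul_left, hNq, ← ENNReal.rpow_add_of_nonneg _ _ (by linarith)
            (by linarith)]
          congr 1; ring

theorem normSeq_one (a : ℤ → ℝ≥0∞) : normSeq 1 a = ∑' j, a j := by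
  simp [normSeq]

/-- For `q ≤ 2` the product of two sequences in `ℓ^q` is summable: both lie in `ℓ²`. -/
theorem tsum_mul_le_normSeq (hq : 1 ≤ q) (hq2 : q ≤ 2) (a b : ℤ → ℝ≥0∞) :
    ∑' j, a j * b j ≤ normSeq q a * normSeq q b := by
  have h := ENNReal.lintegral_mul_le_Lp_mul_Lq (Measure.count : Measure ℤ)
    Real.HolderConjugate.two_two
    (measurable_of_countable a).aemeasurable (measurable_of_countable b).aemeasurable
  rw [lintegral_count, lintegral_count, lintegral_count] at h
  refine h.trans (mul_le_mul' ?_ ?_)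
  · simpa [normSeq] using normSeq_anti hq hq2 a
  · simpa [normSeq] using normSeq_anti hq hq2 b

/-- Fatou's lemma for sequence norms, for eventually stationary approximations. -/
theorem normSeq_le_of_eventually_eq {M : ℝ≥0∞} {X : ℕ → ℤ → ℝ≥0∞} {Y : ℤ → ℝ≥0∞}
    (hX : ∀ n, normSeq q (X n) ≤ M) (h : ∀ j, ∀ᶠ n in atTop, X n j = Y j) (hq : 1 ≤ q) :
    normSeq q Y ≤ M := by
  rcases eq_or_ne q ∞ with rfl | hq'
  · rw [normSeq_top]
    refine iSup_le fun j => ?_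
    obtain ⟨n, hn⟩ := (h j).exists
    rw [← hn]
    exact (le_normSeq hq _ j).trans (hX n)
  · have h0 : 0 < q.toReal := zero_lt_one.trans_le (one_le_toReal hq hq')
    simp only [normSeq_of_ne_top hq', one_div, ENNReal.rpow_inv_le_iff h0] at hX ⊢
    rw [ENNReal.tsum_eq_iSup_sum]
    refine iSup_le fun S => ?_
    obtain ⟨n, hn⟩ := ((Filter.eventually_all_finset S).2 fun j _ => h j).exists
    refine le_trans (le_of_eq (Finset.sum_congr rfl fun j hj => ?_))
      ((ENNReal.sum_le_tsum S).trans (hX n))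
    rw [hn j hj]

/-- Dominated convergence for sequence norms with `q < ∞`. -/
theorem tendsto_normSeq_zero {ι : Type*} {l : Filter ι} [l.IsCountablyGenerated] (hq : 1 ≤ q)
    (hq' : q ≠ ∞) {X : ι → ℤ → ℝ≥0∞} {Y : ℤ → ℝ≥0∞} (hY : normSeq q Y ≠ ∞)
    (hXY : ∀ᶠ i in l, ∀ j, X i j ≤ Y j) (h : ∀ j, Tendsto (fun i => X i j) l (𝓝 0)) :
    Tendsto (fun i => normSeq q (X i)) l (𝓝 0) := by
  have h0 : 0 < q.toReal := zero_lt_one.trans_le (one_le_toReal hq hq')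
  simp only [normSeq_of_ne_top hq'] at hY ⊢
  have hsum : ∑' j, Y j ^ q.toReal ≠ ∞ := fun h' => hY (by simp [h', h0])
  have key : Tendsto (fun i => ∫⁻ j, X i j ^ q.toReal ∂Measure.count) l
      (𝓝 (∫⁻ j : ℤ, 0 ∂Measure.count)) := by
    refine tendsto_lintegral_filter_of_dominated_convergence (fun j => Y j ^ q.toReal)
      (Eventually.of_forall fun i => measurable_of_countable _) ?_ (by rwa [lintegral_count]) ?_
    · filter_upwards [hXY] with i hi
      exact ae_of_all _ fun j => ENNReal.rpow_le_rpow (hi j) h0.le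
    · refine ae_of_all _ fun j => ?_
      simpa [h0, Function.comp_def] using
        (ENNReal.continuous_rpow_const (y := q.toReal)).continuousAt.tendsto.comp
        (h j)
  simp only [lintegral_count, lintegral_zero] at key
  simpa [h0, Function.comp_def] using
    ((ENNReal.continuous_rpow_const (y := 1 / q.toReal)).tendsto 0).comp key

end

/-! ### Geometric sums over `ℤ` -/

theorem tsum_int_eq_nat (f : ℤ → ℝ≥0∞) (a : ℤ) :
    ∑' k : ℤ, (if a ≤ k then f k else 0) = ∑' n : ℕ, f (a + n) := by
  have hinj : Function.Injective (fun n : ℕ => a + (n : ℤ)) := fun x y h => by simpa using h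
  rw [← hinj.tsum_eq (f := fun k : ℤ => if a ≤ k then f k else 0)]
  · simp
  · intro k hk
    have : a ≤ k := by
      by_contra h
      simp [h] at hk
    exact ⟨(k - a).toNat, by simp [this]⟩

theorem two_rpow_ne_top (x : ℝ) : (2 : ℝ≥0∞) ^ x ≠ ∞ := by
  simp [ENNReal.rpow_eq_top_iff]

theorem two_rpow_add (x y : ℝ) : (2 : ℝ≥0∞) ^ (x + y) = 2 ^ x * 2 ^ y :=
  ENNReal.rpow_add _ _ (by simp) (by simp)

theorem two_rpow_mono {x y : ℝ} (h : x ≤ y) : (2 : ℝ≥0∞) ^ x ≤ 2 ^ y :=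
  ENNReal.rpow_le_rpow_of_exponent_le (by norm_num) h

theorem tsum_nat_two_rpow_ne_top {σ : ℝ} (hσ : 0 < σ) (b : ℝ) :
    ∑' n : ℕ, (2 : ℝ≥0∞) ^ (-(σ * n) + b) ≠ ∞ := by
  have h : ∀ n : ℕ, (2 : ℝ≥0∞) ^ (-(σ * n) + b) = ((2 : ℝ≥0∞) ^ (-σ)) ^ n * 2 ^ b := fun n => by
    rw [two_rpow_add, ← ENNReal.rpow_natCast, ← ENNReal.rpow_mul]
    congr 2; ring
  simp_rw [h]
  rw [ENNReal.tsum_mul_right, ENNReal.tsum_geometric]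
  refine ENNReal.mul_ne_top ?_ (two_rpow_ne_top _)
  rw [ENNReal.inv_ne_top, ← pos_iff_ne_zero, tsub_pos_iff_lt]
  exact ENNReal.rpow_lt_one_of_one_lt_of_neg (by norm_num) (by linarith)

theorem tsum_two_rpow_ge_ne_top {σ : ℝ} (hσ : 0 < σ) (a : ℤ) :
    ∑' k : ℤ, (if a ≤ k then (2 : ℝ≥0∞) ^ (-(σ * k)) else 0) ≠ ∞ := by
  rw [tsum_int_eq_nat]
  convert tsum_nat_two_rpow_ne_top hσ (-(σ * a)) using 4 with n
  push_cast; ring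

theorem tsum_two_rpow_le_ne_top {σ : ℝ} (hσ : 0 < σ) (a : ℤ) :
    ∑' k : ℤ, (if k ≤ a then (2 : ℝ≥0∞) ^ (σ * k) else 0) ≠ ∞ := by
  rw [← (Equiv.neg ℤ).tsum_eq]
  convert tsum_two_rpow_ge_ne_top hσ (-a) using 4 with k
  · simp [neg_le]
  · simp

/-! ### Littlewood–Paley pieces of nonnegative functions -/

/-- The symbol `φ (2^{-j} ξ)` of the dyadic block, as an element of `[0,∞]`. -/
noncomputable def cutoff (φ : R3 → ℝ) (j : ℤ) (ξ : R3) : ℝ≥0∞ :=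
  ENNReal.ofReal (φ ((2 : ℝ) ^ (-j) • ξ))

/-- The `L^p` norm of the `j`-th dyadic piece of `f`. -/
noncomputable def blockNorm (φ : R3 → ℝ) (p : ℝ≥0∞) (j : ℤ) (f : R3 → ℝ≥0∞) : ℝ≥0∞ :=
  eLpNorm (fun ξ => cutoff φ j ξ * f ξ) p volume

/-- The convolution of two nonnegative functions. -/
noncomputable def conv (f g : R3 → ℝ≥0∞) (ξ : R3) : ℝ≥0∞ := ∫⁻ η, f (ξ - η) * g η

/-- The part of `f` at frequencies well below `2^k`, as a sum of dyadic pieces. -/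
noncomputable def lowPart (φ : R3 → ℝ) (k : ℤ) (f : R3 → ℝ≥0∞) (ξ : R3) : ℝ≥0∞ :=
  ∑' i : ℤ, if i ≤ k - 3 then cutoff φ i ξ * f ξ else 0

/-- The part of `f` at frequencies comparable to `2^k`. The window `[k - 2, k + 1]` is not
symmetric, because the first factor of a product is taken to have the smaller frequency. -/
noncomputable def nearPart (φ : R3 → ℝ) (k : ℤ) (f : R3 → ℝ≥0∞) (ξ : R3) : ℝ≥0∞ :=
  ∑' i : ℤ, if k - 2 ≤ i ∧ i ≤ k + 1 then cutoff φ i ξ * f ξ else 0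

section

variable {φ : R3 → ℝ}

theorem measurable_cutoff (hφ : IsDyadicPartition φ) (j : ℤ) : Measurable (cutoff φ j) :=
  (hφ.contDiff.continuous.comp (continuous_const_smul _)).measurable.ennreal_ofReal

theorem cutoff_ne_zero (hφ : IsDyadicPartition φ) {j : ℤ} {ξ : R3} (h : cutoff φ j ξ ≠ 0) :
    3 / 4 * (2 : ℝ) ^ j ≤ ‖ξ‖ ∧ ‖ξ‖ ≤ 8 / 3 * (2 : ℝ) ^ j := by
  have h1 : φ ((2 : ℝ) ^ (-j) • ξ) ≠ 0 := fun h' => h (by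
    rw [cutoff, h', ENNReal.ofReal_zero])
  have h2 := hφ.tsupport_subset (subset_tsupport φ h1)
  have h3 : (0 : ℝ) < 2 ^ j := by positivity
  simp only [Set.mem_ofPred_eq, norm_smul, zpow_neg, norm_inv, Real.norm_of_nonneg h3.le] at h2
  rw [← div_eq_inv_mul, le_div_iff₀ h3, div_le_iff₀ h3] at h2
  exact h2

theorem tsum_cutoff (hφ : IsDyadicPartition φ) {ξ : R3} (hξ : ξ ≠ 0) : ∑' j, cutoff φ j ξ = 1 := by
  have h := hφ.hasSum ξ hξ
  simp only [cutoff]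
  rw [← ENNReal.ofReal_tsum_of_nonneg (fun j => hφ.nonneg _) h.summable, h.tsum_eq]
  simp

theorem tsum_cutoff_le (hφ : IsDyadicPartition φ) (ξ : R3) : ∑' j, cutoff φ j ξ ≤ 1 := by
  rcases eq_or_ne ξ 0 with rfl | h
  · have : ∀ j, cutoff φ j (0 : R3) = 0 := fun j => by
      by_contra h
      have := (cutoff_ne_zero hφ h).1
      have h3 : (0 : ℝ) < 2 ^ j := by positivity
      simp at this
      linarith
    simp [this]
  · exact (tsum_cutoff hφ h).le

theorem cutoff_le_one (hφ : IsDyadicPartition φ) (j : ℤ) (ξ : R3) : cutoff φ j ξ ≤ 1 :=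
  (ENNReal.le_tsum j).trans (tsum_cutoff_le hφ ξ)

theorem ofReal_two_zpow (j : ℤ) : ENNReal.ofReal ((2 : ℝ) ^ j) = (2 : ℝ≥0∞) ^ (j : ℝ) := by
  rw [← Real.rpow_intCast, ← ENNReal.ofReal_rpow_of_pos (by norm_num)]
  simp

/-- The volume factor in Bernstein's inequality. -/
noncomputable def bernsteinConst (η p : ℝ≥0∞) : ℝ≥0∞ :=
  volume (Metric.closedBall (0 : R3) (8 / 3)) ^ ((η⁻¹).toReal - (p⁻¹).toReal)

theorem toReal_inv_mono {η p : ℝ≥0∞} (hη : 1 ≤ η) (hηp : η ≤ p) :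
    (p⁻¹).toReal ≤ (η⁻¹).toReal := by
  refine ENNReal.toReal_mono ?_ (ENNReal.inv_le_inv.2 hηp)
  exact ENNReal.inv_ne_top.2 (zero_lt_one.trans_le hη).ne'

theorem bernsteinConst_ne_top {η p : ℝ≥0∞} (hη : 1 ≤ η) (hηp : η ≤ p) :
    bernsteinConst η p ≠ ∞ :=
  ENNReal.rpow_ne_top_of_nonneg (sub_nonneg.2 (toReal_inv_mono hη hηp))
    (isCompact_closedBall _ _).measure_lt_top.ne

/-- Bernstein's inequality on the Fourier side, i.e. Hölder's inequality on the support of the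
`j`-th dyadic piece. -/
theorem blockNorm_le_bernstein (hφ : IsDyadicPartition φ) {η p : ℝ≥0∞} (hη : 1 ≤ η) (hηp : η ≤ p)
    {f : R3 → ℝ≥0∞} (hf : Measurable f) (j : ℤ) :
    blockNorm φ η j f ≤
      bernsteinConst η p * 2 ^ (3 * (j : ℝ) * ((η⁻¹).toReal - (p⁻¹).toReal)) *
        blockNorm φ p j f := by
  set B : Set R3 := Metric.closedBall (0 : R3) ((2 : ℝ) ^ j * (8 / 3)) with hB
  have hsupp : Function.support (fun ξ => cutoff φ j ξ * f ξ) ⊆ B := by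
    intro ξ hξ
    have := (cutoff_ne_zero hφ (left_ne_zero_of_mul hξ)).2
    simp only [hB, Metric.mem_closedBall, dist_zero_right]
    linarith
  have hvol : volume B = (2 : ℝ≥0∞) ^ (3 * (j : ℝ)) *
      volume (Metric.closedBall (0 : R3) (8 / 3)) := by
    rw [hB, Measure.addHaar_closedBall_mul _ _ (by positivity) (by norm_num)]
    congr 1
    rw [finrank_euclideanSpace_fin, ENNReal.ofReal_pow (by positivity), ofReal_two_zpow,
      ← ENNReal.rpow_natCast, ← ENNReal.rpow_mul]
    congr 1; push_cast; ring
  have hexp : 0 ≤ (η⁻¹).toReal - (p⁻¹).toReal := sub_nonneg.2 (toReal_inv_mono hη hηp)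
  have hm : Measurable (fun ξ => cutoff φ j ξ * f ξ) := (measurable_cutoff hφ j).mul hf
  unfold blockNorm bernsteinConst
  calc eLpNorm (fun ξ => cutoff φ j ξ * f ξ) η volume
      = eLpNorm (fun ξ => cutoff φ j ξ * f ξ) η (volume.restrict B) :=
        (eLpNorm_restrict_eq_of_support_subset hsupp).symm
    _ ≤ eLpNorm (fun ξ => cutoff φ j ξ * f ξ) p (volume.restrict B) *
          (volume.restrict B) Set.univ ^ (1 / η.toReal - 1 / p.toReal) :=
        eLpNorm_le_eLpNorm_mul_rpow_measure_univ hηp hm.aestronglyMeasurable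
    _ = _ := by
        rw [eLpNorm_restrict_eq_of_support_subset hsupp, Measure.restrict_apply_univ, hvol, one_div,
          one_div, ← ENNReal.toReal_inv, ← ENNReal.toReal_inv,
          ENNReal.mul_rpow_of_nonneg _ _ hexp, ← ENNReal.rpow_mul]
        ring

/-! ### The paraproduct decomposition -/

/-- Frequency localisation of the paraproduct: in a product of pieces of frequencies `2^i ≲ 2^k`
that contributes at frequency `2^j`, either `i` is much smaller than `k`, and then `k` is close
to `j`, or `i` is close to `k`, and then `k` is at least about `j`. -/
theorem paraproduct_indices (hφ : IsDyadicPartition φ) {i j k : ℤ} {ξ η : R3}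
    (hle : ‖ξ - η‖ ≤ ‖η‖) (hj : cutoff φ j ξ ≠ 0) (hi : cutoff φ i (ξ - η) ≠ 0)
    (hk : cutoff φ k η ≠ 0) :
    (j - 2 ≤ k ∧ k ≤ j + 2 ∧ i ≤ k - 3) ∨ (j - 2 ≤ k ∧ k - 2 ≤ i ∧ i ≤ k + 1) := by
  obtain ⟨hj1, hj2⟩ := cutoff_ne_zero hφ hj
  obtain ⟨hi1, hi2⟩ := cutoff_ne_zero hφ hi
  obtain ⟨hk1, hk2⟩ := cutoff_ne_zero hφ hk
  have key : ∀ {m n : ℤ} {c : ℕ}, (2 : ℝ) ^ m < 2 ^ c * 2 ^ n → m < c + n := fun {m n c} h => by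
    rw [← zpow_natCast, ← zpow_add₀ (by norm_num)] at h
    exact (zpow_lt_zpow_iff_right₀ (by norm_num)).1 h
  have pi : (0 : ℝ) < 2 ^ i := by positivity
  have pj : (0 : ℝ) < 2 ^ j := by positivity
  have pk : (0 : ℝ) < 2 ^ k := by positivity
  have h1 : ‖ξ‖ ≤ ‖ξ - η‖ + ‖η‖ := by simpa using norm_add_le (ξ - η) η
  have h2 : ‖η‖ ≤ ‖ξ‖ + ‖ξ - η‖ := by
    simpa using norm_sub_le ξ (ξ - η)
  have hik : i < (2 : ℕ) + k := key (by norm_num; linarith)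
  have hjk : j < (3 : ℕ) + k := key (by norm_num; linarith)
  by_cases hlow : i ≤ k - 3
  · have h3 : (2 : ℝ) ^ i ≤ 2 ^ k / 8 := by
      calc (2 : ℝ) ^ i ≤ 2 ^ (k - 3) := zpow_le_zpow_right₀ (by norm_num) hlow
        _ = 2 ^ k / 8 := by rw [zpow_sub₀ (by norm_num)]; norm_num
    have hkj : k < (3 : ℕ) + j := key (by norm_num; linarith)
    left; push_cast at *; omega
  · right; push_cast at *; omega

theorem measurable_cutoff_mul (hφ : IsDyadicPartition φ) {f : R3 → ℝ≥0∞} (hf : Measurable f)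
    (j : ℤ) : Measurable fun ξ => cutoff φ j ξ * f ξ :=
  (measurable_cutoff hφ j).mul hf

theorem measurable_lowPart (hφ : IsDyadicPartition φ) {f : R3 → ℝ≥0∞} (hf : Measurable f)
    (k : ℤ) : Measurable (lowPart φ k f) := by
  refine Measurable.tsum fun i => ?_
  split_ifs
  · exact measurable_cutoff_mul hφ hf i
  · exact measurable_const

theorem measurable_nearPart (hφ : IsDyadicPartition φ) {f : R3 → ℝ≥0∞} (hf : Measurable f)
    (k : ℤ) : Measurable (nearPart φ k f) := by
  refine Measurable.tsum fun i => ?_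
  split_ifs
  · exact measurable_cutoff_mul hφ hf i
  · exact measurable_const

theorem measurable_conv {f g : R3 → ℝ≥0∞} (hf : Measurable f) (hg : Measurable g) :
    Measurable (conv f g) := by
  refine Measurable.lintegral_prod_right' (f := fun z : R3 × R3 => f (z.1 - z.2) * g z.2) ?_
  exact (hf.comp (measurable_fst.sub measurable_snd)).mul (hg.comp measurable_snd)

/-- Pointwise paraproduct decomposition of the integrand of `f * f`, for the half of the frequency
interactions where the second factor carries the higher frequency. -/
theorem cutoff_mul_mul_le (hφ : IsDyadicPartition φ) {f : R3 → ℝ≥0∞} {j : ℤ} {ξ η : R3}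
    (hle : ‖ξ - η‖ ≤ ‖η‖) (hne : ξ - η ≠ 0) :
    cutoff φ j ξ * (f (ξ - η) * f η) ≤
      ∑' k, ((if j - 2 ≤ k ∧ k ≤ j + 2 then
          lowPart φ k f (ξ - η) * (cutoff φ k η * f η) else 0) +
        if j - 2 ≤ k then
          cutoff φ j ξ * (nearPart φ k f (ξ - η) * (cutoff φ k η * f η)) else 0) := by
  by_cases hj : cutoff φ j ξ = 0
  · simp [hj]
  have hη : η ≠ 0 := by
    rintro rfl
    simp at hle
    simp [hle] at hne
  calc cutoff φ j ξ * (f (ξ - η) * f η)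
      = ∑' k, cutoff φ j ξ * (f (ξ - η) * (cutoff φ k η * f η)) := by
        rw [ENNReal.tsum_mul_left, ENNReal.tsum_mul_left, ENNReal.tsum_mul_right,
          tsum_cutoff hφ hη, one_mul]
    _ ≤ _ := by
        refine ENNReal.tsum_le_tsum fun k => ?_
        by_cases hk : cutoff φ k η = 0
        · simp [hk]
        calc cutoff φ j ξ * (f (ξ - η) * (cutoff φ k η * f η))
            = ∑' i, cutoff φ j ξ *
                (cutoff φ i (ξ - η) * f (ξ - η) * (cutoff φ k η * f η)) := by
              rw [ENNReal.tsum_mul_left, ENNReal.tsum_mul_right, ENNReal.tsum_mul_right,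
                tsum_cutoff hφ hne, one_mul]
          _ ≤ ∑' i, ((if j - 2 ≤ k ∧ k ≤ j + 2 then
                (if i ≤ k - 3 then cutoff φ i (ξ - η) * f (ξ - η) else 0) *
                  (cutoff φ k η * f η) else 0) +
                if j - 2 ≤ k then cutoff φ j ξ *
                  ((if k - 2 ≤ i ∧ i ≤ k + 1 then cutoff φ i (ξ - η) * f (ξ - η) else 0) *
                  (cutoff φ k η * f η)) else 0) := by
              refine ENNReal.tsum_le_tsum fun i => ?_
              by_cases hi : cutoff φ i (ξ - η) = 0
              · simp [hi]
              rcases paraproduct_indices hφ hle hj hi hk with ⟨h1, h2, h3⟩ | ⟨h1, h2, h3⟩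
              · rw [if_pos ⟨h1, h2⟩, if_pos h3]
                exact (mul_le_of_le_one_left' (cutoff_le_one hφ j ξ)).trans le_self_add
              · rw [if_pos (c := j - 2 ≤ k) h1, if_pos (c := k - 2 ≤ i ∧ i ≤ k + 1) ⟨h2, h3⟩]
                exact le_add_self
          _ = _ := by
              rw [ENNReal.tsum_add]
              congr 1
              · split_ifs
                · rw [ENNReal.tsum_mul_right]; rfl
                · simp
              · split_ifs
                · rw [ENNReal.tsum_mul_left, ENNReal.tsum_mul_right]; rfl
                · simp

/-- By symmetry, `f * f` is bounded by twice the part where the second factor carries the higher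
frequency. -/
theorem conv_self_le {f : R3 → ℝ≥0∞} (hf : Measurable f) (ξ : R3) :
    conv f f ξ ≤ 2 * ∫⁻ η, if ‖ξ - η‖ ≤ ‖η‖ then f (ξ - η) * f η else 0 := by
  set G : R3 → ℝ≥0∞ := fun η => if ‖ξ - η‖ ≤ ‖η‖ then f (ξ - η) * f η else 0 with hG
  have hGm : Measurable G := by
    refine Measurable.ite (measurableSet_le ?_ ?_) ?_ measurable_const
    · fun_prop
    · fun_prop
    · exact (hf.comp (measurable_const.sub measurable_id)).mul hf
  have h1 : conv f f ξ ≤ ∫⁻ η, G η + G (ξ - η) := by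
    refine lintegral_mono fun η => ?_
    simp only [hG, sub_sub_cancel]
    rcases le_total ‖ξ - η‖ ‖η‖ with h | h
    · rw [if_pos h]; exact le_self_add
    · rw [if_pos h, mul_comm (f η)]; exact le_add_self
  refine h1.trans (le_of_eq ?_)
  rw [lintegral_add_left hGm, lintegral_sub_left_eq_self G ξ, two_mul]

theorem cutoff_mul_conv_le (hφ : IsDyadicPartition φ) {f : R3 → ℝ≥0∞} (hf : Measurable f) (j : ℤ)
    (ξ : R3) :
    cutoff φ j ξ * conv f f ξ ≤ 2 *
      ∑' k, ((if j - 2 ≤ k ∧ k ≤ j + 2 then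
          conv (lowPart φ k f) (fun η => cutoff φ k η * f η) ξ else 0) +
        if j - 2 ≤ k then
          cutoff φ j ξ * conv (nearPart φ k f) (fun η => cutoff φ k η * f η) ξ else 0) := by
  have hl : ∀ k, Measurable fun η => lowPart φ k f (ξ - η) * (cutoff φ k η * f η) := fun k =>
    ((measurable_lowPart hφ hf k).comp (measurable_const.sub measurable_id)).mul
      (measurable_cutoff_mul hφ hf k)
  have hn : ∀ k, Measurable fun η => nearPart φ k f (ξ - η) * (cutoff φ k η * f η) := fun k =>
    ((measurable_nearPart hφ hf k).comp (measurable_const.sub measurable_id)).mul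
      (measurable_cutoff_mul hφ hf k)
  have hl' : ∀ k, Measurable fun η => if j - 2 ≤ k ∧ k ≤ j + 2 then
      lowPart φ k f (ξ - η) * (cutoff φ k η * f η) else 0 := fun k => by
    split_ifs
    · exact hl k
    · exact measurable_const
  have hn' : ∀ k, Measurable fun η => if j - 2 ≤ k then
      cutoff φ j ξ * (nearPart φ k f (ξ - η) * (cutoff φ k η * f η)) else 0 := fun k => by
    split_ifs
    · exact (hn k).const_mul _
    · exact measurable_const
  calc cutoff φ j ξ * conv f f ξ
      ≤ cutoff φ j ξ * (2 * ∫⁻ η, if ‖ξ - η‖ ≤ ‖η‖ then f (ξ - η) * f η else 0) := by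
        gcongr; exact conv_self_le hf ξ
    _ = 2 * (cutoff φ j ξ * ∫⁻ η, if ‖ξ - η‖ ≤ ‖η‖ then f (ξ - η) * f η else 0) := by ring
    _ = 2 * ∫⁻ η, cutoff φ j ξ * if ‖ξ - η‖ ≤ ‖η‖ then f (ξ - η) * f η else 0 := by
        rw [lintegral_const_mul']
        exact ne_top_of_le_ne_top ENNReal.one_ne_top (cutoff_le_one hφ j ξ)
    _ ≤ 2 * ∫⁻ η, ∑' k, ((if j - 2 ≤ k ∧ k ≤ j + 2 then
          lowPart φ k f (ξ - η) * (cutoff φ k η * f η) else 0) +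
        if j - 2 ≤ k then
          cutoff φ j ξ * (nearPart φ k f (ξ - η) * (cutoff φ k η * f η)) else 0) := by
        gcongr 2 * ?_
        refine lintegral_mono_ae ?_
        have h0 : ∀ᵐ η : R3, η ≠ ξ := by simp [ae_iff]
        filter_upwards [h0] with η hη
        by_cases hle : ‖ξ - η‖ ≤ ‖η‖
        · rw [if_pos hle]
          exact cutoff_mul_mul_le hφ hle (sub_ne_zero.2 hη.symm)
        · simp [hle]
    _ = _ := by
        rw [lintegral_tsum fun k => by exact ((hl' k).add (hn' k)).aemeasurable]
        congr 2
        funext k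
        rw [lintegral_add_left (hl' k)]
        congr 1
        · split_ifs
          · rfl
          · simp
        · split_ifs
          · rw [lintegral_const_mul _ (hn k)]; rfl
          · simp

/-- The high-high interaction at frequencies about `2^k`, localised at frequency `2^j`. -/
noncomputable def highHigh (φ : R3 → ℝ) (p : ℝ≥0∞) (j k : ℤ) (f : R3 → ℝ≥0∞) : ℝ≥0∞ :=
  blockNorm φ p j (conv (nearPart φ k f) (fun η => cutoff φ k η * f η))

theorem eLpNorm_lowPart_le (hφ : IsDyadicPartition φ) {f : R3 → ℝ≥0∞} (hf : Measurable f) (k : ℤ) :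
    eLpNorm (lowPart φ k f) 1 volume ≤
      ∑' i : ℤ, if i ≤ k - 3 then blockNorm φ 1 i f else 0 := by
  refine (eLpNorm_tsum_le (fun i => ?_) le_rfl ENNReal.one_ne_top).trans
    (ENNReal.tsum_le_tsum fun i => ?_)
  · split_ifs
    · exact measurable_cutoff_mul hφ hf i
    · exact measurable_const
  · split_ifs
    · exact le_rfl
    · simp

theorem eLpNorm_nearPart_le (hφ : IsDyadicPartition φ) {f : R3 → ℝ≥0∞} (hf : Measurable f) (k : ℤ) :
    eLpNorm (nearPart φ k f) 1 volume ≤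
      ∑' i : ℤ, if k - 2 ≤ i ∧ i ≤ k + 1 then blockNorm φ 1 i f else 0 := by
  refine (eLpNorm_tsum_le (fun i => ?_) le_rfl ENNReal.one_ne_top).trans
    (ENNReal.tsum_le_tsum fun i => ?_)
  · split_ifs
    · exact measurable_cutoff_mul hφ hf i
    · exact measurable_const
  · split_ifs
    · exact le_rfl
    · simp

theorem blockNorm_le_eLpNorm (hφ : IsDyadicPartition φ) (p : ℝ≥0∞) (f : R3 → ℝ≥0∞) (j : ℤ) :
    blockNorm φ p j f ≤ eLpNorm f p volume :=
  eLpNorm_mono_enorm fun ξ => by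
    simpa using mul_le_of_le_one_left' (cutoff_le_one hφ j ξ)

theorem highHigh_le (hφ : IsDyadicPartition φ) {f : R3 → ℝ≥0∞} (hf : Measurable f) {p : ℝ≥0∞}
    (hp : 1 ≤ p) (hp' : p ≠ ∞) (j k : ℤ) :
    highHigh φ p j k f ≤
      (∑' i : ℤ, if k - 2 ≤ i ∧ i ≤ k + 1 then blockNorm φ 1 i f else 0) * blockNorm φ p k f := by
  refine (blockNorm_le_eLpNorm hφ p _ j).trans ?_
  refine (eLpNorm_conv_le (measurable_nearPart hφ hf k) (measurable_cutoff_mul hφ hf k) hp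
    hp').trans ?_
  gcongr
  · exact eLpNorm_nearPart_le hφ hf k
  · exact le_rfl

/-- For `p = 1` the high-high interactions are summable over the output frequency. -/
theorem tsum_highHigh_le (hφ : IsDyadicPartition φ) {f : R3 → ℝ≥0∞} (hf : Measurable f) (k : ℤ) :
    ∑' j, highHigh φ 1 j k f ≤
      (∑' i : ℤ, if k - 2 ≤ i ∧ i ≤ k + 1 then blockNorm φ 1 i f else 0) * blockNorm φ 1 k f := by
  have hc := measurable_conv (measurable_nearPart hφ hf k) (measurable_cutoff_mul hφ hf k)
  calc ∑' j, highHigh φ 1 j k f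
      = ∫⁻ ξ, ∑' j, cutoff φ j ξ *
          conv (nearPart φ k f) (fun η => cutoff φ k η * f η) ξ := by
        rw [lintegral_tsum fun j => (measurable_cutoff_mul hφ hc j).aemeasurable]
        simp [highHigh, blockNorm, eLpNorm_one_eq_lintegral_enorm]
    _ ≤ eLpNorm (conv (nearPart φ k f) (fun η => cutoff φ k η * f η)) 1 volume := by
        rw [eLpNorm_one_eq_lintegral_enorm]
        refine lintegral_mono fun ξ => ?_
        rw [ENNReal.tsum_mul_right]
        exact mul_le_of_le_one_left' (tsum_cutoff_le hφ ξ)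
    _ ≤ _ := by
        refine (eLpNorm_conv_le (measurable_nearPart hφ hf k) (measurable_cutoff_mul hφ hf k)
          le_rfl ENNReal.one_ne_top).trans ?_
        gcongr
        · exact eLpNorm_nearPart_le hφ hf k
        · exact le_rfl

/-- The paraproduct estimate for the dyadic pieces of `f * f`. -/
theorem blockNorm_conv_le (hφ : IsDyadicPartition φ) {f : R3 → ℝ≥0∞} (hf : Measurable f)
    {p : ℝ≥0∞} (hp : 1 ≤ p) (hp' : p ≠ ∞) (j : ℤ) :
    blockNorm φ p j (conv f f) ≤ 2 *
      ∑' k, ((if j - 2 ≤ k ∧ k ≤ j + 2 then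
          (∑' i : ℤ, if i ≤ k - 3 then blockNorm φ 1 i f else 0) * blockNorm φ p k f else 0) +
        if j - 2 ≤ k then highHigh φ p j k f else 0) := by
  have hl : ∀ k, Measurable (conv (lowPart φ k f) (fun η => cutoff φ k η * f η)) := fun k =>
    measurable_conv (measurable_lowPart hφ hf k) (measurable_cutoff_mul hφ hf k)
  have hn : ∀ k, Measurable fun ξ =>
      cutoff φ j ξ * conv (nearPart φ k f) (fun η => cutoff φ k η * f η) ξ := fun k =>
    measurable_cutoff_mul hφ
      (measurable_conv (measurable_nearPart hφ hf k) (measurable_cutoff_mul hφ hf k)) j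
  have hl' : ∀ k, Measurable fun ξ => if j - 2 ≤ k ∧ k ≤ j + 2 then
      conv (lowPart φ k f) (fun η => cutoff φ k η * f η) ξ else 0 := fun k => by
    split_ifs
    · exact hl k
    · exact measurable_const
  have hn' : ∀ k, Measurable fun ξ => if j - 2 ≤ k then
      cutoff φ j ξ * conv (nearPart φ k f) (fun η => cutoff φ k η * f η) ξ else 0 := fun k => by
    split_ifs
    · exact hn k
    · exact measurable_const
  have h2 : blockNorm φ p j (conv f f) ≤ 2 * eLpNorm (fun ξ =>
      ∑' k, ((if j - 2 ≤ k ∧ k ≤ j + 2 then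
          conv (lowPart φ k f) (fun η => cutoff φ k η * f η) ξ else 0) +
        if j - 2 ≤ k then
          cutoff φ j ξ * conv (nearPart φ k f) (fun η => cutoff φ k η * f η) ξ else 0)) p
        volume :=
    eLpNorm_le_nnreal_smul_eLpNorm_of_ae_le_mul' (c := 2) (ae_of_all _ fun ξ => by
      simpa using cutoff_mul_conv_le hφ hf j ξ) p
  refine h2.trans ?_
  gcongr
  refine (eLpNorm_tsum_le (fun k => (hl' k).add (hn' k)) hp hp').trans
    (ENNReal.tsum_le_tsum fun k => ?_)
  refine (eLpNorm_add_le (hl' k).aestronglyMeasurable (hn' k).aestronglyMeasurable hp).trans ?_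
  gcongr ?_ + ?_
  · split_ifs
    · refine (eLpNorm_conv_le (measurable_lowPart hφ hf k) (measurable_cutoff_mul hφ hf k) hp
        hp').trans ?_
      gcongr
      · exact eLpNorm_lowPart_le hφ hf k
      · exact le_rfl
    · simp
  · split_ifs
    · exact le_rfl
    · simp

end

/-! ### Duhamel's formula on dyadic pieces -/

/-- Consequence of Duhamel's formula for the modulus `w` of the Fourier transform of a mild
solution: the heat flow of the initial value plus a heat integral of `|ξ| (w * w)(ξ)`. -/
structure IsDuhamelBounded (κ : ℝ) (K : ℝ≥0∞) (T : ℝ) (w : ℝ → R3 → ℝ≥0∞) : Prop where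
  measurable : Measurable (Function.uncurry w)
  bound : ∀ t ∈ Set.Icc 0 T, ∀ᵐ ξ, w t ξ ≤
    ENNReal.ofReal (Real.exp (-(κ * t * ‖ξ‖ ^ 2))) * w 0 ξ +
      ∫⁻ τ in Set.Ioc 0 t, ENNReal.ofReal (Real.exp (-(κ * (t - τ) * ‖ξ‖ ^ 2))) *
        (K * ENNReal.ofReal ‖ξ‖ * conv (w τ) (w τ) ξ)

theorem measurable_eLpNorm {α β : Type*} [MeasurableSpace α] [MeasurableSpace β] {ν : Measure β}
    [SFinite ν] {F : α → β → ℝ≥0∞} (hF : Measurable (Function.uncurry F)) {p : ℝ≥0∞} (hp : 1 ≤ p)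
    (hp' : p ≠ ∞) : Measurable fun x => eLpNorm (F x) p ν := by
  simp_rw [eLpNorm_eq_lintegral_rpow_enorm_toReal (zero_lt_one.trans_le hp).ne' hp', enorm_eq_self]
  exact (Measurable.lintegral_prod_right' (f := fun z : α × β => F z.1 z.2 ^ p.toReal)
      (hF.pow_const _)).pow_const _

section

variable {φ : R3 → ℝ} {w : ℝ → R3 → ℝ≥0∞}

theorem measurable_uncurry_conv {f g : ℝ → R3 → ℝ≥0∞} (hf : Measurable (Function.uncurry f))
    (hg : Measurable (Function.uncurry g)) :
    Measurable (Function.uncurry fun τ => conv (f τ) (g τ)) := by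
  refine Measurable.lintegral_prod_right'
    (f := fun z : (ℝ × R3) × R3 => f z.1.1 (z.1.2 - z.2) * g z.1.1 z.2) ?_
  have h1 : Measurable fun z : (ℝ × R3) × R3 => (z.1.1, z.1.2 - z.2) := by fun_prop
  have h2 : Measurable fun z : (ℝ × R3) × R3 => (z.1.1, z.2) := by fun_prop
  exact (hf.comp h1).mul (hg.comp h2)

theorem measurable_uncurry_cutoff_mul (hφ : IsDyadicPartition φ)
    (hw : Measurable (Function.uncurry w)) (j : ℤ) :
    Measurable (Function.uncurry fun τ ξ => cutoff φ j ξ * w τ ξ) :=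
  ((measurable_cutoff hφ j).comp measurable_snd).mul hw

theorem measurable_blockNorm (hφ : IsDyadicPartition φ) (hw : Measurable (Function.uncurry w))
    {p : ℝ≥0∞} (hp : 1 ≤ p) (hp' : p ≠ ∞) (j : ℤ) :
    Measurable fun τ => blockNorm φ p j (w τ) :=
  measurable_eLpNorm (measurable_uncurry_cutoff_mul hφ hw j) hp hp'

theorem measurable_highHigh (hφ : IsDyadicPartition φ) (hw : Measurable (Function.uncurry w))
    {p : ℝ≥0∞} (hp : 1 ≤ p) (hp' : p ≠ ∞) (j k : ℤ) :
    Measurable fun τ => highHigh φ p j k (w τ) := by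
  refine measurable_blockNorm (w := fun τ => conv (nearPart φ k (w τ))
    (fun η => cutoff φ k η * w τ η)) hφ (measurable_uncurry_conv ?_
    (measurable_uncurry_cutoff_mul hφ hw k)) hp hp' j
  refine Measurable.tsum (f := fun i (z : ℝ × R3) =>
    if k - 2 ≤ i ∧ i ≤ k + 1 then cutoff φ i z.2 * w z.1 z.2 else 0) fun i => ?_
  split_ifs
  · exact measurable_uncurry_cutoff_mul hφ hw i
  · exact measurable_const

theorem lintegral_heat_le {b : ℝ} (hb : 0 < b) (t : ℝ) :
    ∫⁻ τ in Set.Ioc 0 t, ENNReal.ofReal (Real.exp (-(b * (t - τ)))) ≤ ENNReal.ofReal (1 / b) := by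
  rcases le_or_gt t 0 with ht | ht
  · simp [Set.Ioc_eq_empty (not_lt.2 ht)]
  have hint : IntegrableOn (fun τ => Real.exp (-(b * (t - τ)))) (Set.Ioc 0 t) :=
    (Continuous.integrableOn_Icc (by fun_prop)).mono_set Set.Ioc_subset_Icc_self
  rw [← ofReal_integral_eq_lintegral_ofReal hint (ae_of_all _ fun τ => (Real.exp_pos _).le),
    ← intervalIntegral.integral_of_le ht.le]
  refine ENNReal.ofReal_le_ofReal ?_
  have hd : ∀ τ ∈ Set.uIcc 0 t, HasDerivAt (fun τ => Real.exp (-(b * (t - τ))) / b)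
      (Real.exp (-(b * (t - τ)))) τ := fun τ _ => by
    have h1 : HasDerivAt (fun τ => -(b * (t - τ))) b τ := by
      simpa using (((hasDerivAt_id τ).const_sub t).const_mul b).fun_neg
    simpa [mul_div_assoc, hb.ne'] using h1.exp.div_const b
  rw [intervalIntegral.integral_eq_sub_of_hasDerivAt hd
    ((by fun_prop : Continuous fun τ => Real.exp (-(b * (t - τ)))).intervalIntegrable _ _)]
  have := Real.exp_pos (-(b * (t - 0)))
  simp only [sub_self, mul_zero, neg_zero, Real.exp_zero]
  have : 0 ≤ Real.exp (-(b * (t - 0))) / b := by positivity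
  linarith

/-- The lower bound `|ξ|² ≥ (9/16) 4^j` on the support of the `j`-th cutoff gives the heat kernel
decay at rate `(9/16) κ 4^j`. -/
theorem heat_le_on_cutoff (hφ : IsDyadicPartition φ) {κ t : ℝ} (hκ : 0 < κ) (ht : 0 ≤ t) {j : ℤ}
    {ξ : R3} (h : cutoff φ j ξ ≠ 0) :
    ENNReal.ofReal (Real.exp (-(κ * t * ‖ξ‖ ^ 2))) ≤
      ENNReal.ofReal (Real.exp (-(9 / 16 * κ * ((2 : ℝ) ^ j) ^ 2 * t))) := by
  refine ENNReal.ofReal_le_ofReal (Real.exp_le_exp.2 (neg_le_neg ?_))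
  have h1 := (cutoff_ne_zero hφ h).1
  have h3 : (0 : ℝ) < 2 ^ j := by positivity
  have h2 : (3 / 4 * (2 : ℝ) ^ j) ^ 2 ≤ ‖ξ‖ ^ 2 := by gcongr
  have h4 : 0 ≤ κ * t := by positivity
  nlinarith [mul_le_mul_of_nonneg_left h2 h4]

/-- Duhamel's formula for a single dyadic piece: the heat flow decays like `exp (-c 4^j t)`, and the
derivative in the nonlinear term costs a factor `2^j`. -/
theorem blockNorm_duhamel (hφ : IsDyadicPartition φ) {κ : ℝ} (hκ : 0 < κ) {K : ℝ≥0∞} {T : ℝ}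
    (hw : IsDuhamelBounded κ K T w) {p : ℝ≥0∞} (hp : 1 ≤ p) (hp' : p ≠ ∞) (j : ℤ) {t : ℝ}
    (ht : t ∈ Set.Icc 0 T) :
    blockNorm φ p j (w t) ≤
      ENNReal.ofReal (Real.exp (-(9 / 16 * κ * ((2 : ℝ) ^ j) ^ 2 * t))) * blockNorm φ p j (w 0) +
      ∫⁻ τ in Set.Ioc 0 t, ENNReal.ofReal (Real.exp (-(9 / 16 * κ * ((2 : ℝ) ^ j) ^ 2 * (t - τ)))) *
        (K * ENNReal.ofReal (8 / 3 * (2 : ℝ) ^ j)) * blockNorm φ p j (conv (w τ) (w τ)) := by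
  set E : ℝ → ℝ≥0∞ := fun t => ENNReal.ofReal (Real.exp (-(9 / 16 * κ * ((2 : ℝ) ^ j) ^ 2 * t)))
    with hE
  have hEm : Measurable E := by fun_prop
  set K' := K * ENNReal.ofReal (8 / 3 * (2 : ℝ) ^ j) with hK'
  have hcm := measurable_uncurry_conv hw.measurable hw.measurable
  have hFm : Measurable (Function.uncurry fun τ ξ =>
      E (t - τ) * K' * (cutoff φ j ξ * conv (w τ) (w τ) ξ)) :=
    ((hEm.comp (measurable_const.sub measurable_fst)).mul_const K').mul
      (measurable_uncurry_cutoff_mul hφ hcm j)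
  have hw0 : Measurable fun ξ => E t * (cutoff φ j ξ * w 0 ξ) :=
    (measurable_cutoff_mul hφ (hw.measurable.comp measurable_prodMk_left) j).const_mul _
  have hpt : ∀ᵐ ξ, cutoff φ j ξ * w t ξ ≤ E t * (cutoff φ j ξ * w 0 ξ) +
      ∫⁻ τ in Set.Ioc 0 t, E (t - τ) * K' * (cutoff φ j ξ * conv (w τ) (w τ) ξ) := by
    filter_upwards [hw.bound t ht] with ξ hξ
    by_cases hj : cutoff φ j ξ = 0
    · simp [hj]
    have hjt : cutoff φ j ξ ≠ ∞ := ne_top_of_le_ne_top ENNReal.one_ne_top (cutoff_le_one hφ j ξ)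
    calc cutoff φ j ξ * w t ξ ≤ cutoff φ j ξ * _ := mul_le_mul_right hξ _
      _ ≤ _ := by
        rw [mul_add, ← lintegral_const_mul' _ _ hjt]
        refine add_le_add ?_ (setLIntegral_mono_ae' measurableSet_Ioc (ae_of_all _ fun τ hτ => ?_))
        · rw [mul_left_comm]
          gcongr
          exact heat_le_on_cutoff hφ hκ ht.1 hj
        · have h1 := heat_le_on_cutoff hφ hκ (sub_nonneg.2 hτ.2) hj
          have h2 := ENNReal.ofReal_le_ofReal (cutoff_ne_zero hφ hj).2
          calc _ ≤ cutoff φ j ξ * (E (t - τ) * (K' * conv (w τ) (w τ) ξ)) := by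
                rw [hK']; gcongr
            _ = _ := by ring
  calc blockNorm φ p j (w t)
      ≤ eLpNorm (fun ξ => E t * (cutoff φ j ξ * w 0 ξ) +
        ∫⁻ τ in Set.Ioc 0 t, E (t - τ) * K' * (cutoff φ j ξ * conv (w τ) (w τ) ξ)) p volume :=
        eLpNorm_mono_enorm_ae (by simpa using hpt)
    _ ≤ eLpNorm (fun ξ => E t * (cutoff φ j ξ * w 0 ξ)) p volume +
        eLpNorm (fun ξ => ∫⁻ τ in Set.Ioc 0 t,
          E (t - τ) * K' * (cutoff φ j ξ * conv (w τ) (w τ) ξ)) p volume :=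
        eLpNorm_add_le hw0.aestronglyMeasurable
          (hFm.comp measurable_swap).lintegral_prod_right'.aestronglyMeasurable hp
    _ ≤ _ := by
        refine add_le_add ?_ ((eLpNorm_lintegral_le hFm hp hp').trans ?_)
        · exact (eLpNorm_const_mul hp hp' _
            (measurable_cutoff_mul hφ (hw.measurable.comp measurable_prodMk_left) j)).le
        · refine lintegral_mono fun τ => ?_
          exact (eLpNorm_const_mul hp hp' _
            (measurable_cutoff_mul hφ (hcm.comp measurable_prodMk_left) j)).le

/-- The truncation `min (4^j, 4^n)` of the smoothing weight `4^j`. The truncated weighted norms of a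
solution are finite a priori. -/
noncomputable def truncWeight (n : ℕ) (j : ℤ) : ℝ≥0∞ :=
  min (2 ^ (2 * (j : ℝ))) (2 ^ (2 * (n : ℝ)))

theorem truncWeight_le (n : ℕ) (j : ℤ) : truncWeight n j ≤ 2 ^ (2 * (j : ℝ)) := min_le_left _ _

theorem truncWeight_ne_top (n : ℕ) (j : ℤ) : truncWeight n j ≠ ∞ :=
  ne_top_of_le_ne_top (two_rpow_ne_top _) (truncWeight_le n j)

/-- The truncated weight is almost increasing in `j`, as the high-high interactions require. -/
theorem truncWeight_le_mul (n : ℕ) {j k : ℤ} (h : j - 2 ≤ k) :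
    truncWeight n j ≤ 16 * truncWeight n k := by
  have h16 : (16 : ℝ≥0∞) = 2 ^ (4 : ℝ) := by
    rw [show (4 : ℝ) = (4 : ℕ) by norm_num, ENNReal.rpow_natCast]; norm_num
  have hjk : (j : ℝ) - 2 ≤ k := by exact_mod_cast h
  unfold truncWeight
  rw [mul_min]
  refine min_le_min ?_ ?_
  · rw [h16, ← two_rpow_add]
    exact two_rpow_mono (by linarith)
  · rw [h16, ← two_rpow_add]
    exact two_rpow_mono (by linarith)

theorem two_rpow_two_mul (j : ℤ) :
    (2 : ℝ≥0∞) ^ (2 * (j : ℝ)) = ENNReal.ofReal (((2 : ℝ) ^ j) ^ 2) := by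
  rw [ENNReal.ofReal_pow (by positivity), ofReal_two_zpow, ← ENNReal.rpow_natCast,
    ← ENNReal.rpow_mul]
  congr 1; push_cast; ring

theorem mul_exp_neg_le {c x : ℝ} (hc : 0 < c) : x * Real.exp (-(c * x)) ≤ 1 / c := by
  have h1 : c * x ≤ Real.exp (c * x) := (by linarith [Real.add_one_le_exp (c * x)])
  rw [Real.exp_neg, ← div_eq_mul_inv, div_le_div_iff₀ (Real.exp_pos _) hc]
  linarith

/-- Splitting `t = (t - τ) + τ`, where the factor `t - τ` is absorbed by the heat kernel. -/
theorem truncWeight_mul_heat_le {c : ℝ} (hc : 0 < c) (n : ℕ) (j : ℤ) {t τ : ℝ} (hτ : 0 ≤ τ)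
    (hτt : τ ≤ t) :
    truncWeight n j * ENNReal.ofReal t *
        ENNReal.ofReal (Real.exp (-(c * ((2 : ℝ) ^ j) ^ 2 * (t - τ)))) ≤
      ENNReal.ofReal (1 / c) + truncWeight n j * (ENNReal.ofReal τ *
        ENNReal.ofReal (Real.exp (-(c * ((2 : ℝ) ^ j) ^ 2 * (t - τ))))) := by
  set L : ℝ := ((2 : ℝ) ^ j) ^ 2 with hL
  have hLp : 0 < L := by positivity
  have h1 : truncWeight n j * (ENNReal.ofReal (t - τ) *
      ENNReal.ofReal (Real.exp (-(c * L * (t - τ))))) ≤ ENNReal.ofReal (1 / c) := by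
    calc _ ≤ ENNReal.ofReal L * (ENNReal.ofReal (t - τ) *
          ENNReal.ofReal (Real.exp (-(c * L * (t - τ))))) := by
          gcongr; rw [hL, ← two_rpow_two_mul]; exact truncWeight_le n j
      _ = ENNReal.ofReal (L * (t - τ) * Real.exp (-(c * (L * (t - τ))))) := by
          rw [← ENNReal.ofReal_mul (by linarith), ← ENNReal.ofReal_mul hLp.le]
          congr 1; rw [← mul_assoc c]; ring
      _ ≤ _ := ENNReal.ofReal_le_ofReal (mul_exp_neg_le hc)
  calc _ = truncWeight n j * (ENNReal.ofReal (t - τ) *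
        ENNReal.ofReal (Real.exp (-(c * L * (t - τ))))) + truncWeight n j * (ENNReal.ofReal τ *
        ENNReal.ofReal (Real.exp (-(c * L * (t - τ))))) := by
        have : ENNReal.ofReal t = ENNReal.ofReal (t - τ) + ENNReal.ofReal τ := by
          rw [← ENNReal.ofReal_add (by linarith) hτ]; congr 1; ring
        rw [this]; ring
    _ ≤ _ := by gcongr

end

/-! ### Time norms of the dyadic pieces -/

/-- The `L^∞` norm in time of the `k`-th dyadic piece. -/
noncomputable def supBlock (φ : R3 → ℝ) (p : ℝ≥0∞) (T : ℝ) (w : ℝ → R3 → ℝ≥0∞) (k : ℤ) : ℝ≥0∞ :=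
  essSup (fun t => blockNorm φ p k (w t)) (volume.restrict (Set.Icc 0 T))

/-- The `L¹` norm in time of the `k`-th dyadic piece. -/
noncomputable def intBlock (φ : R3 → ℝ) (p : ℝ≥0∞) (T : ℝ) (w : ℝ → R3 → ℝ≥0∞) (k : ℤ) : ℝ≥0∞ :=
  ∫⁻ t in Set.Icc 0 T, blockNorm φ p k (w t)

/-- The `L^∞` norm in time, with weight `t`, of the `k`-th dyadic piece. -/
noncomputable def smoothBlock (φ : R3 → ℝ) (p : ℝ≥0∞) (T : ℝ) (w : ℝ → R3 → ℝ≥0∞) (k : ℤ) :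
    ℝ≥0∞ :=
  essSup (fun t => ENNReal.ofReal t * blockNorm φ p k (w t)) (volume.restrict (Set.Icc 0 T))

/-- Bernstein's bound for the `L^∞_t L¹_ξ` norm of the part of `w` at frequencies below `2^k`. -/
noncomputable def lowSum (φ : R3 → ℝ) (p : ℝ≥0∞) (T : ℝ) (w : ℝ → R3 → ℝ≥0∞) (k : ℤ) : ℝ≥0∞ :=
  ∑' i : ℤ, if i ≤ k - 3 then
    bernsteinConst 1 p * 2 ^ ((i : ℝ) * (1 + critExp p)) * supBlock φ p T w i else 0

/-- `L¹` in time norm of a high-high interaction. -/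
noncomputable def intHighHigh (φ : R3 → ℝ) (p : ℝ≥0∞) (T : ℝ) (w : ℝ → R3 → ℝ≥0∞) (j k : ℤ) :
    ℝ≥0∞ :=
  ∫⁻ t in Set.Icc 0 T, highHigh φ p j k (w t)

/-- `L¹` in time norm, with weight `t`, of a high-high interaction. -/
noncomputable def smoothHighHigh (φ : R3 → ℝ) (p : ℝ≥0∞) (T : ℝ) (w : ℝ → R3 → ℝ≥0∞) (j k : ℤ) :
    ℝ≥0∞ :=
  ∫⁻ t in Set.Icc 0 T, ENNReal.ofReal t * highHigh φ p j k (w t)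

section

variable {φ : R3 → ℝ} {w : ℝ → R3 → ℝ≥0∞} {p : ℝ≥0∞} {T : ℝ}

theorem ae_le_supBlock (k : ℤ) :
    ∀ᵐ t ∂volume.restrict (Set.Icc 0 T), blockNorm φ p k (w t) ≤ supBlock φ p T w k :=
  ae_le_essSup

theorem ae_le_smoothBlock (k : ℤ) :
    ∀ᵐ t ∂volume.restrict (Set.Icc 0 T),
      ENNReal.ofReal t * blockNorm φ p k (w t) ≤ smoothBlock φ p T w k :=
  ae_le_essSup

theorem blockNorm_one_le (hφ : IsDyadicPartition φ) (hp : 1 ≤ p) {f : R3 → ℝ≥0∞}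
    (hf : Measurable f) (i : ℤ) :
    blockNorm φ 1 i f ≤
      bernsteinConst 1 p * 2 ^ ((i : ℝ) * (1 + critExp p)) * blockNorm φ p i f := by
  refine (blockNorm_le_bernstein hφ le_rfl hp hf i).trans (le_of_eq ?_)
  congr 3
  simp [critExp]; ring

theorem ae_le_lowSum (hφ : IsDyadicPartition φ) (hw : Measurable (Function.uncurry w)) (hp : 1 ≤ p)
    (k : ℤ) :
    ∀ᵐ t ∂volume.restrict (Set.Icc 0 T),
      (∑' i : ℤ, if i ≤ k - 3 then blockNorm φ 1 i (w t) else 0) ≤ lowSum φ p T w k := by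
  filter_upwards [ae_all_iff.2 fun i => ae_le_supBlock (φ := φ) (w := w) (p := p) (T := T) i]
    with t ht
  refine ENNReal.tsum_le_tsum fun i => ?_
  split_ifs
  · refine (blockNorm_one_le hφ hp (hw.comp measurable_prodMk_left) i).trans ?_
    gcongr
    exact ht i
  · exact le_rfl

/-- The trivial bound of the smoothing norms, used at low frequencies. -/
theorem smoothBlock_le (k : ℤ) :
    smoothBlock φ p T w k ≤ ENNReal.ofReal T * supBlock φ p T w k := by
  refine essSup_le_of_ae_le _ ?_
  filter_upwards [ae_le_supBlock (φ := φ) (w := w) (p := p) (T := T) k,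
    ae_restrict_mem measurableSet_Icc] with t h1 h2
  exact mul_le_mul' (ENNReal.ofReal_le_ofReal h2.2) h1

/-- The smoothing inequality on dyadic pieces: paraproduct estimates inserted into Duhamel's
formula, with the truncated weight `min (4^j, 4^n)`. -/
theorem truncWeight_mul_smoothBlock_le (hφ : IsDyadicPartition φ) {κ : ℝ} (hκ : 0 < κ) {K : ℝ≥0∞}
    (hw : IsDuhamelBounded κ K T w) (hp : 1 ≤ p) (hp' : p ≠ ∞) (n : ℕ) (j : ℤ) :
    truncWeight n j * smoothBlock φ p T w j ≤
      ENNReal.ofReal (1 / (9 / 16 * κ)) * blockNorm φ p j (w 0) +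
      K * ENNReal.ofReal (8 / 3 * (2 : ℝ) ^ j) * 2 *
        ∑' k, ((if j - 2 ≤ k ∧ k ≤ j + 2 then ENNReal.ofReal (1 / (9 / 16 * κ)) *
            (lowSum φ p T w k * intBlock φ p T w k +
              truncWeight n j * 2 ^ (-(2 * (j : ℝ))) *
                (lowSum φ p T w k * smoothBlock φ p T w k)) else 0) +
          if j - 2 ≤ k then ENNReal.ofReal (1 / (9 / 16 * κ)) * intHighHigh φ p T w j k +
            truncWeight n j * smoothHighHigh φ p T w j k else 0) := by
  set c : ℝ := 9 / 16 * κ with hc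
  have hc0 : 0 < c := by positivity
  set Ω := truncWeight n j with hΩ
  set C0 := ENNReal.ofReal (1 / c) with hC0
  set L : ℝ := ((2 : ℝ) ^ j) ^ 2 with hL
  have hLp : 0 < L := by positivity
  have hmw := hw.measurable
  have hwt : ∀ t, Measurable (w t) := fun t => hmw.comp measurable_prodMk_left
  rw [show smoothBlock φ p T w j = essSup (fun t => ENNReal.ofReal t * blockNorm φ p j (w t))
    (volume.restrict (Set.Icc 0 T)) from rfl, ← ENNReal.essSup_const_mul]
  refine essSup_le_of_ae_le _ ?_
  filter_upwards [ae_restrict_mem measurableSet_Icc] with t ht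
  set E : ℝ → ℝ≥0∞ := fun τ => ENNReal.ofReal (Real.exp (-(c * L * (t - τ)))) with hE
  have hEm : Measurable E := by fun_prop
  set K' := K * ENNReal.ofReal (8 / 3 * (2 : ℝ) ^ j) with hK'
  have hsub : Set.Ioc 0 t ⊆ Set.Icc 0 T := fun τ hτ => ⟨hτ.1.le, hτ.2.trans ht.2⟩
  -- the weight that multiplies the nonlinear term under the integral
  set W : ℝ → ℝ≥0∞ := fun τ => C0 + Ω * (ENNReal.ofReal τ * E τ) with hW
  have hWm : Measurable W := by fun_prop
  set B : ℤ → ℝ → ℝ≥0∞ := fun k τ => ∑' i : ℤ, if i ≤ k - 3 then blockNorm φ 1 i (w τ) else 0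
    with hB
  have hBm : ∀ k, Measurable (B k) := fun k => by
    refine Measurable.tsum fun i => ?_
    split_ifs
    · exact measurable_blockNorm hφ hmw le_rfl ENNReal.one_ne_top i
    · exact measurable_const
  have ham : ∀ k, Measurable fun τ => blockNorm φ p k (w τ) := fun k =>
    measurable_blockNorm hφ hmw hp hp' k
  have hhm : ∀ k, Measurable fun τ => highHigh φ p j k (w τ) := fun k =>
    measurable_highHigh hφ hmw hp hp' j k
  set G : ℤ → ℝ → ℝ≥0∞ := fun k τ =>
    (if j - 2 ≤ k ∧ k ≤ j + 2 then B k τ * blockNorm φ p k (w τ) else 0) +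
      if j - 2 ≤ k then highHigh φ p j k (w τ) else 0 with hG
  have hGm : ∀ k, Measurable (G k) := fun k => by
    refine Measurable.add ?_ ?_
    · split_ifs
      · exact (hBm k).mul (ham k)
      · exact measurable_const
    · split_ifs
      · exact hhm k
      · exact measurable_const
  calc Ω * (ENNReal.ofReal t * blockNorm φ p j (w t))
      ≤ Ω * (ENNReal.ofReal t * (ENNReal.ofReal (Real.exp (-(c * L * t))) * blockNorm φ p j (w 0) +
        ∫⁻ τ in Set.Ioc 0 t, E τ * K' * blockNorm φ p j (conv (w τ) (w τ)))) := by
        gcongr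
        exact blockNorm_duhamel hφ hκ hw hp hp' j ht
    _ = Ω * ENNReal.ofReal t * ENNReal.ofReal (Real.exp (-(c * L * (t - 0)))) *
          blockNorm φ p j (w 0) +
        ∫⁻ τ in Set.Ioc 0 t, Ω * ENNReal.ofReal t * E τ *
          (K' * blockNorm φ p j (conv (w τ) (w τ))) := by
        rw [sub_zero, mul_add, mul_add, ← lintegral_const_mul' _ _ ENNReal.ofReal_ne_top,
          ← lintegral_const_mul' _ _ (truncWeight_ne_top n j)]
        congr 1
        · ring
        · refine lintegral_congr fun τ => ?_
          ring
    _ ≤ C0 * blockNorm φ p j (w 0) + ∫⁻ τ in Set.Ioc 0 t, W τ * (K' * (2 * ∑' k, G k τ)) := by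
        refine add_le_add ?_ (setLIntegral_mono' measurableSet_Ioc fun τ hτ => ?_)
        · gcongr
          simpa only [ENNReal.ofReal_zero, zero_mul, mul_zero, add_zero] using
            truncWeight_mul_heat_le hc0 n j le_rfl ht.1
        · refine mul_le_mul' ?_ ?_
          · exact truncWeight_mul_heat_le hc0 n j hτ.1.le hτ.2
          · gcongr
            exact blockNorm_conv_le hφ (hwt τ) hp hp' j
    _ = C0 * blockNorm φ p j (w 0) + K' * 2 * ∑' k, ∫⁻ τ in Set.Ioc 0 t, W τ * G k τ := by
        congr 1
        rw [← lintegral_tsum fun k => by exact (hWm.mul (hGm k)).aemeasurable,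
          ← lintegral_const_mul _ (by exact Measurable.tsum fun k => hWm.mul (hGm k))]
        refine lintegral_congr fun τ => ?_
        rw [ENNReal.tsum_mul_left]
        ring
    _ ≤ _ := by
        gcongr with k
        have hsplit : ∫⁻ τ in Set.Ioc 0 t, W τ * G k τ =
            (if j - 2 ≤ k ∧ k ≤ j + 2 then
              ∫⁻ τ in Set.Ioc 0 t, W τ * (B k τ * blockNorm φ p k (w τ)) else 0) +
            if j - 2 ≤ k then ∫⁻ τ in Set.Ioc 0 t, W τ * highHigh φ p j k (w τ) else 0 := by
          simp only [hG]
          split_ifs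
          · simp only [mul_add]
            rw [lintegral_add_left (by exact hWm.mul ((hBm k).mul (ham k)))]
          all_goals simp
        rw [hsplit]
        refine add_le_add ?_ ?_
        · split_ifs
          swap
          · exact le_rfl
          have hl := ae_restrict_of_ae_restrict_of_subset hsub
            (ae_le_lowSum (T := T) hφ hmw hp k)
          have hs := ae_restrict_of_ae_restrict_of_subset hsub
            (ae_le_smoothBlock (φ := φ) (w := w) (p := p) (T := T) k)
          calc ∫⁻ τ in Set.Ioc 0 t, W τ * (B k τ * blockNorm φ p k (w τ))
              ≤ ∫⁻ τ in Set.Ioc 0 t, (C0 * lowSum φ p T w k * blockNorm φ p k (w τ) +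
                  Ω * (lowSum φ p T w k * smoothBlock φ p T w k) * E τ) := by
                refine lintegral_mono_ae ?_
                filter_upwards [hl, hs] with τ h1 h2
                calc W τ * (B k τ * blockNorm φ p k (w τ))
                    = C0 * B k τ * blockNorm φ p k (w τ) +
                      Ω * (B k τ * (ENNReal.ofReal τ * blockNorm φ p k (w τ))) * E τ := by
                      simp only [hW]; ring
                  _ ≤ _ := by gcongr
            _ = C0 * lowSum φ p T w k * (∫⁻ τ in Set.Ioc 0 t, blockNorm φ p k (w τ)) +
                  Ω * (lowSum φ p T w k * smoothBlock φ p T w k) * ∫⁻ τ in Set.Ioc 0 t, E τ := by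
                rw [lintegral_add_right _ (hEm.const_mul _), lintegral_const_mul _ (ham k),
                  lintegral_const_mul _ hEm]
            _ ≤ C0 * lowSum φ p T w k * intBlock φ p T w k +
                  Ω * (lowSum φ p T w k * smoothBlock φ p T w k) *
                    (C0 * 2 ^ (-(2 * (j : ℝ)))) := by
                gcongr
                · exact lintegral_mono_set hsub
                · refine (lintegral_heat_le (by positivity) t).trans (le_of_eq ?_)
                  rw [ENNReal.rpow_neg, two_rpow_two_mul, hC0, ← ENNReal.ofReal_inv_of_pos hLp,
                    ← ENNReal.ofReal_mul (by positivity)]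
                  congr 1
                  field_simp
            _ = _ := by ring
        · split_ifs
          swap
          · exact le_rfl
          calc ∫⁻ τ in Set.Ioc 0 t, W τ * highHigh φ p j k (w τ)
              ≤ ∫⁻ τ in Set.Icc 0 T, (C0 * highHigh φ p j k (w τ) +
                  Ω * (ENNReal.ofReal τ * highHigh φ p j k (w τ))) := by
                refine le_trans (setLIntegral_mono' measurableSet_Ioc fun τ hτ => ?_)
                  (lintegral_mono_set hsub)
                have hE1 : E τ ≤ 1 := by
                  rw [hE, ← ENNReal.ofReal_one]
                  refine ENNReal.ofReal_le_ofReal (Real.exp_le_one_iff.2 ?_)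
                  have : 0 ≤ t - τ := sub_nonneg.2 hτ.2
                  have : 0 ≤ c * L * (t - τ) := by positivity
                  linarith
                calc W τ * highHigh φ p j k (w τ)
                    = C0 * highHigh φ p j k (w τ) +
                      Ω * (ENNReal.ofReal τ * highHigh φ p j k (w τ)) * E τ := by
                      simp only [hW]; ring
                  _ ≤ _ := add_le_add le_rfl (mul_le_of_le_one_right' hE1)
            _ = _ := by
                rw [lintegral_add_left ((hhm k).const_mul _), lintegral_const_mul _ (hhm k),
                  lintegral_const_mul' _ _ (truncWeight_ne_top n j)]
                rfl

/-- Hölder's inequality in time for a function `h` bounded by a high-high product. Without weight,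
the first factor is put in `L^∞` and the second in `L¹`; the weight `t` is given to the second
factor, which then lies in `L^∞`, and the first one is put in `L¹`. The function `h` stands for a
single high-high interaction or, for `p = 1`, for their sum over the output frequency. -/
theorem lintegral_mul_highHigh_le (hφ : IsDyadicPartition φ) (hw : Measurable (Function.uncurry w))
    (hp : 1 ≤ p) {k : ℤ} {h : ℝ → ℝ≥0∞}
    (hh : ∀ t, h t ≤
      (∑' i : ℤ, if k - 2 ≤ i ∧ i ≤ k + 1 then blockNorm φ 1 i (w t) else 0) *
        blockNorm φ p k (w t)) (hp' : p ≠ ∞) :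
    ∫⁻ t in Set.Icc 0 T, h t ≤
        (∑' i : ℤ, if k - 2 ≤ i ∧ i ≤ k + 1 then
          bernsteinConst 1 p * 2 ^ ((i : ℝ) * (1 + critExp p)) * supBlock φ p T w i else 0) *
        intBlock φ p T w k ∧
    ∫⁻ t in Set.Icc 0 T, ENNReal.ofReal t * h t ≤
        (∑' i : ℤ, if k - 2 ≤ i ∧ i ≤ k + 1 then
          bernsteinConst 1 p * 2 ^ ((i : ℝ) * (1 + critExp p)) * intBlock φ p T w i else 0) *
        smoothBlock φ p T w k := by
  have ham : ∀ k, Measurable fun τ => blockNorm φ p k (w τ) := fun k =>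
    measurable_blockNorm hφ hw hp hp' k
  set N : ℝ → ℝ≥0∞ := fun t => ∑' i : ℤ, if k - 2 ≤ i ∧ i ≤ k + 1 then
    bernsteinConst 1 p * 2 ^ ((i : ℝ) * (1 + critExp p)) * blockNorm φ p i (w t) else 0 with hN
  have hterm : ∀ i : ℤ, Measurable fun t => if k - 2 ≤ i ∧ i ≤ k + 1 then
      bernsteinConst 1 p * 2 ^ ((i : ℝ) * (1 + critExp p)) * blockNorm φ p i (w t) else 0 :=
    fun i => by
      split_ifs
      · exact (ham i).const_mul _
      · exact measurable_const
  have hNm : Measurable N := Measurable.tsum hterm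
  have hhN : ∀ t, h t ≤ N t * blockNorm φ p k (w t) := fun t => by
    refine (hh t).trans (mul_le_mul' (ENNReal.tsum_le_tsum fun i => ?_) le_rfl)
    split_ifs
    · exact blockNorm_one_le hφ hp (hw.comp measurable_prodMk_left) i
    · exact le_rfl
  constructor
  · unfold intBlock
    rw [← lintegral_const_mul _ (ham k)]
    refine lintegral_mono_ae ?_
    filter_upwards [ae_all_iff.2 fun i => ae_le_supBlock (φ := φ) (w := w) (p := p) (T := T) i]
      with t ht
    refine (hhN t).trans (mul_le_mul' (ENNReal.tsum_le_tsum fun i => ?_) le_rfl)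
    split_ifs
    · gcongr; exact ht i
    · exact le_rfl
  · calc ∫⁻ t in Set.Icc 0 T, ENNReal.ofReal t * h t
        ≤ ∫⁻ t in Set.Icc 0 T, N t * smoothBlock φ p T w k := by
          refine lintegral_mono_ae ?_
          filter_upwards [ae_le_smoothBlock (φ := φ) (w := w) (p := p) (T := T) k] with t ht
          calc ENNReal.ofReal t * h t
              ≤ ENNReal.ofReal t * (N t * blockNorm φ p k (w t)) := by gcongr; exact hhN t
            _ = N t * (ENNReal.ofReal t * blockNorm φ p k (w t)) := by ring
            _ ≤ _ := by gcongr
      _ = _ := by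
          rw [lintegral_mul_const _ hNm, lintegral_tsum fun i => (hterm i).aemeasurable]
          congr 2
          funext i
          split_ifs
          · rw [lintegral_const_mul _ (ham i)]; rfl
          · simp

end

/-! ### Absorption in the sequence space -/

/-- The sequence `x` cut off below the index `J`. -/
def tail (J : ℤ) (x : ℤ → ℝ≥0∞) (k : ℤ) : ℝ≥0∞ := if J ≤ k then x k else 0

theorem tail_le (J : ℤ) (x : ℤ → ℝ≥0∞) (k : ℤ) : tail J x k ≤ x k := by
  unfold tail; split_ifs
  · exact le_rfl
  · exact zero_le

theorem tsum_indicator_Icc_ne_top (a b : ℤ) :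
    ∑' m : ℤ, (if a ≤ m ∧ m ≤ b then (1 : ℝ≥0∞) else 0) ≠ ∞ := by
  rw [tsum_eq_sum (s := Finset.Icc a b)]
  · refine (ENNReal.sum_lt_top.2 fun m _ => ?_).ne
    split_ifs <;> simp
  · intro m hm
    rw [Finset.mem_Icc] at hm
    simp [hm]

section

variable {q : ℝ≥0∞}

/-- Summation of the high-high interactions. For `σ > 0` they decay geometrically in `k - j`; in the
limiting case they are summable over the output index `j`, and `ℓ^q · ℓ^q ⊆ ℓ¹` for `q ≤ 2`. -/
theorem exists_normSeq_highHigh_le (hq : 1 ≤ q) {σ : ℝ} (hσ : 0 < σ ∨ q ≤ 2) :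
    ∃ G : ℝ≥0∞, G ≠ ∞ ∧ ∀ (E : ℤ → ℤ → ℝ≥0∞) (x y : ℤ → ℝ≥0∞),
      (0 < σ → ∀ j k, E j k ≤ if j - 2 ≤ k then 2 ^ (σ * ((j : ℝ) - k)) * (x k * y k) else 0) →
      (¬ 0 < σ → ∀ k, ∑' j, E j k ≤ x k * y k) →
      normSeq q (fun j => ∑' k, E j k) ≤ G * (normSeq q x * normSeq q y) := by
  by_cases h : 0 < σ
  · refine ⟨_, tsum_two_rpow_ge_ne_top h (-2), fun E x y hE _ => ?_⟩
    calc normSeq q (fun j => ∑' k, E j k)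
        ≤ normSeq q (fun j => ∑' k, (if -2 ≤ k - j then
            (2 : ℝ≥0∞) ^ (-(σ * ((k - j : ℤ) : ℝ))) else 0) * (x k * y k)) := by
          refine normSeq_mono fun j => ENNReal.tsum_le_tsum fun k => (hE h j k).trans ?_
          have : (j - 2 ≤ k) ↔ (-2 ≤ k - j) := by omega
          simp only [this]
          split_ifs
          · refine le_of_eq ?_
            congr 2; push_cast; ring
          · simp
      _ ≤ _ := by
          refine (normSeq_conv_le hq (fun m : ℤ => if -2 ≤ m then
            (2 : ℝ≥0∞) ^ (-(σ * (m : ℝ))) else 0) (fun k => x k * y k)).trans ?_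
          gcongr
          exact normSeq_mul_le hq x y
  · refine ⟨1, ENNReal.one_ne_top, fun E x y _ hE => ?_⟩
    have hq2 := hσ.resolve_left h
    rw [one_mul]
    calc normSeq q (fun j => ∑' k, E j k) ≤ normSeq 1 (fun j => ∑' k, E j k) :=
          normSeq_anti le_rfl hq _
      _ = ∑' k, ∑' j, E j k := by rw [normSeq_one, ENNReal.tsum_comm]
      _ ≤ ∑' k, x k * y k := ENNReal.tsum_le_tsum (hE h)
      _ ≤ _ := tsum_mul_le_normSeq hq hq2 x y

theorem normSeq_window_le (hq : 1 ≤ q) (a b : ℤ) (x : ℤ → ℝ≥0∞) :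
    normSeq q (fun j => ∑' k, if j + a ≤ k ∧ k ≤ j + b then x k else 0) ≤
      (∑' m : ℤ, (if a ≤ m ∧ m ≤ b then (1 : ℝ≥0∞) else 0)) * normSeq q x := by
  refine le_trans (normSeq_mono fun j => ENNReal.tsum_le_tsum fun k => ?_)
    (normSeq_conv_le hq (fun m : ℤ => if a ≤ m ∧ m ≤ b then (1 : ℝ≥0∞) else 0) x)
  have : (j + a ≤ k ∧ k ≤ j + b) ↔ (a ≤ k - j ∧ k - j ≤ b) := by omega
  simp only [this]
  split_ifs <;> simp

theorem le_two_mul_of_le_add_half {x D : ℝ≥0∞} (hx : x ≠ ∞) (h : x ≤ D + 2⁻¹ * x) : x ≤ 2 * D := by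
  have h1 : 2⁻¹ * x ≠ ∞ := ENNReal.mul_ne_top (by simp) hx
  have h2 : x = 2⁻¹ * x + 2⁻¹ * x := by
    rw [← add_mul, ENNReal.inv_two_add_inv_two, one_mul]
  have h3 : 2⁻¹ * x ≤ D := by
    have h4 : 2⁻¹ * x + 2⁻¹ * x ≤ D + 2⁻¹ * x := h2 ▸ h
    exact (ENNReal.add_le_add_iff_right h1).1 h4
  calc x = 2 * (2⁻¹ * x) := by
        rw [← mul_assoc, ENNReal.mul_inv_cancel (by simp) (by simp), one_mul]
    _ ≤ 2 * D := by gcongr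

end

/-- The bound `2^{-k} ‖S_{k-2} w‖` of the part of `w` at frequencies well below `2^k`, i.e. the
coefficient of the low-high interactions in critical normalisation. -/
noncomputable def lowCoeff (φ : R3 → ℝ) (p : ℝ≥0∞) (T : ℝ) (w : ℝ → R3 → ℝ≥0∞) (k : ℤ) : ℝ≥0∞ :=
  2 ^ (-(k : ℝ)) * lowSum φ p T w k

/-- The dyadic `L¹` in time norms in critical normalisation. -/
noncomputable def critInt (φ : R3 → ℝ) (p : ℝ≥0∞) (T : ℝ) (w : ℝ → R3 → ℝ≥0∞) (k : ℤ) : ℝ≥0∞ :=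
  2 ^ ((k : ℝ) * (critExp p + 2)) * intBlock φ p T w k

/-- The dyadic `L^∞` in time norms in critical normalisation. -/
noncomputable def critSup (φ : R3 → ℝ) (p : ℝ≥0∞) (T : ℝ) (w : ℝ → R3 → ℝ≥0∞) (k : ℤ) : ℝ≥0∞ :=
  2 ^ ((k : ℝ) * critExp p) * supBlock φ p T w k

section

variable {φ : R3 → ℝ} {w : ℝ → R3 → ℝ≥0∞} {p : ℝ≥0∞} {T s : ℝ}

/-- The low-high interactions without weight, in the scaling of the solution space. -/
theorem lowHigh_int_le (hs1 : -1 ≤ s) (hs0 : s ≤ 0) {j k : ℤ} (h : j - 2 ≤ k ∧ k ≤ j + 2) :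
    2 ^ ((j : ℝ) * s) * (2 ^ (j : ℝ) * (lowSum φ p T w k * intBlock φ p T w k)) ≤
      4 * (lowCoeff φ p T w k * (2 ^ ((k : ℝ) * (s + 2)) * intBlock φ p T w k)) := by
  have h4 : (4 : ℝ≥0∞) = 2 ^ (2 : ℝ) := by
    rw [show (2 : ℝ) = (2 : ℕ) by norm_num, ENNReal.rpow_natCast]; norm_num
  have h1 : (j : ℝ) - 2 ≤ k := by exact_mod_cast h.1
  have h2 : (k : ℝ) ≤ j + 2 := by exact_mod_cast h.2
  have hpow : (2 : ℝ≥0∞) ^ ((j : ℝ) * s) * 2 ^ (j : ℝ) ≤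
      4 * (2 ^ (-(k : ℝ)) * 2 ^ ((k : ℝ) * (s + 2))) := by
    rw [h4, ← two_rpow_add, ← two_rpow_add, ← two_rpow_add]
    exact two_rpow_mono (by nlinarith)
  calc _ = 2 ^ ((j : ℝ) * s) * 2 ^ (j : ℝ) * (lowSum φ p T w k * intBlock φ p T w k) := by ring
    _ ≤ 4 * (2 ^ (-(k : ℝ)) * 2 ^ ((k : ℝ) * (s + 2))) *
          (lowSum φ p T w k * intBlock φ p T w k) := by gcongr
    _ = _ := by unfold lowCoeff; ring

/-- The weighted low-high interactions, where the unknown appears with the factor `lowCoeff`. -/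
theorem lowHigh_smooth_le (hs1 : -1 ≤ s) (hs0 : s ≤ 0) (n : ℕ) {j k : ℤ}
    (h : j - 2 ≤ k ∧ k ≤ j + 2) :
    2 ^ ((j : ℝ) * s) * (2 ^ (j : ℝ) * (truncWeight n j * 2 ^ (-(2 * (j : ℝ))) *
        (lowSum φ p T w k * smoothBlock φ p T w k))) ≤
      256 * (lowCoeff φ p T w k *
        (2 ^ ((k : ℝ) * s) * (truncWeight n k * smoothBlock φ p T w k))) := by
  have h16 : (16 : ℝ≥0∞) = 2 ^ (4 : ℝ) := by
    rw [show (4 : ℝ) = (4 : ℕ) by norm_num, ENNReal.rpow_natCast]; norm_num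
  have h1 : (j : ℝ) - 2 ≤ k := by exact_mod_cast h.1
  have h2 : (k : ℝ) ≤ j + 2 := by exact_mod_cast h.2
  have hpow : (2 : ℝ≥0∞) ^ ((j : ℝ) * s) * 2 ^ (j : ℝ) * 2 ^ (-(2 * (j : ℝ))) ≤
      16 * (2 ^ (-(k : ℝ)) * 2 ^ ((k : ℝ) * s)) := by
    rw [h16, ← two_rpow_add, ← two_rpow_add, ← two_rpow_add, ← two_rpow_add]
    exact two_rpow_mono (by nlinarith)
  calc _ = 2 ^ ((j : ℝ) * s) * 2 ^ (j : ℝ) * 2 ^ (-(2 * (j : ℝ))) * truncWeight n j *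
          (lowSum φ p T w k * smoothBlock φ p T w k) := by ring
    _ ≤ 16 * (2 ^ (-(k : ℝ)) * 2 ^ ((k : ℝ) * s)) * (16 * truncWeight n k) *
          (lowSum φ p T w k * smoothBlock φ p T w k) := by
        gcongr
        exact truncWeight_le_mul n h.1
    _ = _ := by
        unfold lowCoeff
        rw [show (256 : ℝ≥0∞) = 16 * 16 by norm_num]
        ring

theorem nearSup_le (k : ℤ) :
    (∑' i : ℤ, if k - 2 ≤ i ∧ i ≤ k + 1 then
      bernsteinConst 1 p * 2 ^ ((i : ℝ) * (1 + critExp p)) * supBlock φ p T w i else 0) ≤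
    2 ^ (k : ℝ) * (2 * bernsteinConst 1 p *
      ∑' i : ℤ, if k + (-2) ≤ i ∧ i ≤ k + 1 then critSup φ p T w i else 0) := by
  rw [← ENNReal.tsum_mul_left, ← ENNReal.tsum_mul_left]
  refine ENNReal.tsum_le_tsum fun i => ?_
  rw [← sub_eq_add_neg]
  split_ifs with h
  · have h2 : (i : ℝ) ≤ k + 1 := by exact_mod_cast h.2
    have hpow : (2 : ℝ≥0∞) ^ ((i : ℝ) * (1 + critExp p)) ≤
        2 ^ (k : ℝ) * 2 * 2 ^ ((i : ℝ) * critExp p) := by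
      nth_rewrite 3 [← ENNReal.rpow_one 2]
      rw [← two_rpow_add, ← two_rpow_add]
      exact two_rpow_mono (by nlinarith)
    calc _ ≤ bernsteinConst 1 p * (2 ^ (k : ℝ) * 2 * 2 ^ ((i : ℝ) * critExp p)) *
          supBlock φ p T w i := by gcongr
      _ = _ := by unfold critSup; ring
  · simp

theorem nearInt_le (k : ℤ) :
    (∑' i : ℤ, if k - 2 ≤ i ∧ i ≤ k + 1 then
      bernsteinConst 1 p * 2 ^ ((i : ℝ) * (1 + critExp p)) * intBlock φ p T w i else 0) ≤
    2 ^ (-(k : ℝ)) * (4 * bernsteinConst 1 p *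
      ∑' i : ℤ, if k + (-2) ≤ i ∧ i ≤ k + 1 then critInt φ p T w i else 0) := by
  rw [← ENNReal.tsum_mul_left, ← ENNReal.tsum_mul_left]
  refine ENNReal.tsum_le_tsum fun i => ?_
  rw [← sub_eq_add_neg]
  have h4 : (4 : ℝ≥0∞) = 2 ^ (2 : ℝ) := by
    rw [show (2 : ℝ) = (2 : ℕ) by norm_num, ENNReal.rpow_natCast]; norm_num
  split_ifs with h
  · have h2 : (k : ℝ) - 2 ≤ i := by exact_mod_cast h.1
    have hpow : (2 : ℝ≥0∞) ^ ((i : ℝ) * (1 + critExp p)) ≤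
        2 ^ (-(k : ℝ)) * 4 * 2 ^ ((i : ℝ) * (critExp p + 2)) := by
      rw [h4, ← two_rpow_add, ← two_rpow_add]
      exact two_rpow_mono (by nlinarith)
    calc _ ≤ bernsteinConst 1 p * (2 ^ (-(k : ℝ)) * 4 * 2 ^ ((i : ℝ) * (critExp p + 2))) *
          intBlock φ p T w i := by gcongr
      _ = _ := by unfold critInt; ring
  · simp

theorem intHighHigh_le (hφ : IsDyadicPartition φ) (hw : Measurable (Function.uncurry w))
    (hp : 1 ≤ p) (hp' : p ≠ ∞) (j k : ℤ) :
    intHighHigh φ p T w j k ≤ 2 ^ (k : ℝ) * (2 * bernsteinConst 1 p *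
      ∑' i : ℤ, if k + (-2) ≤ i ∧ i ≤ k + 1 then critSup φ p T w i else 0) *
        intBlock φ p T w k :=
  ((lintegral_mul_highHigh_le hφ hw hp (fun _ => highHigh_le hφ
    (hw.comp measurable_prodMk_left) hp hp' j k) hp').1).trans
    (mul_le_mul' (nearSup_le k) le_rfl)

theorem smoothHighHigh_le (hφ : IsDyadicPartition φ) (hw : Measurable (Function.uncurry w))
    (hp : 1 ≤ p) (hp' : p ≠ ∞) (j k : ℤ) :
    smoothHighHigh φ p T w j k ≤ 2 ^ (-(k : ℝ)) * (4 * bernsteinConst 1 p *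
      ∑' i : ℤ, if k + (-2) ≤ i ∧ i ≤ k + 1 then critInt φ p T w i else 0) *
        smoothBlock φ p T w k :=
  ((lintegral_mul_highHigh_le hφ hw hp (fun _ => highHigh_le hφ
    (hw.comp measurable_prodMk_left) hp hp' j k) hp').2).trans
    (mul_le_mul' (nearInt_le k) le_rfl)

theorem tsum_intHighHigh_le (hφ : IsDyadicPartition φ) (hw : Measurable (Function.uncurry w))
    (k : ℤ) :
    ∑' j, intHighHigh φ 1 T w j k ≤ 2 ^ (k : ℝ) * (2 * bernsteinConst 1 1 *
      ∑' i : ℤ, if k + (-2) ≤ i ∧ i ≤ k + 1 then critSup φ 1 T w i else 0) *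
        intBlock φ 1 T w k := by
  unfold intHighHigh
  rw [← lintegral_tsum fun j =>
    (measurable_highHigh hφ hw le_rfl ENNReal.one_ne_top j k).aemeasurable]
  exact ((lintegral_mul_highHigh_le hφ hw le_rfl (fun _ => tsum_highHigh_le hφ
    (hw.comp measurable_prodMk_left) k) ENNReal.one_ne_top).1).trans
    (mul_le_mul' (nearSup_le k) le_rfl)

theorem tsum_smoothHighHigh_le (hφ : IsDyadicPartition φ) (hw : Measurable (Function.uncurry w))
    (k : ℤ) :
    ∑' j, smoothHighHigh φ 1 T w j k ≤ 2 ^ (-(k : ℝ)) * (4 * bernsteinConst 1 1 *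
      ∑' i : ℤ, if k + (-2) ≤ i ∧ i ≤ k + 1 then critInt φ 1 T w i else 0) *
        smoothBlock φ 1 T w k := by
  unfold smoothHighHigh
  rw [← lintegral_tsum fun j => by exact (ENNReal.measurable_ofReal.mul
    (measurable_highHigh hφ hw le_rfl ENNReal.one_ne_top j k)).aemeasurable]
  simp_rw [ENNReal.tsum_mul_left]
  exact ((lintegral_mul_highHigh_le hφ hw le_rfl (fun _ => tsum_highHigh_le hφ
    (hw.comp measurable_prodMk_left) k) ENNReal.one_ne_top).2).trans
    (mul_le_mul' (nearInt_le k) le_rfl)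

end

section

variable {φ : R3 → ℝ} {w : ℝ → R3 → ℝ≥0∞} {p q : ℝ≥0∞} {T s : ℝ}

theorem neg_one_le_critExp (hp : 1 ≤ p) : -1 ≤ critExp p := by
  have : (p⁻¹).toReal ≤ 1 := by
    simpa using ENNReal.toReal_mono ENNReal.one_ne_top (ENNReal.inv_le_one.2 hp)
  unfold critExp; linarith

/-- The weighted smoothing inequality for a single dyadic piece. -/
theorem weighted_smoothBlock_le (hφ : IsDyadicPartition φ) {κ : ℝ} (hκ : 0 < κ) {K : ℝ≥0∞}
    (hw : IsDuhamelBounded κ K T w) (hp : 1 ≤ p) (hp' : p ≠ ∞) (hs1 : -1 ≤ s) (hs0 : s ≤ 0)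
    {ε : ℝ≥0∞} {J : ℤ} (hlow : ∀ k, J ≤ k → lowCoeff φ p T w k ≤ ε) (n : ℕ) {j : ℤ}
    (hj : J + 4 ≤ j) :
    2 ^ ((j : ℝ) * s) * (truncWeight n j * smoothBlock φ p T w j) ≤
      ENNReal.ofReal (1 / (9 / 16 * κ)) * (2 ^ ((j : ℝ) * s) * blockNorm φ p j (w 0)) +
      K * ENNReal.ofReal (8 / 3) * 2 *
        ((∑' k, if j + (-2) ≤ k ∧ k ≤ j + 2 then ENNReal.ofReal (1 / (9 / 16 * κ)) *
          (4 * ε * (2 ^ ((k : ℝ) * (s + 2)) * intBlock φ p T w k) + 256 * ε *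
            (2 ^ ((k : ℝ) * s) * (truncWeight n k * smoothBlock φ p T w k))) else 0) +
          (ENNReal.ofReal (1 / (9 / 16 * κ)) *
            (∑' k, if j - 2 ≤ k then
              2 ^ ((j : ℝ) * (s + 1)) * intHighHigh φ p T w j k else 0) +
          ∑' k, if j - 2 ≤ k then
            2 ^ ((j : ℝ) * (s + 1)) * (truncWeight n j * smoothHighHigh φ p T w j k) else 0)) := by
  set C0 := ENNReal.ofReal (1 / (9 / 16 * κ)) with hC0
  have hpow : (2 : ℝ≥0∞) ^ ((j : ℝ) * (s + 1)) = 2 ^ ((j : ℝ) * s) * 2 ^ (j : ℝ) := by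
    rw [← two_rpow_add]; congr 1; ring
  calc _ ≤ 2 ^ ((j : ℝ) * s) * _ :=
        mul_le_mul_right (truncWeight_mul_smoothBlock_le hφ hκ hw hp hp' n j) _
    _ ≤ _ := ?_
  rw [mul_add, ENNReal.ofReal_mul (by norm_num), ofReal_two_zpow]
  refine add_le_add (le_of_eq (by ring)) ?_
  rw [show ∀ S : ℝ≥0∞, 2 ^ ((j : ℝ) * s) *
      (K * (ENNReal.ofReal (8 / 3) * 2 ^ (j : ℝ)) * 2 * S) =
      K * ENNReal.ofReal (8 / 3) * 2 * (2 ^ ((j : ℝ) * s) * 2 ^ (j : ℝ) * S) from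
      fun S => by ring]
  refine mul_le_mul_right ?_ _
  rw [← ENNReal.tsum_mul_left, ← ENNReal.tsum_mul_left, ← ENNReal.tsum_add, ← ENNReal.tsum_add]
  refine ENNReal.tsum_le_tsum fun k => ?_
  rw [mul_add]
  refine add_le_add ?_ ?_
  · rw [← sub_eq_add_neg]
    split_ifs with h
    · have hk : J ≤ k := by omega
      calc _ = C0 * (2 ^ ((j : ℝ) * s) * (2 ^ (j : ℝ) *
              (lowSum φ p T w k * intBlock φ p T w k)) +
            2 ^ ((j : ℝ) * s) * (2 ^ (j : ℝ) * (truncWeight n j * 2 ^ (-(2 * (j : ℝ))) *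
              (lowSum φ p T w k * smoothBlock φ p T w k)))) := by ring
        _ ≤ C0 * (4 * (lowCoeff φ p T w k * (2 ^ ((k : ℝ) * (s + 2)) * intBlock φ p T w k)) +
            256 * (lowCoeff φ p T w k *
              (2 ^ ((k : ℝ) * s) * (truncWeight n k * smoothBlock φ p T w k)))) :=
          mul_le_mul_right (add_le_add (lowHigh_int_le hs1 hs0 h)
            (lowHigh_smooth_le hs1 hs0 n h)) _
        _ ≤ C0 * (4 * (ε * (2 ^ ((k : ℝ) * (s + 2)) * intBlock φ p T w k)) +
            256 * (ε * (2 ^ ((k : ℝ) * s) * (truncWeight n k * smoothBlock φ p T w k)))) := by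
          have := hlow k hk
          gcongr
        _ = _ := by ring
    · simp
  · split_ifs
    · rw [hpow]
      exact le_of_eq (by ring)
    · simp

theorem normSeq_add_three_le (hq : 1 ≤ q) (a b c : ℤ → ℝ≥0∞) :
    normSeq q (fun j => a j + (b j + c j)) ≤ normSeq q a + (normSeq q b + normSeq q c) :=
  (normSeq_add_le hq a fun j => b j + c j).trans (by gcongr; exact normSeq_add_le hq b c)

/-- Smoothing under a smallness condition at high frequencies only. The truncated norms are finite
a priori and satisfy an inequality `X ≤ D + X / 2` with `D` independent of the truncation, since
low frequencies are controlled by the trivial bound `smoothBlock_le`. -/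
theorem exists_smoothing_threshold (hφ : IsDyadicPartition φ) {κ : ℝ} (hκ : 0 < κ) {K : ℝ≥0∞}
    (hK : K ≠ ∞) (hp : 1 ≤ p) (hp' : p ≠ ∞) (hq : 1 ≤ q) (hs : critExp p ≤ s) (hs0 : s ≤ 0)
    (hcase : 0 < s + 1 ∨ (p = 1 ∧ q ≤ 2)) :
    ∃ ε : ℝ≥0∞, 0 < ε ∧ ∀ (T : ℝ) (w : ℝ → R3 → ℝ≥0∞) (J : ℤ), IsDuhamelBounded κ K T w →
      normSeq q (fun j => 2 ^ ((j : ℝ) * s) * supBlock φ p T w j) ≠ ∞ →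
      normSeq q (fun j => 2 ^ ((j : ℝ) * (s + 2)) * intBlock φ p T w j) ≠ ∞ →
      normSeq q (fun j => 2 ^ ((j : ℝ) * s) * blockNorm φ p j (w 0)) ≠ ∞ →
      (∀ k, J ≤ k → lowCoeff φ p T w k ≤ ε) →
      normSeq q (tail J (critInt φ p T w)) ≤ ε →
      normSeq q (fun j => 2 ^ ((j : ℝ) * (s + 2)) * smoothBlock φ p T w j) ≠ ∞ := by
  have hs1 : -1 ≤ s := (neg_one_le_critExp hp).trans hs
  obtain ⟨G, hG, hGbound⟩ := exists_normSeq_highHigh_le hq (σ := s + 1) (hcase.imp_right And.right)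
  set C0 := ENNReal.ofReal (1 / (9 / 16 * κ)) with hC0
  have hC0t : C0 ≠ ∞ := ENNReal.ofReal_ne_top
  set c1 := bernsteinConst 1 p with hc1
  have hc1t : c1 ≠ ∞ := bernsteinConst_ne_top le_rfl hp
  set K2 := K * ENNReal.ofReal (8 / 3) * 2 with hK2
  have hK2t : K2 ≠ ∞ := ENNReal.mul_ne_top (ENNReal.mul_ne_top hK ENNReal.ofReal_ne_top) (by simp)
  set N5 := ∑' m : ℤ, (if -2 ≤ m ∧ m ≤ 2 then (1 : ℝ≥0∞) else 0) with hN5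
  have hN5t : N5 ≠ ∞ := tsum_indicator_Icc_ne_top _ _
  set N4 := ∑' m : ℤ, (if -2 ≤ m ∧ m ≤ 1 then (1 : ℝ≥0∞) else 0) with hN4
  have hN4t : N4 ≠ ∞ := tsum_indicator_Icc_ne_top _ _
  -- `Γ ε` will be the coefficient of the unknown norm on the right-hand side
  set Γ := K2 * (N5 * C0 * 256 + 64 * G * c1 * N4) with hΓ
  have hΓt : Γ ≠ ∞ := by
    rw [hΓ]
    finiteness
  refine ⟨(2 * (Γ + 1))⁻¹, ?_, ?_⟩
  · rw [ENNReal.inv_pos]; finiteness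
  set ε := (2 * (Γ + 1))⁻¹ with hε
  have hεt : ε ≠ ∞ := by rw [hε, ENNReal.inv_ne_top]; simp
  have hΓε : Γ * ε ≤ 2⁻¹ := by
    rw [hε, ENNReal.mul_inv (by simp) (by simp), mul_left_comm]
    refine mul_le_of_le_one_right' ?_
    rw [← div_eq_mul_inv]
    exact ENNReal.div_le_of_le_mul (by simp)
  intro T w J hw hA hP hU hlow hint
  have hmw := hw.measurable
  set A : ℤ → ℝ≥0∞ := fun j => 2 ^ ((j : ℝ) * s) * supBlock φ p T w j with hAdef
  set P : ℤ → ℝ≥0∞ := fun j => 2 ^ ((j : ℝ) * (s + 2)) * intBlock φ p T w j with hPdef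
  set U : ℤ → ℝ≥0∞ := fun j => 2 ^ ((j : ℝ) * s) * blockNorm φ p j (w 0) with hUdef
  set X : ℕ → ℤ → ℝ≥0∞ := fun n j =>
    2 ^ ((j : ℝ) * s) * (truncWeight n j * smoothBlock φ p T w j) with hXdef
  -- the coefficient sequences of the high-high interactions
  set x1 : ℤ → ℝ≥0∞ := fun k => 2 * c1 *
    ∑' i : ℤ, if k + (-2) ≤ i ∧ i ≤ k + 1 then tail J (critSup φ p T w) i else 0 with hx1
  set x2 : ℤ → ℝ≥0∞ := fun k => 4 * c1 *
    ∑' i : ℤ, if k + (-2) ≤ i ∧ i ≤ k + 1 then tail J (critInt φ p T w) i else 0 with hx2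
  have hx1n : normSeq q x1 ≤
      2 * c1 * (N4 * (2 ^ (-((J : ℝ) * (s - critExp p))) * normSeq q A)) := by
    rw [hx1, normSeq_const_mul hq]
    gcongr
    refine (normSeq_window_le hq _ _ _).trans ?_
    gcongr
    rw [← normSeq_const_mul hq]
    refine normSeq_mono fun k => ?_
    unfold tail
    split_ifs with h
    · have hJk : (J : ℝ) ≤ k := by exact_mod_cast h
      have hpow : (2 : ℝ≥0∞) ^ ((k : ℝ) * critExp p) ≤
          2 ^ (-((J : ℝ) * (s - critExp p))) * 2 ^ ((k : ℝ) * s) := by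
        rw [← two_rpow_add]
        exact two_rpow_mono (by nlinarith)
      calc critSup φ p T w k ≤ 2 ^ (-((J : ℝ) * (s - critExp p))) * 2 ^ ((k : ℝ) * s) *
            supBlock φ p T w k := mul_le_mul_left hpow _
        _ = _ := by rw [hAdef, mul_assoc]
    · exact zero_le
  have hx2n : normSeq q x2 ≤ 4 * c1 * (N4 * ε) := by
    rw [hx2, normSeq_const_mul hq]
    gcongr
    refine (normSeq_window_le hq _ _ _).trans ?_
    gcongr
  -- outputs at frequency `j ≥ J + 4` only involve `k ≥ J + 2`, hence factors with index `i ≥ J`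
  have htail : ∀ (x : ℤ → ℝ≥0∞) (k : ℤ), J + 2 ≤ k →
      (∑' i : ℤ, if k + (-2) ≤ i ∧ i ≤ k + 1 then x i else 0) =
        ∑' i : ℤ, if k + (-2) ≤ i ∧ i ≤ k + 1 then tail J x i else 0 := by
    intro x k hk
    refine tsum_congr fun i => ?_
    split_ifs with h
    · rw [tail, if_pos (by omega)]
    · rfl
  set E1 : ℤ → ℤ → ℝ≥0∞ := fun j k => if J + 4 ≤ j ∧ j - 2 ≤ k then
    2 ^ ((j : ℝ) * (s + 1)) * intHighHigh φ p T w j k else 0 with hE1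
  set E2 : ℕ → ℤ → ℤ → ℝ≥0∞ := fun n j k => if J + 4 ≤ j ∧ j - 2 ≤ k then
    2 ^ ((j : ℝ) * (s + 1)) * (truncWeight n j * smoothHighHigh φ p T w j k) else 0 with hE2
  have hE1n : normSeq q (fun j => ∑' k, E1 j k) ≤ G * (normSeq q x1 * normSeq q P) := by
    refine hGbound E1 x1 P (fun _ j k => ?_) fun hns k => ?_
    · simp only [hE1]
      by_cases h : J + 4 ≤ j ∧ j - 2 ≤ k
      · rw [if_pos h, if_pos h.2]
        have hb := intHighHigh_le (T := T) hφ hmw hp hp' j k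
        rw [htail _ _ (by omega)] at hb
        have hpow : (2 : ℝ≥0∞) ^ ((j : ℝ) * (s + 1)) * 2 ^ (k : ℝ) =
            2 ^ ((s + 1) * ((j : ℝ) - k)) * 2 ^ ((k : ℝ) * (s + 2)) := by
          rw [← two_rpow_add, ← two_rpow_add]; congr 1; ring
        calc _ ≤ 2 ^ ((j : ℝ) * (s + 1)) * (2 ^ (k : ℝ) * x1 k * intBlock φ p T w k) := by
              gcongr
          _ = 2 ^ ((j : ℝ) * (s + 1)) * 2 ^ (k : ℝ) * (x1 k * intBlock φ p T w k) := by ring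
          _ = _ := by rw [hpow]; simp only [hPdef]; ring
      · rw [if_neg h]; exact zero_le
    · have hs' : s = -1 := by linarith
      obtain ⟨rfl, -⟩ := hcase.resolve_left hns
      by_cases h : J + 2 ≤ k
      · have hb := tsum_intHighHigh_le (T := T) hφ hmw k
        rw [htail _ _ h] at hb
        calc ∑' j, E1 j k ≤ ∑' j, intHighHigh φ 1 T w j k := by
              refine ENNReal.tsum_le_tsum fun j => ?_
              simp only [hE1, hs']
              split_ifs <;> simp
          _ ≤ 2 ^ (k : ℝ) * x1 k * intBlock φ 1 T w k := hb
          _ = x1 k * P k := by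
              simp only [hPdef, hs']
              rw [show (k : ℝ) * (-1 + 2) = k by ring]
              ring
      · have : ∀ j, E1 j k = 0 := fun j => by
          simp only [hE1]
          rw [if_neg (by omega)]
        simp [this]
  have hE2n : ∀ n, normSeq q (fun j => ∑' k, E2 n j k) ≤
      G * (normSeq q x2 * (16 * normSeq q (X n))) := by
    intro n
    rw [← normSeq_const_mul hq 16]
    refine hGbound (E2 n) x2 _ (fun _ j k => ?_) fun hns k => ?_
    · simp only [hE2]
      by_cases h : J + 4 ≤ j ∧ j - 2 ≤ k
      · rw [if_pos h, if_pos h.2]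
        have hb := smoothHighHigh_le (T := T) hφ hmw hp hp' j k
        rw [htail _ _ (by omega)] at hb
        have hpow : (2 : ℝ≥0∞) ^ ((j : ℝ) * (s + 1)) * 2 ^ (-(k : ℝ)) =
            2 ^ ((s + 1) * ((j : ℝ) - k)) * 2 ^ ((k : ℝ) * s) := by
          rw [← two_rpow_add, ← two_rpow_add]; congr 1; ring
        calc _ ≤ 2 ^ ((j : ℝ) * (s + 1)) * (16 * truncWeight n k *
                (2 ^ (-(k : ℝ)) * x2 k * smoothBlock φ p T w k)) := by
              gcongr
              exact truncWeight_le_mul n h.2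
          _ = 2 ^ ((j : ℝ) * (s + 1)) * 2 ^ (-(k : ℝ)) *
                (x2 k * (16 * (truncWeight n k * smoothBlock φ p T w k))) := by ring
          _ = _ := by rw [hpow]; simp only [hXdef]; ring
      · rw [if_neg h]; exact zero_le
    · have hs' : s = -1 := by linarith
      obtain ⟨rfl, -⟩ := hcase.resolve_left hns
      by_cases h : J + 2 ≤ k
      · have hb := tsum_smoothHighHigh_le (T := T) hφ hmw k
        rw [htail _ _ h] at hb
        calc ∑' j, E2 n j k ≤ ∑' j, 16 * truncWeight n k * smoothHighHigh φ 1 T w j k := by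
              refine ENNReal.tsum_le_tsum fun j => ?_
              simp only [hE2, hs']
              split_ifs with hj
              · simp only [neg_add_cancel, mul_zero, ENNReal.rpow_zero, one_mul]
                gcongr
                exact truncWeight_le_mul n hj.2
              · exact zero_le
          _ ≤ 16 * truncWeight n k * (2 ^ (-(k : ℝ)) * x2 k * smoothBlock φ 1 T w k) := by
              rw [ENNReal.tsum_mul_left]
              gcongr
          _ = x2 k * (16 * X n k) := by
              simp only [hXdef, hs']
              rw [show (k : ℝ) * (-1) = -k by ring]
              ring
      · have : ∀ j, E2 n j k = 0 := fun j => by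
          simp only [hE2]
          rw [if_neg (by omega)]
        simp [this]
  -- low frequencies, and the terms at high frequencies that do not contain the unknown
  set D : ℝ≥0∞ := 2 ^ (2 * ((J + 4 : ℤ) : ℝ)) * ENNReal.ofReal T * normSeq q A + (C0 * normSeq q U +
    K2 * (N5 * (C0 * (4 * ε * normSeq q P)) + C0 * (G * (normSeq q x1 * normSeq q P)))) with hD
  have hDt : D ≠ ∞ := by
    have h1 : normSeq q x1 ≠ ∞ := by
      refine ne_top_of_le_ne_top ?_ hx1n
      have := two_rpow_ne_top (-((J : ℝ) * (s - critExp p)))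
      finiteness
    have h2 := two_rpow_ne_top (2 * ((J + 4 : ℤ) : ℝ))
    rw [hD]
    finiteness
  have hXA : ∀ n (j : ℤ) (c : ℝ), truncWeight n j ≤ 2 ^ c →
      X n j ≤ 2 ^ c * ENNReal.ofReal T * A j := fun n j c hc => by
    calc X n j ≤ 2 ^ ((j : ℝ) * s) * (2 ^ c * (ENNReal.ofReal T * supBlock φ p T w j)) := by
          simp only [hXdef]
          gcongr
          exact smoothBlock_le j
      _ = _ := by simp only [hAdef]; ring
  have hXt : ∀ n, normSeq q (X n) ≠ ∞ := fun n => by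
    have h1 : normSeq q (X n) ≤ 2 ^ (2 * (n : ℝ)) * ENNReal.ofReal T * normSeq q A := by
      rw [← normSeq_const_mul hq]
      exact normSeq_mono fun j => hXA n j _ (min_le_right _ _)
    have := two_rpow_ne_top (2 * (n : ℝ))
    exact ne_top_of_le_ne_top (by finiteness) h1
  have hXD : ∀ n, normSeq q (X n) ≤ 2 * D := fun n => by
    refine le_two_mul_of_le_add_half (hXt n) ?_
    have hpt : ∀ j, X n j ≤ 2 ^ (2 * ((J + 4 : ℤ) : ℝ)) * ENNReal.ofReal T * A j +
        (C0 * U j + K2 * ((∑' k, if j + (-2) ≤ k ∧ k ≤ j + 2 then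
          C0 * (4 * ε * P k + 256 * ε * X n k) else 0) +
          (C0 * (∑' k, E1 j k) + ∑' k, E2 n j k))) := by
      intro j
      by_cases hj : J + 4 ≤ j
      · refine le_trans ?_ le_add_self
        have := weighted_smoothBlock_le hφ hκ hw hp hp' hs1 hs0 hlow n hj
        simpa only [hE1, hE2, hj, true_and] using this
      · refine le_trans (hXA n j _ ((truncWeight_le n j).trans (two_rpow_mono ?_))) le_self_add
        have : (j : ℝ) ≤ ((J + 4 : ℤ) : ℝ) := by exact_mod_cast (not_le.1 hj).le
        linarith
    refine (normSeq_mono hpt).trans ?_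
    refine (normSeq_add_three_le hq _ _ _).trans ?_
    rw [normSeq_const_mul hq, normSeq_const_mul hq, normSeq_const_mul hq K2]
    have hwin : normSeq q (fun j => ∑' k, if j + (-2) ≤ k ∧ k ≤ j + 2 then
          C0 * (4 * ε * P k + 256 * ε * X n k) else 0) ≤
        N5 * (C0 * (4 * ε * normSeq q P + 256 * ε * normSeq q (X n))) := by
      refine (normSeq_window_le hq _ _ _).trans ?_
      gcongr
      rw [normSeq_const_mul hq]
      gcongr
      refine (normSeq_add_le hq _ _).trans ?_
      rw [normSeq_const_mul hq, normSeq_const_mul hq]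
    have hsum := normSeq_add_three_le hq (fun j => ∑' k, if j + (-2) ≤ k ∧ k ≤ j + 2 then
          C0 * (4 * ε * P k + 256 * ε * X n k) else 0) (fun j => C0 * (∑' k, E1 j k))
          (fun j => ∑' k, E2 n j k)
    rw [normSeq_const_mul hq] at hsum
    calc _ ≤ 2 ^ (2 * ((J + 4 : ℤ) : ℝ)) * ENNReal.ofReal T * normSeq q A + (C0 * normSeq q U +
          K2 * (N5 * (C0 * (4 * ε * normSeq q P + 256 * ε * normSeq q (X n))) +
            (C0 * (G * (normSeq q x1 * normSeq q P)) +
              G * (4 * c1 * (N4 * ε) * (16 * normSeq q (X n)))))) := by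
          gcongr
          refine hsum.trans ?_
          gcongr
          exact (hE2n n).trans (by gcongr)
      _ = D + Γ * ε * normSeq q (X n) := by rw [hD, hΓ]; ring
      _ ≤ D + 2⁻¹ * normSeq q (X n) := by gcongr
  refine ne_top_of_le_ne_top (ENNReal.mul_ne_top (by simp) hDt)
    (normSeq_le_of_eventually_eq hXD (fun j => ?_) hq)
  -- at a fixed frequency the truncation is not active for large `n`
  obtain ⟨N, hN⟩ := exists_nat_ge (j : ℝ)
  filter_upwards [eventually_ge_atTop N] with n hn
  have hjn : (j : ℝ) ≤ n := hN.trans (by exact_mod_cast hn)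
  simp only [hXdef, truncWeight]
  rw [min_eq_left (two_rpow_mono (by linarith)), ← mul_assoc, ← two_rpow_add]
  congr 2; ring

end

/-! ### Tempered distributions whose Fourier transform is a function -/

section

variable {f f' : 𝓢'(R3, C3)} {g g' : R3 → C3}

theorem HasFourierFunction.ae_eq (h : HasFourierFunction f g) (h' : HasFourierFunction f g') :
    g =ᵐ[volume] g' := by
  refine ae_eq_of_integral_contDiff_smul_eq h.1 h'.1 fun χ hχ hc => ?_
  have hc' : HasCompactSupport fun x => (χ x : ℂ) := hc.comp_left (g := Complex.ofReal) (by simp)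
  let ψ : 𝓢(R3, ℂ) := hc'.toSchwartzMap (Complex.ofRealCLM.contDiff.comp hχ)
  have hψ : ∀ x, ψ x = (χ x : ℂ) := fun x => rfl
  have h1 := (h.2 ψ).2
  have h2 := (h'.2 ψ).2
  rw [h1] at h2
  simpa [hψ] using h2

theorem HasFourierFunction.normFL_eq (h : HasFourierFunction f g) (p : ℝ≥0∞) :
    normFL p f = eLpNorm g p volume := by
  refine le_antisymm (iInf₂_le g h) (le_iInf₂ fun g' h' => ?_)
  exact (eLpNorm_congr_ae (h.ae_eq h')).le

theorem HasFourierFunction.of_smulLeft {m : R3 → ℂ} (hm : m.HasTemperateGrowth)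
    (h : HasFourierFunction f g)
    (hf' : 𝓕 f' = TemperedDistribution.smulLeftCLM C3 m (𝓕 f)) :
    HasFourierFunction f' (fun ξ => m ξ • g ξ) := by
  refine ⟨?_, fun ψ => ?_⟩
  · rw [locallyIntegrable_iff]
    intro k hk
    exact (h.1.integrableOn_isCompact hk).continuousOn_smul hm.1.continuous.continuousOn hk
  · have h1 := h.2 (SchwartzMap.smulLeftCLM ℂ m ψ)
    simp only [SchwartzMap.smulLeftCLM_apply_apply hm, smul_eq_mul] at h1
    have h2 : ∀ ξ, (m ξ * ψ ξ) • g ξ = ψ ξ • m ξ • g ξ := fun ξ => by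
      rw [smul_smul, mul_comm]
    simp only [h2] at h1
    rw [hf', TemperedDistribution.smulLeftCLM_apply_apply]
    exact h1

theorem HasFourierFunction.sub (h : HasFourierFunction f g) (h' : HasFourierFunction f' g') :
    HasFourierFunction (f - f') (fun ξ => g ξ - g' ξ) := by
  refine ⟨h.1.sub h'.1, fun ψ => ?_⟩
  obtain ⟨h1, h2⟩ := h.2 ψ
  obtain ⟨h3, h4⟩ := h'.2 ψ
  simp only [smul_sub]
  refine ⟨h1.sub h3, ?_⟩
  rw [integral_sub h1 h3, ← h2, ← h4]
  rfl

theorem HasFourierFunction.const_smul (h : HasFourierFunction f g) (c : ℂ) :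
    HasFourierFunction (c • f) (fun ξ => c • g ξ) := by
  refine ⟨h.1.smul c, fun ψ => ?_⟩
  obtain ⟨h1, h2⟩ := h.2 ψ
  simp only [smul_comm _ c]
  refine ⟨h1.smul c, ?_⟩
  rw [integral_smul, ← h2]
  rfl

theorem HasFourierFunction.dyadicBlock {φ : R3 → ℝ} (hφ : IsDyadicPartition φ)
    (h : HasFourierFunction f g) (j : ℤ) :
    HasFourierFunction (dyadicBlock φ j f)
      (fun ξ => ((φ ((2 : ℝ) ^ (-j) • ξ) : ℝ) : ℂ) • g ξ) := by
  refine h.of_smulLeft ?_ ?_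
  · have hcs : HasCompactSupport φ := by
      refine HasCompactSupport.of_support_subset_isCompact (isCompact_closedBall (0 : R3) (8 / 3))
        fun ξ hξ => ?_
      simpa using (hφ.tsupport_subset (subset_tsupport φ hξ)).2
    have h1 : HasCompactSupport fun ξ : R3 => φ ((2 : ℝ) ^ (-j) • ξ) :=
      hcs.comp_smul (by positivity)
    have h2 : HasCompactSupport fun ξ : R3 => ((φ ((2 : ℝ) ^ (-j) • ξ) : ℝ) : ℂ) :=
      h1.comp_left (g := Complex.ofReal) (by simp)
    refine h2.hasTemperateGrowth ?_
    exact Complex.ofRealCLM.contDiff.comp (hφ.contDiff.comp (contDiff_const_smul _))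
  · unfold FourierHerz.dyadicBlock
    rw [TemperedDistribution.fourierMultiplierCLM_apply, FourierTransform.fourier_fourierInv_eq]

theorem HasFourierFunction.lineDeriv (h : HasFourierFunction f g) (i : Fin 3) :
    HasFourierFunction (∂_{(EuclideanSpace.single i (1 : ℝ) : R3)} f)
      (fun ξ => (2 * Real.pi * Complex.I) • ((ξ i : ℝ) : ℂ) • g ξ) := by
  have hm : Function.HasTemperateGrowth
      fun ξ : R3 => ((inner ℝ ξ (EuclideanSpace.single i (1 : ℝ) : R3) : ℝ) : ℂ) := by
    fun_prop
  have h1 : HasFourierFunction (𝓕⁻ (TemperedDistribution.smulLeftCLM C3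
      (fun ξ : R3 => ((inner ℝ ξ (EuclideanSpace.single i (1 : ℝ) : R3) : ℝ) : ℂ)) (𝓕 f)))
      (fun ξ => ((inner ℝ ξ (EuclideanSpace.single i (1 : ℝ) : R3) : ℝ) : ℂ) • g ξ) :=
    h.of_smulLeft hm (FourierTransform.fourier_fourierInv_eq _)
  have h2 := h1.const_smul (2 * Real.pi * Complex.I)
  have h3 : ∂_{(EuclideanSpace.single i (1 : ℝ) : R3)} f =
      (2 * Real.pi * Complex.I) • 𝓕⁻ (TemperedDistribution.smulLeftCLM C3
      (fun ξ : R3 => ((inner ℝ ξ (EuclideanSpace.single i (1 : ℝ) : R3) : ℝ) : ℂ)) (𝓕 f)) := by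
    rw [TemperedDistribution.lineDeriv_eq_fourierMultiplierCLM,
      TemperedDistribution.fourierMultiplierCLM_apply]
  rw [h3]
  simpa [EuclideanSpace.inner_single_right] using h2

/-- The dyadic norms of a distribution are those of the modulus of its Fourier transform. -/
theorem HasFourierFunction.normFL_dyadicBlock {φ : R3 → ℝ} (hφ : IsDyadicPartition φ)
    (h : HasFourierFunction f g) (p : ℝ≥0∞) (j : ℤ) :
    normFL p (FourierHerz.dyadicBlock φ j f) = blockNorm φ p j (fun ξ => ‖g ξ‖ₑ) := by
  rw [(h.dyadicBlock hφ j).normFL_eq]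
  unfold blockNorm cutoff
  refine eLpNorm_congr_enorm_ae (ae_of_all _ fun ξ => ?_)
  rw [enorm_smul, enorm_eq_self]
  congr 1
  rw [← ofReal_norm, Complex.norm_real, Real.norm_of_nonneg (hφ.nonneg _)]

end

/-! ### Smallness at high frequencies -/

section

variable {φ : R3 → ℝ} {w : ℝ → R3 → ℝ≥0∞} {p q : ℝ≥0∞} {T s : ℝ}

/-- The tails of a sequence in `ℓ^q` tend to zero if `q < ∞`, or in the presence of a decaying
weight. -/
theorem tendsto_normSeq_tail (hq : 1 ≤ q) {x : ℤ → ℝ≥0∞} (hx : normSeq q x ≠ ∞) {δ : ℝ}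
    (hδ : 0 ≤ δ) (h : 0 < δ ∨ q ≠ ∞) :
    Tendsto (fun J : ℤ => normSeq q (tail J fun k => 2 ^ (-((k : ℝ) * δ)) * x k)) atTop
      (𝓝 0) := by
  rcases h with h | h
  · have h1 : Tendsto (fun J : ℤ => (2 : ℝ≥0∞) ^ (-((J : ℝ) * δ)) * normSeq q x) atTop (𝓝 0) := by
      have h2 : Tendsto (fun J : ℤ => (2 : ℝ≥0∞) ^ (-((J : ℝ) * δ))) atTop (𝓝 0) := by
        have h3 : Tendsto (fun J : ℤ => (2 : ℝ) ^ (-((J : ℝ) * δ))) atTop (𝓝 0) := by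
          refine (tendsto_rpow_atBot_of_base_gt_one 2 (by norm_num)).comp ?_
          exact tendsto_neg_atTop_atBot.comp
            ((tendsto_intCast_atTop_atTop (R := ℝ)).atTop_mul_const h)
        have h4 := ENNReal.tendsto_ofReal h3
        simpa [← ENNReal.ofReal_rpow_of_pos] using h4
      simpa using ENNReal.Tendsto.mul_const h2 (Or.inr hx)
    refine tendsto_of_tendsto_of_tendsto_of_le_of_le tendsto_const_nhds h1 (fun _ => zero_le)
      fun J => ?_
    simp only
    rw [← normSeq_const_mul hq]
    refine normSeq_mono fun k => ?_
    unfold tail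
    split_ifs with hk
    · have hJk : (J : ℝ) ≤ k := by exact_mod_cast hk
      exact mul_le_mul_left (two_rpow_mono (by nlinarith)) _
    · exact zero_le
  · refine tendsto_normSeq_zero hq h hx ?_ fun j => ?_
    · filter_upwards [eventually_ge_atTop 0] with J hJ k
      unfold tail
      split_ifs with hk
      · refine mul_le_of_le_one_left' ?_
        rw [← ENNReal.rpow_zero (x := 2)]
        have : (0 : ℝ) ≤ k := by exact_mod_cast hJ.trans hk
        exact two_rpow_mono (by nlinarith)
      · exact zero_le
    · refine tendsto_const_nhds.congr' ?_
      filter_upwards [eventually_gt_atTop j] with J hJ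
      rw [tail, if_neg (by omega)]

/-- The low-high coefficients are a convolution of the critical norms with a summable kernel. -/
theorem lowCoeff_eq (k : ℤ) :
    lowCoeff φ p T w k = bernsteinConst 1 p *
      ∑' m : ℤ, (if m ≤ -3 then (2 : ℝ≥0∞) ^ (m : ℝ) else 0) * critSup φ p T w (m + k) := by
  unfold lowCoeff lowSum
  rw [← (Equiv.addRight k).tsum_eq, ← ENNReal.tsum_mul_left, ← ENNReal.tsum_mul_left]
  refine tsum_congr fun m => ?_
  have h : (m + k ≤ k - 3) ↔ m ≤ -3 := by omega
  simp only [Equiv.coe_addRight, h]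
  split_ifs
  · have hpow : (2 : ℝ≥0∞) ^ (-(k : ℝ)) * 2 ^ (((m + k : ℤ) : ℝ) * (1 + critExp p)) =
        2 ^ (m : ℝ) * 2 ^ (((m + k : ℤ) : ℝ) * critExp p) := by
      rw [← two_rpow_add, ← two_rpow_add]; congr 1; push_cast; ring
    calc _ = bernsteinConst 1 p * (2 ^ (-(k : ℝ)) * 2 ^ (((m + k : ℤ) : ℝ) * (1 + critExp p))) *
          supBlock φ p T w (m + k) := by ring
      _ = _ := by rw [hpow, critSup]; ring
  · simp

theorem critSup_eq (k : ℤ) :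
    critSup φ p T w k = 2 ^ (-((k : ℝ) * (s - critExp p))) *
      (2 ^ ((k : ℝ) * s) * supBlock φ p T w k) := by
  rw [critSup, ← mul_assoc, ← two_rpow_add]; congr 2; ring

theorem critInt_eq (k : ℤ) :
    critInt φ p T w k = 2 ^ (-((k : ℝ) * (s - critExp p))) *
      (2 ^ ((k : ℝ) * (s + 2)) * intBlock φ p T w k) := by
  rw [critInt, ← mul_assoc, ← two_rpow_add]; congr 2; ring

/-- The low-high coefficients tend to zero at high frequencies; the low frequencies are summable
because of `s < critExp p + 1`. -/
theorem tendsto_lowCoeff (hp : 1 ≤ p) (hq : 1 ≤ q)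
    (hA : normSeq q (fun j => 2 ^ ((j : ℝ) * s) * supBlock φ p T w j) ≠ ∞)
    (hs : critExp p ≤ s) (hs' : s < critExp p + 1) (h : critExp p < s ∨ q ≠ ∞) :
    Tendsto (fun k : ℤ => lowCoeff φ p T w k) atTop (𝓝 0) := by
  set δ := s - critExp p with hδ
  have hδ0 : 0 ≤ δ := sub_nonneg.2 hs
  set A : ℤ → ℝ≥0∞ := fun j => 2 ^ ((j : ℝ) * s) * supBlock φ p T w j with hAdef
  have hcA : ∀ k, critSup φ p T w k = 2 ^ (-((k : ℝ) * δ)) * A k := critSup_eq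
  have htail := tendsto_normSeq_tail hq hA hδ0 (h.imp_left fun h => sub_pos.2 h)
  have hc0 : Tendsto (critSup φ p T w) atTop (𝓝 0) := by
    refine tendsto_of_tendsto_of_tendsto_of_le_of_le tendsto_const_nhds htail (fun _ => zero_le)
      fun k => ?_
    refine le_trans (le_of_eq ?_) (le_normSeq hq _ k)
    rw [tail, if_pos le_rfl, hcA]
  simp_rw [lowCoeff_eq]
  rw [← mul_zero (bernsteinConst 1 p)]
  refine ENNReal.Tendsto.const_mul ?_ (Or.inr (bernsteinConst_ne_top le_rfl hp))
  simp_rw [← normSeq_one]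
  refine tendsto_normSeq_zero le_rfl ENNReal.one_ne_top
    (Y := fun m : ℤ => (if m ≤ -3 then (2 : ℝ≥0∞) ^ ((1 - δ) * (m : ℝ)) else 0) * normSeq q A)
    ?_ ?_ fun m => ?_
  · rw [normSeq_one, ENNReal.tsum_mul_right]
    exact ENNReal.mul_ne_top (tsum_two_rpow_le_ne_top (by linarith) _) hA
  · filter_upwards [eventually_ge_atTop 0] with k hk m
    split_ifs
    · rw [hcA, ← mul_assoc, ← two_rpow_add]
      have hk' : (0 : ℝ) ≤ k := by exact_mod_cast hk
      refine mul_le_mul' (two_rpow_mono ?_) (le_normSeq hq A _)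
      push_cast; nlinarith
    · simp
  · split_ifs
    · rw [← mul_zero ((2 : ℝ≥0∞) ^ (m : ℝ))]
      refine ENNReal.Tendsto.const_mul ?_ (Or.inr (two_rpow_ne_top _))
      exact hc0.comp (tendsto_atTop_add_const_left _ m tendsto_id)
    · simp

theorem lowCoeff_le (k : ℤ) :
    lowCoeff φ p T w k ≤ bernsteinConst 1 p *
      ((∑' m : ℤ, (if m ≤ -3 then (2 : ℝ≥0∞) ^ (m : ℝ) else 0)) *
        normSeq ∞ (critSup φ p T w)) := by
  rw [lowCoeff_eq, ← ENNReal.tsum_mul_right]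
  refine mul_le_mul_right (ENNReal.tsum_le_tsum fun m => ?_) _
  gcongr
  exact le_normSeq le_top _ _

end

/-! ### The modulus of a mild solution -/

theorem norm_C3_le {x : C3} {M : ℝ} (h : ∀ i, ‖x i‖ ≤ M) : ‖x‖ ≤ 2 * M := by
  have hM : 0 ≤ M := (norm_nonneg _).trans (h 0)
  rw [EuclideanSpace.norm_eq]
  refine Real.sqrt_le_iff.2 ⟨by linarith, ?_⟩
  have h1 : ∀ i, ‖x i‖ ^ 2 ≤ M ^ 2 := fun i => pow_le_pow_left₀ (norm_nonneg _) (h i) 2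
  calc ∑ i, ‖x i‖ ^ 2 ≤ ∑ _i : Fin 3, M ^ 2 := Finset.sum_le_sum fun i _ => h1 i
    _ ≤ (2 * M) ^ 2 := by simp; nlinarith [sq_nonneg M]

theorem norm_lerayHat_le (ξ : R3) (a : C3) : ‖lerayHat ξ a‖ ≤ 8 * ‖a‖ := by
  have hξ : ∀ i, ‖(ξ i : ℂ)‖ ≤ ‖ξ‖ := fun i => by
    rw [Complex.norm_real]; exact PiLp.norm_apply_le ξ i
  have ha : ∀ i, ‖a i‖ ≤ ‖a‖ := PiLp.norm_apply_le a
  have hS : ‖∑ l, (ξ l : ℂ) * a l‖ ≤ 3 * (‖ξ‖ * ‖a‖) := by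
    refine (norm_sum_le _ _).trans ?_
    calc ∑ l, ‖(ξ l : ℂ) * a l‖ ≤ ∑ _l : Fin 3, ‖ξ‖ * ‖a‖ :=
          Finset.sum_le_sum fun l _ => by
            rw [norm_mul]; exact mul_le_mul (hξ l) (ha l) (norm_nonneg _) (norm_nonneg _)
      _ = _ := by simp
  rw [show 8 * ‖a‖ = 2 * (4 * ‖a‖) by ring]
  refine norm_C3_le fun i => ?_
  have hq : ‖(ξ i : ℂ) * (∑ l, (ξ l : ℂ) * a l) / ((‖ξ‖ : ℝ) : ℂ) ^ 2‖ ≤ 3 * ‖a‖ := by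
    rw [norm_div, norm_mul, norm_pow, Complex.norm_real ‖ξ‖, norm_norm]
    refine div_le_of_le_mul₀ (by positivity) (by positivity) ?_
    calc _ ≤ ‖ξ‖ * (3 * (‖ξ‖ * ‖a‖)) :=
          mul_le_mul (hξ i) hS (norm_nonneg _) (norm_nonneg _)
      _ = _ := by ring
  calc ‖lerayHat ξ a i‖
      = ‖a i - (ξ i : ℂ) * (∑ l, (ξ l : ℂ) * a l) / ((‖ξ‖ : ℝ) : ℂ) ^ 2‖ := rfl
    _ ≤ ‖a‖ + 3 * ‖a‖ := (norm_sub_le _ _).trans (add_le_add (ha i) hq)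
    _ = _ := by ring

/-- The constant in the pointwise bound of the nonlinear term. -/
noncomputable def nonlinearConst : ℝ≥0∞ := ENNReal.ofReal (96 * Real.pi)

theorem enorm_nonlinearHat_le (a : R3 → C3) (ξ : R3) :
    ‖nonlinearHat a ξ‖ₑ ≤ nonlinearConst * ENNReal.ofReal ‖ξ‖ *
      conv (fun η => ‖a η‖ₑ) (fun η => ‖a η‖ₑ) ξ := by
  set I := conv (fun η => ‖a η‖ₑ) (fun η => ‖a η‖ₑ) ξ with hI
  have hint : ∀ k l, ‖∫ η, a (ξ - η) k * a η l‖ₑ ≤ I := fun k l => by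
    refine (enorm_integral_le_lintegral_enorm _).trans (lintegral_mono fun η => ?_)
    rw [enorm_mul]
    exact mul_le_mul' (enorm_le_iff_norm_le.2 (PiLp.norm_apply_le _ k))
      (enorm_le_iff_norm_le.2 (PiLp.norm_apply_le _ l))
  rcases eq_or_ne ξ 0 with rfl | hξ
  · have : nonlinearHat a 0 = 0 := by
      rw [← norm_le_zero_iff]
      refine (norm_lerayHat_le _ _).trans (le_of_eq ?_)
      rw [mul_eq_zero_of_right]
      rw [norm_eq_zero]
      ext l
      simp
    simp [this]
  rcases eq_or_ne I ∞ with hI' | hI'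
  · rw [hI', ENNReal.mul_top]
    · exact le_top
    · refine mul_ne_zero ?_ (by simpa using hξ)
      have := Real.pi_pos
      simp [nonlinearConst, this]
  have hint' : ∀ k l, ‖∫ η, a (ξ - η) k * a η l‖ ≤ I.toReal := fun k l => by
    rw [← toReal_enorm]
    exact ENNReal.toReal_mono hI' (hint k l)
  have hnorm : ‖nonlinearHat a ξ‖ ≤ 96 * Real.pi * ‖ξ‖ * I.toReal := by
    refine (norm_lerayHat_le _ _).trans ?_
    have hpi := Real.pi_pos
    rw [show 96 * Real.pi * ‖ξ‖ * I.toReal = 8 * (2 * (6 * Real.pi * ‖ξ‖ * I.toReal)) by ring]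
    gcongr
    refine norm_C3_le fun l => ?_
    calc _ ≤ ∑ k : Fin 3, ‖(2 * Real.pi * Complex.I) * (ξ k : ℂ) *
          ∫ η, a (ξ - η) k * a η l‖ := norm_sum_le _ _
      _ ≤ ∑ _k : Fin 3, 2 * Real.pi * ‖ξ‖ * I.toReal := by
          refine Finset.sum_le_sum fun k _ => ?_
          rw [norm_mul, norm_mul]
          have h1 : ‖(2 * Real.pi * Complex.I : ℂ)‖ = 2 * Real.pi := by
            simp [abs_of_pos hpi]
          have h2 : ‖(ξ k : ℂ)‖ ≤ ‖ξ‖ := by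
            rw [Complex.norm_real]; exact PiLp.norm_apply_le ξ k
          rw [h1]
          gcongr
          exact hint' k l
      _ = _ := by simp; ring
  rw [← ofReal_norm, ← ENNReal.ofReal_toReal hI', nonlinearConst,
    ← ENNReal.ofReal_mul (by positivity), ← ENNReal.ofReal_mul (by positivity)]
  exact ENNReal.ofReal_le_ofReal hnorm

/-- Passing to moduli in Duhamel's formula. -/
theorem isDuhamelBounded_of_mild {ν : ℝ} {Tstar : ℝ≥0∞} {v₀ : R3 → C3} {v : ℝ → R3 → C3}
    (hv : Measurable (Function.uncurry v))
    (hmild : ∀ t ∈ timeInterval Tstar, ∀ᵐ ξ,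
      IntegrableOn (fun τ => heatHat ν (t - τ) ξ • nonlinearHat (v τ) ξ) (Set.Ioc 0 t) ∧
      v t ξ = heatHat ν t ξ • v₀ ξ
        - ∫ τ in Set.Ioc 0 t, heatHat ν (t - τ) ξ • nonlinearHat (v τ) ξ)
    {T : ℝ} (hT : T ∈ timeInterval Tstar) :
    IsDuhamelBounded (4 * Real.pi ^ 2 * ν) nonlinearConst T (fun t ξ => ‖v t ξ‖ₑ) := by
  have hmem : ∀ t ∈ Set.Icc 0 T, t ∈ timeInterval Tstar := fun t ht =>
    ⟨ht.1, (ENNReal.ofReal_le_ofReal ht.2).trans_lt hT.2⟩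
  have h0 : ∀ᵐ ξ, v 0 ξ = v₀ ξ := by
    filter_upwards [hmild 0 (hmem 0 ⟨le_rfl, hT.1⟩)] with ξ hξ
    rw [hξ.2]
    simp [heatHat]
  refine ⟨hv.enorm, fun t ht => ?_⟩
  filter_upwards [h0, hmild t (hmem t ht)] with ξ hξ0 hξ
  have hheat : ∀ t, ‖heatHat ν t ξ‖ₑ =
      ENNReal.ofReal (Real.exp (-(4 * Real.pi ^ 2 * ν * t * ‖ξ‖ ^ 2))) := fun t => by
    rw [← ofReal_norm, heatHat, Real.norm_of_nonneg (Real.exp_pos _).le]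
  rw [hξ.2, hξ0]
  refine (enorm_sub_le).trans (add_le_add (le_of_eq ?_) ?_)
  · rw [enorm_smul, hheat]
  · refine (enorm_integral_le_lintegral_enorm _).trans (lintegral_mono fun τ => ?_)
    rw [enorm_smul, hheat]
    gcongr
    exact enorm_nonlinearHat_le (v τ) ξ

/-! ### Weighted sums and embeddings for the decay bounds -/

/-- Interpolation between `A_j ≤ M` and `A_j ≤ M t^{-1} 4^{-j}`, with the sum split at
`4^{-j} ≈ t`. -/
theorem exists_tsum_interpolation {σ : ℝ} (hσ : 0 < σ) (hσ2 : σ < 2) :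
    ∃ C : ℝ≥0∞, C ≠ ∞ ∧ ∀ (t : ℝ) (A : ℤ → ℝ≥0∞) (M : ℝ≥0∞), 0 < t → (∀ j, A j ≤ M) →
      (∀ j : ℤ, ENNReal.ofReal t * (2 ^ (2 * (j : ℝ)) * A j) ≤ M) →
      ENNReal.ofReal (t ^ (σ / 2)) * ∑' j : ℤ, 2 ^ ((j : ℝ) * σ) * A j ≤ C * M := by
  set S1 := ∑' k : ℤ, (if k ≤ 0 then (2 : ℝ≥0∞) ^ (σ * (k : ℝ)) else 0) with hS1
  set S2 := ∑' k : ℤ, (if 0 ≤ k then (2 : ℝ≥0∞) ^ (-((2 - σ) * (k : ℝ))) else 0) with hS2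
  have hS1t : S1 ≠ ∞ := tsum_two_rpow_le_ne_top hσ 0
  have hS2t : S2 ≠ ∞ := tsum_two_rpow_ge_ne_top (by linarith) 0
  have h2σ := two_rpow_ne_top σ
  refine ⟨2 ^ σ * (S1 + S2), by finiteness, fun t A M ht hA hA2 => ?_⟩
  -- `4^n ≤ t < 4^(n+1)`
  obtain ⟨n, hn1, hn2⟩ := exists_mem_Ico_zpow ht (by norm_num : (1 : ℝ) < 4)
  have h4 : ∀ m : ℤ, ENNReal.ofReal ((4 : ℝ) ^ m) = 2 ^ (2 * (m : ℝ)) := fun m => by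
    rw [two_rpow_two_mul]
    congr 1
    rw [← zpow_natCast, ← zpow_mul, mul_comm, zpow_mul]; norm_num
  have htσ : ENNReal.ofReal (t ^ (σ / 2)) ≤ 2 ^ (((n : ℝ) + 1) * σ) := by
    rw [← ENNReal.ofReal_rpow_of_pos ht]
    calc ENNReal.ofReal t ^ (σ / 2) ≤ (2 ^ (2 * ((n + 1 : ℤ) : ℝ))) ^ (σ / 2) := by
          refine ENNReal.rpow_le_rpow ?_ (by positivity)
          rw [← h4]
          exact ENNReal.ofReal_le_ofReal hn2.le
      _ = _ := by rw [← ENNReal.rpow_mul]; congr 1; push_cast; ring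
  have hnt : (2 : ℝ≥0∞) ^ (2 * (n : ℝ)) ≤ ENNReal.ofReal t := by
    rw [← h4]; exact ENNReal.ofReal_le_ofReal hn1
  have hAdec : ∀ j : ℤ, A j ≤ 2 ^ (-(2 * ((n : ℝ) + j))) * M := fun j => by
    have h1 : 2 ^ (2 * (n : ℝ)) * (2 ^ (2 * (j : ℝ)) * A j) ≤ M :=
      (mul_le_mul_left hnt _).trans (hA2 j)
    calc A j = 2 ^ (-(2 * ((n : ℝ) + j))) * (2 ^ (2 * (n : ℝ)) * (2 ^ (2 * (j : ℝ)) * A j)) := by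
          rw [← mul_assoc, ← mul_assoc, ← two_rpow_add, ← two_rpow_add]
          rw [show -(2 * ((n : ℝ) + j)) + 2 * n + 2 * j = 0 by ring, ENNReal.rpow_zero, one_mul]
      _ ≤ _ := by gcongr
  calc ENNReal.ofReal (t ^ (σ / 2)) * ∑' j : ℤ, 2 ^ ((j : ℝ) * σ) * A j
      ≤ ∑' j : ℤ, 2 ^ (((n : ℝ) + 1) * σ) * (2 ^ ((j : ℝ) * σ) * A j) := by
        rw [ENNReal.tsum_mul_left]; gcongr
    _ ≤ ∑' j : ℤ, ((2 ^ σ * if j + n ≤ 0 then (2 : ℝ≥0∞) ^ (σ * ((j + n : ℤ) : ℝ)) else 0) +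
          2 ^ σ * if 0 ≤ j + n then (2 : ℝ≥0∞) ^ (-((2 - σ) * ((j + n : ℤ) : ℝ))) else 0) * M := by
        refine ENNReal.tsum_le_tsum fun j => ?_
        rcases le_total (j + n) 0 with h | h
        · refine le_trans ?_ (mul_le_mul_left le_self_add M)
          rw [if_pos h, ← mul_assoc, ← two_rpow_add, ← two_rpow_add]
          refine mul_le_mul' (two_rpow_mono (le_of_eq ?_)) (hA j)
          push_cast; ring
        · refine le_trans ?_ (mul_le_mul_left le_add_self M)
          rw [if_pos h]
          refine (mul_le_mul_right (mul_le_mul_right (hAdec j) _) _).trans (le_of_eq ?_)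
          rw [← mul_assoc, ← mul_assoc, ← two_rpow_add, ← two_rpow_add, ← two_rpow_add]
          congr 2; push_cast; ring
    _ = _ := by
        rw [ENNReal.tsum_mul_right, ENNReal.tsum_add, ENNReal.tsum_mul_left, ENNReal.tsum_mul_left,
          hS1, hS2, ← (Equiv.addRight n).tsum_eq (fun k : ℤ =>
            if k ≤ 0 then (2 : ℝ≥0∞) ^ (σ * (k : ℝ)) else 0),
          ← (Equiv.addRight n).tsum_eq (fun k : ℤ =>
            if 0 ≤ k then (2 : ℝ≥0∞) ^ (-((2 - σ) * (k : ℝ))) else 0), mul_add]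
        rfl

section

variable {φ : R3 → ℝ}

/-- Since at most three cutoffs are nonzero at a given frequency, one of them is at least `1/3`. -/
theorem exists_one_le_three_mul_cutoff (hφ : IsDyadicPartition φ) {ξ : R3} (hξ : ξ ≠ 0) :
    ∃ j, 1 ≤ 3 * cutoff φ j ξ := by
  have hsum := tsum_cutoff hφ hξ
  obtain ⟨j₀, hj₀⟩ : ∃ j, cutoff φ j ξ ≠ 0 := by
    by_contra! h
    simp [h] at hsum
  obtain ⟨h1, h2⟩ := cutoff_ne_zero hφ hj₀
  have key : ∀ {m n : ℤ}, 3 / 4 * (2 : ℝ) ^ m ≤ ‖ξ‖ → ‖ξ‖ ≤ 8 / 3 * (2 : ℝ) ^ n → m ≤ n + 1 :=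
      fun {m n} hm hn => by
    have pn : (0 : ℝ) < 2 ^ n := by positivity
    have : (2 : ℝ) ^ m < 2 ^ (n + 2) := by
      rw [zpow_add₀ (by norm_num)]; norm_num; linarith
    have := (zpow_lt_zpow_iff_right₀ (by norm_num)).1 this
    omega
  rw [tsum_eq_sum (s := Finset.Icc (j₀ - 1) (j₀ + 1))] at hsum
  · by_contra! h
    have hlt : ∑ j ∈ Finset.Icc (j₀ - 1) (j₀ + 1), 3 * cutoff φ j ξ <
        ∑ _j ∈ Finset.Icc (j₀ - 1) (j₀ + 1), (1 : ℝ≥0∞) :=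
      ENNReal.sum_lt_sum_of_nonempty ⟨j₀, by simp⟩ fun j _ => h j
    rw [← Finset.mul_sum, hsum] at hlt
    have hcard : (j₀ + 1 + 1 - (j₀ - 1)).toNat = 3 := by omega
    simp [hcard] at hlt
  · intro j hj
    by_contra hne
    obtain ⟨h3, h4⟩ := cutoff_ne_zero hφ hne
    refine hj (Finset.mem_Icc.2 ⟨?_, key h3 h2⟩)
    have := key h1 h4
    omega

/-- The embedding of the Fourier–Herz space of regularity `0` and summability `p` into the space of
functions with `p`-integrable Fourier transform. -/
theorem eLpNorm_le_normSeq_blockNorm (hφ : IsDyadicPartition φ) {p : ℝ≥0∞} (hp : 1 ≤ p)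
    (hp' : p ≠ ∞) {f : R3 → ℝ≥0∞} (hf : Measurable f) :
    eLpNorm f p volume ≤ 3 * normSeq p (fun j => blockNorm φ p j f) := by
  have hp0 := (zero_lt_one.trans_le hp).ne'
  have hr : 0 < p.toReal := ENNReal.toReal_pos hp0 hp'
  rw [normSeq_of_ne_top hp']
  simp only [blockNorm, eLpNorm_eq_lintegral_rpow_enorm_toReal hp0 hp', enorm_eq_self]
  have h1 : ∀ j, ((∫⁻ ξ, (cutoff φ j ξ * f ξ) ^ p.toReal) ^ (1 / p.toReal)) ^ p.toReal =
      ∫⁻ ξ, (cutoff φ j ξ * f ξ) ^ p.toReal := fun j => by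
    rw [← ENNReal.rpow_mul, one_div_mul_cancel hr.ne', ENNReal.rpow_one]
  simp_rw [h1]
  rw [← lintegral_tsum fun j => ((measurable_cutoff_mul hφ hf j).pow_const _).aemeasurable]
  have h3 : (3 : ℝ≥0∞) = (3 ^ p.toReal) ^ (1 / p.toReal) := by
    rw [← ENNReal.rpow_mul, mul_one_div_cancel hr.ne', ENNReal.rpow_one]
  conv_rhs => rw [h3]
  rw [← ENNReal.mul_rpow_of_nonneg _ _ (by positivity)]
  refine ENNReal.rpow_le_rpow ?_ (by positivity)
  rw [← lintegral_const_mul' _ _ (ENNReal.rpow_ne_top_of_nonneg hr.le (by simp))]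
  refine lintegral_mono_ae ?_
  have h0 : ∀ᵐ ξ : R3, ξ ≠ 0 := by simp [ae_iff]
  filter_upwards [h0] with ξ hξ
  obtain ⟨j, hj⟩ := exists_one_le_three_mul_cutoff hφ hξ
  calc f ξ ^ p.toReal ≤ (3 * (cutoff φ j ξ * f ξ)) ^ p.toReal := by
        refine ENNReal.rpow_le_rpow ?_ hr.le
        rw [← mul_assoc]
        exact le_mul_of_one_le_left' hj
    _ = 3 ^ p.toReal * (cutoff φ j ξ * f ξ) ^ p.toReal := ENNReal.mul_rpow_of_nonneg _ _ hr.le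
    _ ≤ _ := by
        gcongr
        exact ENNReal.le_tsum (f := fun j => (cutoff φ j ξ * f ξ) ^ p.toReal) j

/-- The norms of a function and of its gradient, summed over dyadic pieces. -/
theorem normGradFL_le (hφ : IsDyadicPartition φ) {η : ℝ≥0∞} (hη : 1 ≤ η) (hη' : η ≠ ∞)
    {f : 𝓢'(R3, C3)} {g : R3 → C3} (h : HasFourierFunction f g) (hg : Measurable g) (α : Fin 2) :
    normGradFL α η f ≤ 3 * ENNReal.ofReal (16 / 3 * Real.pi) *
      ∑' j : ℤ, 2 ^ ((j : ℝ) * ((α : ℕ) : ℝ)) * blockNorm φ η j (fun ξ => ‖g ξ‖ₑ) := by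
  have hpi := Real.pi_pos
  have hm : ∀ j, Measurable fun ξ => cutoff φ j ξ * ‖g ξ‖ₑ := measurable_cutoff_mul hφ hg.enorm
  have h0 : ∀ᵐ ξ : R3, ξ ≠ 0 := by simp [ae_iff]
  have hterm : ∀ (r : NNReal) (a : ℝ) (G : R3 → C3),
      (∀ ξ j, cutoff φ j ξ ≠ 0 → ‖G ξ‖ₑ ≤ r * 2 ^ ((j : ℝ) * a) * ‖g ξ‖ₑ) →
      eLpNorm G η volume ≤
        r * ∑' j : ℤ, 2 ^ ((j : ℝ) * a) * blockNorm φ η j (fun ξ => ‖g ξ‖ₑ) := by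
    intro r a G hG
    calc eLpNorm G η volume
        ≤ eLpNorm (fun ξ => ∑' j : ℤ,
            (r * 2 ^ ((j : ℝ) * a)) * (cutoff φ j ξ * ‖g ξ‖ₑ)) η volume := by
          refine eLpNorm_mono_enorm_ae ?_
          filter_upwards [h0] with ξ hξ
          calc ‖G ξ‖ₑ = ∑' j, cutoff φ j ξ * ‖G ξ‖ₑ := by
                rw [ENNReal.tsum_mul_right, tsum_cutoff hφ hξ, one_mul]
            _ ≤ _ := by
                rw [enorm_eq_self]
                refine ENNReal.tsum_le_tsum fun j => ?_
                by_cases hj : cutoff φ j ξ = 0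
                · simp [hj]
                · rw [mul_left_comm]
                  exact mul_le_mul_right (hG ξ j hj) _
      _ ≤ ∑' j : ℤ, eLpNorm (fun ξ =>
            (r * 2 ^ ((j : ℝ) * a)) * (cutoff φ j ξ * ‖g ξ‖ₑ)) η volume :=
          eLpNorm_tsum_le (fun j => (hm j).const_mul _) hη hη'
      _ ≤ _ := by
          rw [← ENNReal.tsum_mul_left]
          refine ENNReal.tsum_le_tsum fun j => ?_
          have hne : (r : ℝ≥0∞) * 2 ^ ((j : ℝ) * a) ≠ ∞ :=
            ENNReal.mul_ne_top ENNReal.coe_ne_top (two_rpow_ne_top _)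
          refine (eLpNorm_le_nnreal_smul_eLpNorm_of_ae_le_mul'
            (c := ((r : ℝ≥0∞) * 2 ^ ((j : ℝ) * a)).toNNReal)
            (g := fun ξ => cutoff φ j ξ * ‖g ξ‖ₑ) (ae_of_all _ fun ξ => ?_) η).trans
            (le_of_eq ?_)
          · rw [ENNReal.coe_toNNReal hne]; simp
          · rw [ENNReal.smul_def, ENNReal.coe_toNNReal hne, smul_eq_mul, mul_assoc]; rfl
  fin_cases α
  · have h1 : (1 : ℝ≥0∞) ≤ 3 * ENNReal.ofReal (16 / 3 * Real.pi) := by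
      have h3 : (1 : ℝ≥0∞) ≤ ENNReal.ofReal (16 / 3 * Real.pi) := by
        rw [← ENNReal.ofReal_one]
        exact ENNReal.ofReal_le_ofReal (by nlinarith [Real.pi_gt_three])
      calc (1 : ℝ≥0∞) ≤ 1 * 1 := by simp
        _ ≤ _ := mul_le_mul' (by norm_num) h3
    simp only [normGradFL, Fin.zero_eta, if_true]
    rw [h.normFL_eq]
    refine (hterm 1 0 g fun ξ j _ => by simp).trans ?_
    simpa using le_mul_of_one_le_left' h1
  · simp only [normGradFL, Fin.mk_one, one_ne_zero, if_false]
    rw [mul_assoc]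
    calc _ ≤ ∑ _i : Fin 3, ENNReal.ofReal (16 / 3 * Real.pi) *
          ∑' j : ℤ, 2 ^ ((j : ℝ) * (((1 : Fin 2) : ℕ) : ℝ)) *
            blockNorm φ η j (fun ξ => ‖g ξ‖ₑ) := by
          refine Finset.sum_le_sum fun i _ => ?_
          rw [(h.lineDeriv i).normFL_eq]
          refine hterm (Real.toNNReal (16 / 3 * Real.pi)) _ _ fun ξ j hj => ?_
          rw [enorm_smul, enorm_smul, ← mul_assoc]
          refine mul_le_mul_left ?_ _
          have h2 : ‖((ξ i : ℝ) : ℂ)‖ ≤ 8 / 3 * (2 : ℝ) ^ j := by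
            rw [Complex.norm_real]
            exact (PiLp.norm_apply_le ξ i).trans (cutoff_ne_zero hφ hj).2
          have h3 : ‖(2 * Real.pi * Complex.I : ℂ)‖ = 2 * Real.pi := by simp [abs_of_pos hpi]
          rw [← ofReal_norm, ← ofReal_norm, h3, ← ENNReal.ofReal_mul (by positivity)]
          calc _ ≤ ENNReal.ofReal (16 / 3 * Real.pi * (2 : ℝ) ^ j) :=
                ENNReal.ofReal_le_ofReal (by nlinarith)
            _ = _ := by
                rw [ENNReal.ofReal_mul (by positivity), ofReal_two_zpow]
                simp [ENNReal.ofReal]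
      _ = _ := by simp

end

/-! ### Norms of a time-dependent distribution in terms of its Fourier transform -/

section

variable {φ : R3 → ℝ} {s : ℝ} {p q : ℝ≥0∞} {Tstar : ℝ≥0∞} {u : ℝ → 𝓢'(R3, C3)}
  {v : ℝ → R3 → C3}

theorem mem_timeInterval_of_mem_Icc {T t : ℝ} (hT : T ∈ timeInterval Tstar)
    (ht : t ∈ Set.Icc 0 T) : t ∈ timeInterval Tstar :=
  ⟨ht.1, (ENNReal.ofReal_le_ofReal ht.2).trans_lt hT.2⟩

theorem normCL_eq_of_eqOn (hF : ∀ t ∈ timeInterval Tstar, HasFourierFunction (u t) (v t))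
    (hφ : IsDyadicPartition φ) {T : ℝ} (hT : T ∈ timeInterval Tstar) (r : ℝ≥0∞) (a : ℝ) :
    normCL φ (Set.Icc 0 T) r a p q u = normSeq q fun j => 2 ^ ((j : ℝ) * a) *
      eLpNorm (fun t => blockNorm φ p j (fun ξ => ‖v t ξ‖ₑ)) r (volume.restrict (Set.Icc 0 T)) := by
  unfold normCL
  congr 1
  funext j
  congr 1
  refine eLpNorm_congr_ae ?_
  filter_upwards [ae_restrict_mem measurableSet_Icc] with t ht
  exact (hF t (mem_timeInterval_of_mem_Icc hT ht)).normFL_dyadicBlock hφ p j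

theorem normCL_top_eq (hF : ∀ t ∈ timeInterval Tstar, HasFourierFunction (u t) (v t))
    (hφ : IsDyadicPartition φ) {T : ℝ} (hT : T ∈ timeInterval Tstar) (a : ℝ) :
    normCL φ (Set.Icc 0 T) ∞ a p q u =
      normSeq q fun j => 2 ^ ((j : ℝ) * a) * supBlock φ p T (fun t ξ => ‖v t ξ‖ₑ) j := by
  rw [normCL_eq_of_eqOn hF hφ hT]
  simp [eLpNorm_exponent_top, eLpNormEssSup, supBlock]

theorem normCL_one_eq (hF : ∀ t ∈ timeInterval Tstar, HasFourierFunction (u t) (v t))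
    (hφ : IsDyadicPartition φ) {T : ℝ} (hT : T ∈ timeInterval Tstar) (a : ℝ) :
    normCL φ (Set.Icc 0 T) 1 a p q u =
      normSeq q fun j => 2 ^ ((j : ℝ) * a) * intBlock φ p T (fun t ξ => ‖v t ξ‖ₑ) j := by
  rw [normCL_eq_of_eqOn hF hφ hT]
  simp [eLpNorm_one_eq_lintegral_enorm, intBlock]

theorem smoothingNorm_eq (hF : ∀ t ∈ timeInterval Tstar, HasFourierFunction (u t) (v t))
    (hφ : IsDyadicPartition φ) (hv : Measurable (Function.uncurry v)) (hp : 1 ≤ p) (hp' : p ≠ ∞)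
    {T : ℝ} (hT : T ∈ timeInterval Tstar) :
    smoothingNorm φ s p q T u =
      normSeq q fun j => 2 ^ ((j : ℝ) * (s + 2)) *
        smoothBlock φ p T (fun t ξ => ‖v t ξ‖ₑ) j := by
  have hF' : ∀ t ∈ timeInterval Tstar,
      HasFourierFunction ((t : ℂ) • u t) (fun ξ => (t : ℂ) • v t ξ) := fun t ht =>
    (hF t ht).const_smul _
  unfold smoothingNorm
  rw [normCL_top_eq hF' hφ hT]
  congr 1
  funext j
  congr 1
  unfold supBlock smoothBlock
  refine essSup_congr_ae ?_
  filter_upwards [ae_restrict_mem measurableSet_Icc] with t ht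
  have h1 : ‖(t : ℂ)‖ₑ = ENNReal.ofReal t := by
    rw [← ofReal_norm, Complex.norm_real, Real.norm_of_nonneg ht.1]
  rw [← h1]
  refine Eq.trans ?_ (eLpNorm_const_mul hp hp' ‖(t : ℂ)‖ₑ
    (measurable_cutoff_mul hφ (hv.comp measurable_prodMk_left).enorm j))
  unfold blockNorm
  congr 1
  funext ξ
  change cutoff φ j ξ * ‖(t : ℂ) • v t ξ‖ₑ = _
  rw [enorm_smul, mul_left_comm]

end

/-! ### From dyadic smoothing to the conclusions -/

section

variable {φ : R3 → ℝ} {s : ℝ} {p q : ℝ≥0∞} {Tstar : ℝ≥0∞} {u : ℝ → 𝓢'(R3, C3)}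
  {v : ℝ → R3 → C3}

/-- Every set of full measure has points that approach `t` from the left. -/
instance neBot_nhdsLT_inf_ae (t : ℝ) : (𝓝[<] t ⊓ ae (volume : Measure ℝ)).NeBot := by
  rw [inf_neBot_iff]
  intro S hS N hN
  obtain ⟨a, ha, hsub⟩ := (mem_nhdsLT_iff_exists_Ioo_subset).1 hS
  by_contra hne
  have h1 : Set.Ioo a t ⊆ Nᶜ := fun x hx hxN => hne ⟨x, hsub hx, hxN⟩
  have h2 : volume (Set.Ioo a t) = 0 := measure_mono_null h1 hN
  rw [Real.volume_Ioo, ENNReal.ofReal_eq_zero] at h2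
  have : a < t := ha
  linarith

/-- By continuity in time, the essential suprema bound the dyadic pieces at every positive time. -/
theorem blockNorm_le_of_continuous (hF : ∀ t ∈ timeInterval Tstar, HasFourierFunction (u t) (v t))
    (hφ : IsDyadicPartition φ) (hv : Measurable (Function.uncurry v)) (hp : 1 ≤ p) (hq : 1 ≤ q)
    (hc : ContinuousInFB φ s p q Tstar u) {T : ℝ} (hT : T ∈ timeInterval Tstar) {t : ℝ}
    (ht : 0 < t) (htT : t ≤ T) (j : ℤ) :
    blockNorm φ p j (fun ξ => ‖v t ξ‖ₑ) ≤ supBlock φ p T (fun t ξ => ‖v t ξ‖ₑ) j ∧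
    ENNReal.ofReal t * blockNorm φ p j (fun ξ => ‖v t ξ‖ₑ) ≤
      smoothBlock φ p T (fun t ξ => ‖v t ξ‖ₑ) j := by
  set w : ℝ → R3 → ℝ≥0∞ := fun t ξ => ‖v t ξ‖ₑ with hw
  have htI : t ∈ timeInterval Tstar := mem_timeInterval_of_mem_Icc hT ⟨ht.le, htT⟩
  set L := 𝓝[<] t ⊓ ae (volume : Measure ℝ) with hL
  have hIoo : ∀ᶠ t' in L, t' ∈ Set.Ioo 0 t :=
    (show ∀ᶠ t' in 𝓝[<] t, t' ∈ Set.Ioo 0 t from Ioo_mem_nhdsLT ht).filter_mono inf_le_left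
  have hmem : ∀ᶠ t' in L, t' ∈ timeInterval Tstar := by
    filter_upwards [hIoo] with t' ht'
    exact mem_timeInterval_of_mem_Icc htI ⟨ht'.1.le, ht'.2.le⟩
  have hLt : Tendsto id L (𝓝 t) := tendsto_id'.2 (inf_le_left.trans nhdsWithin_le_nhds)
  have hcont : Tendsto (fun t' => normFB φ s p q (u t' - u t)) L (𝓝 0) :=
    ((hc t htI).2 fun _ => ht).comp (tendsto_nhdsWithin_iff.2 ⟨hLt, hmem⟩)
  have hsup : ∀ᶠ t' in L, blockNorm φ p j (w t') ≤ supBlock φ p T w j ∧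
      ENNReal.ofReal t' * blockNorm φ p j (w t') ≤ smoothBlock φ p T w j := by
    have h1 := (ae_restrict_iff' measurableSet_Icc).1
      ((ae_le_supBlock (φ := φ) (w := w) (p := p) (T := T) j).and
        (ae_le_smoothBlock (φ := φ) (w := w) (p := p) (T := T) j))
    filter_upwards [h1.filter_mono inf_le_right, hIoo] with t' h2 h3
    exact h2 ⟨h3.1.le, h3.2.le.trans htT⟩
  -- the error made by replacing the time `t` by `t'`
  set e : ℝ → ℝ≥0∞ := fun t' => 2 ^ (-((j : ℝ) * s)) * normFB φ s p q (u t' - u t) with he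
  have he0 : Tendsto e L (𝓝 0) := by
    simpa using ENNReal.Tendsto.const_mul hcont (Or.inr (two_rpow_ne_top (-((j : ℝ) * s))))
  have hmeas : ∀ t, Measurable (v t) := fun t => hv.comp measurable_prodMk_left
  have htri : ∀ᶠ t' in L, blockNorm φ p j (w t) ≤ blockNorm φ p j (w t') + e t' := by
    filter_upwards [hmem] with t' ht'
    have h1 : blockNorm φ p j (w t) ≤
        blockNorm φ p j (w t') + blockNorm φ p j (fun ξ => ‖v t' ξ - v t ξ‖ₑ) := by
      unfold blockNorm
      refine le_trans (eLpNorm_mono_enorm fun ξ => ?_) (eLpNorm_add_le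
        (measurable_cutoff_mul hφ (hmeas t').enorm j).aestronglyMeasurable
        (measurable_cutoff_mul hφ ((hmeas t').sub (hmeas t)).enorm j).aestronglyMeasurable hp)
      simp only [enorm_eq_self, Pi.add_apply, hw]
      rw [← mul_add]
      gcongr
      calc ‖v t ξ‖ₑ = ‖v t' ξ - (v t' ξ - v t ξ)‖ₑ := by rw [sub_sub_cancel]
        _ ≤ _ := enorm_sub_le
    refine h1.trans (add_le_add le_rfl ?_)
    rw [← ((hF t' ht').sub (hF t htI)).normFL_dyadicBlock hφ p j]
    have h2 := le_normSeq hq (fun j : ℤ => (2 : ℝ≥0∞) ^ ((j : ℝ) * s) *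
      normFL p (dyadicBlock φ j (u t' - u t))) j
    calc normFL p (dyadicBlock φ j (u t' - u t))
        = 2 ^ (-((j : ℝ) * s)) * (2 ^ ((j : ℝ) * s) *
            normFL p (dyadicBlock φ j (u t' - u t))) := by
          rw [← mul_assoc, ← two_rpow_add]; simp
      _ ≤ _ := mul_le_mul_right h2 _
  constructor
  · have hlim : Tendsto (fun t' => supBlock φ p T w j + e t') L (𝓝 (supBlock φ p T w j)) := by
      simpa using tendsto_const_nhds.add he0
    refine ge_of_tendsto hlim ?_
    filter_upwards [htri, hsup] with t' h1 h2
    exact h1.trans (add_le_add h2.1 le_rfl)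
  · have hlim : Tendsto (fun t' => smoothBlock φ p T w j + ENNReal.ofReal t * e t') L
        (𝓝 (smoothBlock φ p T w j)) := by
      simpa using tendsto_const_nhds.add
        (ENNReal.Tendsto.const_mul he0 (Or.inr (ENNReal.ofReal_ne_top (r := t))))
    have hlim' : Tendsto (fun t' => ENNReal.ofReal t' * blockNorm φ p j (w t)) L
        (𝓝 (ENNReal.ofReal t * blockNorm φ p j (w t))) :=
      ENNReal.Tendsto.mul_const (ENNReal.tendsto_ofReal hLt) (Or.inl (by simpa using ht))
    refine le_of_tendsto_of_tendsto hlim' hlim ?_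
    filter_upwards [htri, hsup, hIoo] with t' h1 h2 h3
    calc ENNReal.ofReal t' * blockNorm φ p j (w t)
        ≤ ENNReal.ofReal t' * blockNorm φ p j (w t') + ENNReal.ofReal t' * e t' := by
          rw [← mul_add]; gcongr
      _ ≤ _ := by
          refine add_le_add h2.2 (mul_le_mul_left (ENNReal.ofReal_le_ofReal h3.2.le) _)

/-- The decay bounds, except in the endpoint case of exponent zero. -/
theorem exists_decay_bound (hφ : IsDyadicPartition φ) {η : ℝ≥0∞} (hη : 1 ≤ η) (hηp : η ≤ p)
    (hp' : p ≠ ∞) (α : Fin 2) {σ : ℝ} (hσ0 : 0 < σ) (hσ2 : σ < 2)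
    (hσ : σ = ((α : ℕ) : ℝ) - s + 3 * ((η⁻¹).toReal - (p⁻¹).toReal)) {M : ℝ≥0∞} (hM : M ≠ ∞) :
    ∃ C : ℝ≥0∞, C ≠ ∞ ∧ ∀ (t : ℝ) (f : 𝓢'(R3, C3)) (g : R3 → C3), 0 < t →
      HasFourierFunction f g → Measurable g →
      (∀ j : ℤ, 2 ^ ((j : ℝ) * s) * blockNorm φ p j (fun ξ => ‖g ξ‖ₑ) ≤ M) →
      (∀ j : ℤ, 2 ^ ((j : ℝ) * (s + 2)) *
        (ENNReal.ofReal t * blockNorm φ p j (fun ξ => ‖g ξ‖ₑ)) ≤ M) →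
      ENNReal.ofReal (t ^ (σ / 2)) * normGradFL α η f ≤ C := by
  obtain ⟨C, hC, hCb⟩ := exists_tsum_interpolation hσ0 hσ2
  have hη' : η ≠ ∞ := ne_top_of_le_ne_top hp' hηp
  have hb := bernsteinConst_ne_top hη hηp
  refine ⟨3 * ENNReal.ofReal (16 / 3 * Real.pi) * bernsteinConst η p * (C * M), by finiteness,
    fun t f g ht hfg hg h1 h2 => ?_⟩
  have key := hCb t (fun j => 2 ^ ((j : ℝ) * s) * blockNorm φ p j (fun ξ => ‖g ξ‖ₑ)) M ht h1
    fun j => by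
      refine le_trans (le_of_eq ?_) (h2 j)
      rw [show (j : ℝ) * (s + 2) = 2 * j + j * s by ring, two_rpow_add]
      ring
  calc ENNReal.ofReal (t ^ (σ / 2)) * normGradFL α η f
      ≤ ENNReal.ofReal (t ^ (σ / 2)) * (3 * ENNReal.ofReal (16 / 3 * Real.pi) *
        ∑' j : ℤ, bernsteinConst η p * (2 ^ ((j : ℝ) * σ) *
          (2 ^ ((j : ℝ) * s) * blockNorm φ p j (fun ξ => ‖g ξ‖ₑ)))) := by
        gcongr
        refine (normGradFL_le hφ hη hη' hfg hg α).trans ?_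
        refine mul_le_mul_right (ENNReal.tsum_le_tsum fun j => ?_) _
        refine (mul_le_mul_right (blockNorm_le_bernstein hφ hη hηp hg.enorm j) _).trans
          (le_of_eq ?_)
        have hpow : (2 : ℝ≥0∞) ^ ((j : ℝ) * σ) * 2 ^ ((j : ℝ) * s) =
            2 ^ ((j : ℝ) * ((α : ℕ) : ℝ)) *
              2 ^ (3 * (j : ℝ) * ((η⁻¹).toReal - (p⁻¹).toReal)) := by
          rw [← two_rpow_add, ← two_rpow_add, hσ]; congr 1; ring
        rw [← mul_assoc (2 ^ ((j : ℝ) * σ)), hpow]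
        ring
    _ = 3 * ENNReal.ofReal (16 / 3 * Real.pi) * bernsteinConst η p *
        (ENNReal.ofReal (t ^ (σ / 2)) * ∑' j : ℤ, 2 ^ ((j : ℝ) * σ) *
          (2 ^ ((j : ℝ) * s) * blockNorm φ p j (fun ξ => ‖g ξ‖ₑ))) := by
        rw [ENNReal.tsum_mul_left]; ring
    _ ≤ _ := by gcongr

/-- All conclusions follow from the finiteness of the dyadic smoothing norms, by dominated
convergence for the vanishing at time zero, and by Bernstein's inequality and
interpolation for the decay. -/
theorem smoothingAndDecay_of_finite (hF : ∀ t ∈ timeInterval Tstar, HasFourierFunction (u t) (v t))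
    (hφ : IsDyadicPartition φ) (hv : Measurable (Function.uncurry v)) (hp : 1 ≤ p) (hp' : p ≠ ∞)
    (hq : 1 ≤ q) (hs : critExp p ≤ s) (hs0 : s ≤ 0) (hT0 : 0 < Tstar)
    (hu : InSolutionClass φ s p q Tstar u)
    (hY : ∀ T ∈ timeInterval Tstar, normSeq q (fun j => 2 ^ ((j : ℝ) * (s + 2)) *
      smoothBlock φ p T (fun t ξ => ‖v t ξ‖ₑ) j) ≠ ∞) :
    SmoothingAndDecay φ s p q Tstar u := by
  set w : ℝ → R3 → ℝ≥0∞ := fun t ξ => ‖v t ξ‖ₑ with hw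
  have hA : ∀ T ∈ timeInterval Tstar,
      normSeq q (fun j => 2 ^ ((j : ℝ) * s) * supBlock φ p T w j) ≠ ∞ := fun T hT => by
    have := hu.2 ∞ le_top T hT
    rw [normCL_top_eq hF hφ hT] at this
    simpa using this.ne
  refine ⟨fun T hT => ?_, fun hq' => ?_, fun T hT α η hη hηp hex1 hex2 => ?_⟩
  · rw [smoothingNorm_eq hF hφ hv hp hp' hT]
    exact (hY T hT).lt_top
  · -- each dyadic piece is `O(T)`, and the sequence at a fixed time is a majorant in `ℓ^q`
    obtain ⟨T₀, hT₀, hT₀I⟩ : ∃ T₀ : ℝ, 0 < T₀ ∧ T₀ ∈ timeInterval Tstar := by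
      obtain ⟨r, hr0, hr⟩ := ENNReal.lt_iff_exists_nnreal_btwn.1 hT0
      refine ⟨r, by exact_mod_cast hr0, r.2, by simpa using hr⟩
    have hIoo : ∀ᶠ T in 𝓝[>] (0 : ℝ), T ∈ Set.Ioo 0 T₀ := Ioo_mem_nhdsGT hT₀
    have hlim : Tendsto (fun T => normSeq q fun j => 2 ^ ((j : ℝ) * (s + 2)) *
        smoothBlock φ p T w j) (𝓝[>] 0) (𝓝 0) := by
      refine tendsto_normSeq_zero hq hq' (hY T₀ hT₀I) ?_ fun j => ?_
      · filter_upwards [hIoo] with T hT j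
        gcongr
        exact essSup_mono_measure' (Measure.restrict_mono
          (Set.Icc_subset_Icc_right hT.2.le) le_rfl)
      · have hfin : 2 ^ ((j : ℝ) * (s + 2)) * supBlock φ p T₀ w j ≠ ∞ := by
          have h1 : 2 ^ ((j : ℝ) * s) * supBlock φ p T₀ w j ≠ ∞ :=
            ne_top_of_le_ne_top (hA T₀ hT₀I) (le_normSeq hq (fun j : ℤ =>
              2 ^ ((j : ℝ) * s) * supBlock φ p T₀ w j) j)
          rw [show (j : ℝ) * (s + 2) = 2 * j + j * s by ring, two_rpow_add, mul_assoc]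
          exact ENNReal.mul_ne_top (two_rpow_ne_top _) h1
        have h2 : Tendsto (fun T => ENNReal.ofReal T *
            (2 ^ ((j : ℝ) * (s + 2)) * supBlock φ p T₀ w j)) (𝓝[>] (0 : ℝ)) (𝓝 0) := by
          have h3 : Tendsto (fun T : ℝ => ENNReal.ofReal T) (𝓝[>] (0 : ℝ)) (𝓝 0) := by
            simpa using (ENNReal.tendsto_ofReal (tendsto_id (x := 𝓝 (0 : ℝ)))).mono_left
              nhdsWithin_le_nhds
          simpa using ENNReal.Tendsto.mul_const h3 (Or.inr hfin)
        refine tendsto_of_tendsto_of_tendsto_of_le_of_le' tendsto_const_nhds h2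
          (Eventually.of_forall fun _ => zero_le) ?_
        filter_upwards [hIoo] with T hT
        rw [mul_left_comm]
        refine mul_le_mul_right ((smoothBlock_le j).trans (mul_le_mul_right ?_ _)) _
        exact essSup_mono_measure' (Measure.restrict_mono
          (Set.Icc_subset_Icc_right hT.2.le) le_rfl)
    refine hlim.congr' ?_
    filter_upwards [hIoo] with T hT
    rw [smoothingNorm_eq hF hφ hv hp hp' (mem_timeInterval_of_mem_Icc hT₀I ⟨hT.1.le, hT.2.le⟩)]
  · have hvm : ∀ t, Measurable (v t) := fun t => hv.comp measurable_prodMk_left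
    have hηp' := toReal_inv_mono hη hηp
    have hη1 : (η⁻¹).toReal ≤ 1 := by
      simpa using ENNReal.toReal_mono ENNReal.one_ne_top (ENNReal.inv_le_one.2 hη)
    have hα : ((α : ℕ) : ℝ) = 0 ∧ α = 0 ∨ ((α : ℕ) : ℝ) = 1 ∧ α = 1 := by
      fin_cases α <;> simp
    have hinv : ∀ {x : ℝ≥0∞}, 1 ≤ x → (η⁻¹).toReal = (x⁻¹).toReal → η = x := fun hx h => by
      have h1 := ENNReal.inv_ne_top.2 (zero_lt_one.trans_le hη).ne'
      have h2 := ENNReal.inv_ne_top.2 (zero_lt_one.trans_le hx).ne'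
      exact inv_injective ((ENNReal.toReal_eq_toReal_iff' h1 h2).1 h)
    obtain ⟨σ, hσ⟩ : ∃ σ, σ = ((α : ℕ) : ℝ) - s + 3 * ((η⁻¹).toReal - (p⁻¹).toReal) := ⟨_, rfl⟩
    have hexp : ((α : ℕ) : ℝ) / 2 - s / 2 + 3 / 2 * (η⁻¹).toReal - 3 / 2 * (p⁻¹).toReal =
        σ / 2 := by rw [hσ]; ring
    rw [hexp]
    have hαnn : (0 : ℝ) ≤ ((α : ℕ) : ℝ) := Nat.cast_nonneg _
    have hσ0 : 0 ≤ σ := by rw [hσ]; linarith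
    have hsupA : ∀ t, 0 < t → t ≤ T → ∀ j, blockNorm φ p j (w t) ≤ supBlock φ p T w j :=
      fun t ht htT j => (blockNorm_le_of_continuous hF hφ hv hp hq hu.1 hT ht htT j).1
    rcases hσ0.eq_or_lt with hσz | hσpos
    · -- exponent zero: only the embedding of the space itself is needed
      have hs' : s = 0 := by rw [hσ] at hσz; linarith
      have hα0 : α = 0 := by
        rcases hα with h | h
        · exact h.2
        · rw [hσ] at hσz; linarith [h.1]
      have hηeq : η = p := hinv hp (by rw [hσ] at hσz; linarith)
      have hqp : q ≤ p := not_lt.1 fun h => hex2 ⟨hs', hα0, hηeq, h⟩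
      subst hα0 hηeq hs'
      have hbound : ∀ t ∈ timeInterval Tstar, normGradFL 0 η (u t) ≤
          3 * normSeq q (fun j => blockNorm φ η j (w t)) := fun t ht => by
        simp only [normGradFL, if_true]
        rw [(hF t ht).normFL_eq]
        have := eLpNorm_le_normSeq_blockNorm hφ hp hp' (hvm t).enorm
        rw [eLpNorm_enorm] at this
        exact this.trans (mul_le_mul_right (normSeq_anti hq hqp _) _)
      have h0I : (0 : ℝ) ∈ timeInterval Tstar := mem_timeInterval_of_mem_Icc hT ⟨le_rfl, hT.1⟩
      have hinit : normSeq q (fun j => blockNorm φ η j (w 0)) ≠ ∞ := by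
        have h1 := (hu.1 0 h0I).1.2
        unfold normFB at h1
        simp_rw [(hF 0 h0I).normFL_dyadicBlock hφ] at h1
        simpa using h1.ne
      have hAT := hA T hT
      simp only [mul_zero, ENNReal.rpow_zero, one_mul] at hAT
      refine lt_of_le_of_lt (b := 3 * normSeq q (fun j => blockNorm φ η j (w 0)) +
        3 * normSeq q (supBlock φ η T w)) (iSup₂_le fun t ht => ?_) (by finiteness)
      rw [← hσz]
      simp only [zero_div, Real.rpow_zero, ENNReal.ofReal_one, one_mul]
      refine (hbound t (mem_timeInterval_of_mem_Icc hT ⟨ht.1, ht.2.le⟩)).trans ?_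
      rcases ht.1.eq_or_lt with h | h
      · rw [← h]; exact le_self_add
      · refine le_trans ?_ le_add_self
        exact mul_le_mul_right (normSeq_mono fun j => hsupA t h ht.2.le j) _
    · have hσ2 : σ < 2 := by
        have hcrit : critExp p = 2 - 3 * (p⁻¹).toReal := rfl
        rcases hα with h | h
        · rw [hσ, h.1]; linarith
        · rw [hσ, h.1]
          by_contra! hge
          refine hex1 ⟨by linarith, h.2, hinv le_rfl ?_⟩
          simp only [inv_one, ENNReal.toReal_one]
          linarith
      set M := normSeq q (fun j => 2 ^ ((j : ℝ) * s) * supBlock φ p T w j) +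
        normSeq q (fun j => 2 ^ ((j : ℝ) * (s + 2)) * smoothBlock φ p T w j) with hM
      obtain ⟨C, hC, hCb⟩ := exists_decay_bound hφ hη hηp hp' α hσpos hσ2 hσ
        (M := M) (ENNReal.add_ne_top.2 ⟨hA T hT, hY T hT⟩)
      refine lt_of_le_of_lt (b := C) (iSup₂_le fun t ht => ?_) hC.lt_top
      rcases ht.1.eq_or_lt with h | h
      · rw [← h, Real.zero_rpow (by positivity)]
        simp
      · have hb := blockNorm_le_of_continuous hF hφ hv hp hq hu.1 hT h ht.2.le
        refine hCb t (u t) (v t) h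
          (hF t (mem_timeInterval_of_mem_Icc hT ⟨ht.1, ht.2.le⟩)) (hvm t) (fun j => ?_) fun j => ?_
        · refine le_trans ?_ le_self_add
          exact (mul_le_mul_right (hb j).1 _).trans (le_normSeq hq (fun j : ℤ =>
            2 ^ ((j : ℝ) * s) * supBlock φ p T w j) j)
        · refine le_trans ?_ le_add_self
          exact (mul_le_mul_right (hb j).2 _).trans (le_normSeq hq (fun j : ℤ =>
            2 ^ ((j : ℝ) * (s + 2)) * smoothBlock φ p T w j) j)

end

/-! ### Mild solutions -/

section

variable {φ : R3 → ℝ} {s : ℝ} {p q : ℝ≥0∞}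

/-- A mild solution has the smoothing and decay properties as soon as its high frequencies are
small: the low-high coefficients and the tail of the dyadic `L¹` in time norms, both in critical
normalisation, must eventually lie below a threshold which does not depend on the solution. -/
theorem exists_threshold_smoothingAndDecay (hφ : IsDyadicPartition φ) {ν : ℝ} (hν : 0 < ν)
    (hp : 1 ≤ p) (hp' : p ≠ ∞) (hq : 1 ≤ q) (hs : critExp p ≤ s) (hs0 : s ≤ 0)
    (hcase : 0 < s + 1 ∨ (p = 1 ∧ q ≤ 2)) :
    ∃ ε : ℝ≥0∞, 0 < ε ∧ ∀ (Tstar : ℝ≥0∞) (u₀ : 𝓢'(R3, C3)) (u : ℝ → 𝓢'(R3, C3)),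
      0 < Tstar → IsMildSolution ν u₀ Tstar u → InSolutionClass φ s p q Tstar u →
      (∀ v : ℝ → R3 → C3, (∀ t ∈ timeInterval Tstar, HasFourierFunction (u t) (v t)) →
        ∀ T ∈ timeInterval Tstar, ∃ J : ℤ,
          (∀ k, J ≤ k → lowCoeff φ p T (fun t ξ => ‖v t ξ‖ₑ) k ≤ ε) ∧
          normSeq q (tail J (critInt φ p T fun t ξ => ‖v t ξ‖ₑ)) ≤ ε) →
      SmoothingAndDecay φ s p q Tstar u := by
  have hκ : 0 < 4 * Real.pi ^ 2 * ν := by have := Real.pi_pos; positivity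
  obtain ⟨ε, hε, hthr⟩ := exists_smoothing_threshold hφ hκ (K := nonlinearConst)
    ENNReal.ofReal_ne_top hp hp' hq hs hs0 hcase
  refine ⟨ε, hε, fun Tstar u₀ u hT0 hmild hu hsmall => ?_⟩
  obtain ⟨v₀, v, -, hF, hv, -, hD⟩ := hmild
  refine smoothingAndDecay_of_finite hF hφ hv hp hp' hq hs hs0 hT0 hu fun T hT => ?_
  obtain ⟨J, hlow, htail⟩ := hsmall v hF T hT
  refine hthr T _ J (isDuhamelBounded_of_mild hv hD hT) ?_ ?_ ?_ hlow htail
  · have := hu.2 ∞ le_top T hT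
    rw [normCL_top_eq hF hφ hT] at this
    simpa using this.ne
  · have := hu.2 1 le_rfl T hT
    rw [normCL_one_eq hF hφ hT] at this
    simpa using this.ne
  · have h0I : (0 : ℝ) ∈ timeInterval Tstar := mem_timeInterval_of_mem_Icc hT ⟨le_rfl, hT.1⟩
    have h1 := (hu.1 0 h0I).1.2
    unfold normFB at h1
    simp_rw [(hF 0 h0I).normFL_dyadicBlock hφ] at h1
    exact h1.ne

theorem ne_top_of_critExp_le (hs : critExp p ≤ s) (hs0 : s ≤ 0) : p ≠ ∞ := by
  rintro rfl
  have h := hs.trans hs0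
  simp [critExp] at h
  linarith

theorem neg_one_lt_critExp (hp : 1 ≤ p) (hp1 : p ≠ 1) : -1 < critExp p := by
  have h1 : p⁻¹ < 1 := ENNReal.inv_lt_one.2 (lt_of_le_of_ne hp hp1.symm)
  have h2 : (p⁻¹).toReal < 1 := by
    simpa using (ENNReal.toReal_lt_toReal h1.ne_top ENNReal.one_ne_top).2 h1
  unfold critExp; linarith

theorem critExp_one : critExp 1 = -1 := by norm_num [critExp]

theorem normCL_mono_set {I I' : Set ℝ} (h : I ⊆ I') (r : ℝ≥0∞) (a : ℝ) (u : ℝ → 𝓢'(R3, C3)) :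
    normCL φ I r a p q u ≤ normCL φ I' r a p q u :=
  normSeq_mono fun _ => mul_le_mul_right
    (eLpNorm_mono_measure _ (Measure.restrict_mono h le_rfl)) _

/-- Local solutions: for `q < ∞` or subcritical regularity the high frequencies of every solution
in the class are small. -/
theorem smoothingAndDecay_of_local (hφ : IsDyadicPartition φ) {ν : ℝ} (hν : 0 < ν)
    (hp : 1 ≤ p) (hq : 1 ≤ q) (hs : critExp p ≤ s) (hs0 : s ≤ 0)
    (h : (s = critExp p ∧ q ≠ ∞ ∧ (p = 1 → q ≤ 2)) ∨ (critExp p < s ∧ ¬ (s = 0 ∧ p = 1)))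
    {u₀ : 𝓢'(R3, C3)} {Tstar : ℝ≥0∞} (hT0 : 0 < Tstar) {u : ℝ → 𝓢'(R3, C3)}
    (hmild : IsMildSolution ν u₀ Tstar u) (hu : InSolutionClass φ s p q Tstar u) :
    SmoothingAndDecay φ s p q Tstar u := by
  have hp' := ne_top_of_critExp_le hs hs0
  have hcase : 0 < s + 1 ∨ (p = 1 ∧ q ≤ 2) := by
    rcases h with ⟨-, -, h2⟩ | ⟨h1, -⟩
    · by_cases hp1 : p = 1
      · exact Or.inr ⟨hp1, h2 hp1⟩
      · exact Or.inl (by linarith [neg_one_lt_critExp hp hp1])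
    · exact Or.inl (by linarith [neg_one_le_critExp hp])
  have hs1 : s < critExp p + 1 := by
    rcases h with ⟨h1, -, -⟩ | ⟨-, h2⟩
    · linarith
    · by_cases hp1 : p = 1
      · have hne : s ≠ 0 := fun hs' => h2 ⟨hs', hp1⟩
        rw [hp1, critExp_one]
        linarith [lt_of_le_of_ne hs0 hne]
      · linarith [neg_one_lt_critExp hp hp1]
  have hdec : critExp p < s ∨ q ≠ ∞ := h.symm.imp And.left fun h => h.2.1
  obtain ⟨ε, hε, H⟩ := exists_threshold_smoothingAndDecay hφ hν hp hp' hq hs hs0 hcase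
  refine H Tstar u₀ u hT0 hmild hu fun v hF T hT => ?_
  have hA := (hu.2 ∞ le_top T hT).ne
  rw [normCL_top_eq hF hφ hT, ENNReal.inv_top, ENNReal.toReal_zero, mul_zero, add_zero] at hA
  have hP := (hu.2 1 le_rfl T hT).ne
  rw [normCL_one_eq hF hφ hT, inv_one, ENNReal.toReal_one, mul_one] at hP
  have h1 := (tendsto_lowCoeff hp hq hA hs hs1 hdec).eventually_le_const hε
  have h2 := (tendsto_normSeq_tail hq hP (sub_nonneg.2 hs)
    (hdec.imp_left sub_pos.2)).eventually_le_const hε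
  simp_rw [← critInt_eq] at h2
  obtain ⟨J, hJ1, hJ2⟩ := ((eventually_forall_ge_atTop.2 h1).and h2).exists
  exact ⟨J, hJ1, hJ2⟩

/-- Global solutions from small critical data, `q = ∞`: the norms of the solution are so small that
no localisation to high frequencies is needed. -/
theorem exists_smallness_smoothingAndDecay (hφ : IsDyadicPartition φ) {ν : ℝ} (hν : 0 < ν)
    (hp : 1 ≤ p) (hp1 : p ≠ 1) (hs : s = critExp p) (hs0 : s ≤ 0) (C : ℝ≥0) :
    ∃ η₀ : ℝ≥0∞, 0 < η₀ ∧ ∀ u₀ : 𝓢'(R3, C3), normFB φ s p ∞ u₀ < η₀ →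
      ∀ u : ℝ → 𝓢'(R3, C3), IsMildSolution ν u₀ ∞ u → InSolutionClass φ s p ∞ ∞ u →
        (∀ r : ℝ≥0∞, 1 ≤ r → normCL φ (Set.Ici 0) r (s + 2 * (r⁻¹).toReal) p ∞ u ≤
          C * normFB φ s p ∞ u₀) →
        SmoothingAndDecay φ s p ∞ ∞ u := by
  have hp' := ne_top_of_critExp_le hs.ge hs0
  obtain ⟨ε, hε, H⟩ := exists_threshold_smoothingAndDecay hφ hν hp hp' le_top hs.ge hs0
    (Or.inl (by linarith [neg_one_lt_critExp hp hp1]))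
  obtain ⟨B, hB⟩ : ∃ B, B = bernsteinConst 1 p *
      (∑' m : ℤ, (if m ≤ -3 then (2 : ℝ≥0∞) ^ (m : ℝ) else 0)) := ⟨_, rfl⟩
  have hBt : B ≠ ∞ := by
    rw [hB]
    refine ENNReal.mul_ne_top (bernsteinConst_ne_top le_rfl hp) ?_
    simpa using tsum_two_rpow_le_ne_top one_pos (-3)
  -- `B C` controls the low-high coefficients, and `C` the high-high ones
  set D : ℝ≥0∞ := (B + 1) * C + 1 with hD
  have hDt : D ≠ ∞ := by rw [hD]; finiteness
  have hD0 : D ≠ 0 := by rw [hD]; simp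
  refine ⟨ε / D, ENNReal.div_pos hε.ne' hDt, fun u₀ hu₀ u hmild hu hglob => ?_⟩
  have hCB : (B + 1) * (C * normFB φ s p ∞ u₀) ≤ ε :=
    calc (B + 1) * (C * normFB φ s p ∞ u₀) ≤ D * (ε / D) := by
          rw [← mul_assoc]
          exact mul_le_mul' le_self_add hu₀.le
      _ = ε := ENNReal.mul_div_cancel hD0 hDt
  have hsub : ∀ T : ℝ, Set.Icc 0 T ⊆ Set.Ici 0 := fun T t ht => ht.1
  refine H ∞ u₀ u ENNReal.zero_lt_top hmild hu fun v hF T hT => ⟨0, fun k _ => ?_, ?_⟩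
  · have h1 := (normCL_mono_set (hsub T) ∞ _ u).trans (hglob ∞ le_top)
    rw [normCL_top_eq hF hφ hT, ENNReal.inv_top, ENNReal.toReal_zero, mul_zero, add_zero] at h1
    refine (lowCoeff_le k).trans (le_trans ?_ hCB)
    rw [← mul_assoc, ← hB]
    refine mul_le_mul' le_self_add (le_trans (le_of_eq ?_) h1)
    unfold critSup
    rw [hs]
  · have h1 := (normCL_mono_set (hsub T) 1 _ u).trans (hglob 1 le_rfl)
    rw [normCL_one_eq hF hφ hT, inv_one, ENNReal.toReal_one, mul_one] at h1
    refine le_trans ?_ hCB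
    refine le_trans ((normSeq_mono (tail_le _ _)).trans (le_trans (le_of_eq ?_) h1)) ?_
    · unfold critInt
      rw [hs]
    · exact le_mul_of_one_le_left' le_add_self

end

end FourierHerz

theorem mainTheorem8 (φ : FourierHerz.R3 → ℝ) (hφ : FourierHerz.IsDyadicPartition φ)
    (ν : ℝ) (hν : 0 < ν) (p q : ℝ≥0∞) (hp : 1 ≤ p) (hq : 1 ≤ q)
    (s : ℝ) (hs : FourierHerz.critExp p ≤ s) (hs0 : s ≤ 0) :
    -- local solutions: critical data with `q < ∞`, or subcritical data
    ((s = FourierHerz.critExp p ∧ q ≠ ∞ ∧ (p = 1 → q ≤ 2)) ∨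
        (FourierHerz.critExp p < s ∧ ¬ (s = 0 ∧ p = 1)) →
      ∀ u₀ : 𝓢'(FourierHerz.R3, FourierHerz.C3),
        FourierHerz.MemFB φ s p q u₀ → FourierHerz.IsDivFree u₀ →
        ∀ Tstar : ℝ≥0∞, 0 < Tstar → ∀ u : ℝ → 𝓢'(FourierHerz.R3, FourierHerz.C3),
          FourierHerz.IsMildSolution ν u₀ Tstar u →
          FourierHerz.InSolutionClass φ s p q Tstar u →
          FourierHerz.SmoothingAndDecay φ s p q Tstar u) ∧
    -- global solutions from small critical data, `q = ∞` included
    (s = FourierHerz.critExp p → (p = 1 → q ≤ 2) →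
      ∀ C : ℝ≥0, ∃ η₀ : ℝ≥0∞, 0 < η₀ ∧
        ∀ u₀ : 𝓢'(FourierHerz.R3, FourierHerz.C3),
          FourierHerz.MemFB φ s p q u₀ → FourierHerz.IsDivFree u₀ →
          FourierHerz.normFB φ s p q u₀ < η₀ →
          ∀ u : ℝ → 𝓢'(FourierHerz.R3, FourierHerz.C3),
            FourierHerz.IsMildSolution ν u₀ ∞ u →
            FourierHerz.InSolutionClass φ s p q ∞ u →
            (∀ r : ℝ≥0∞, 1 ≤ r →
              FourierHerz.normCL φ (Set.Ici 0) r (s + 2 * (r⁻¹).toReal) p q u ≤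
                C * FourierHerz.normFB φ s p q u₀) →
            FourierHerz.SmoothingAndDecay φ s p q ∞ u) := by
  refine ⟨fun h u₀ _ _ Tstar hT0 u hmild hu =>
    FourierHerz.smoothingAndDecay_of_local hφ hν hp hq hs hs0 h hT0 hmild hu,
    fun hsc hpq C => ?_⟩
  rcases eq_or_ne q ∞ with rfl | hq'
  · have hp1 : p ≠ 1 := fun h => by simpa using hpq h
    obtain ⟨η₀, hη₀, H⟩ :=
      FourierHerz.exists_smallness_smoothingAndDecay hφ hν hp hp1 hsc hs0 C
    exact ⟨η₀, hη₀, fun u₀ _ _ hu₀ u hmild hu hglob => H u₀ hu₀ u hmild hu hglob⟩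
  · -- for `q < ∞` no smallness is needed
    exact ⟨1, one_pos, fun u₀ _ _ _ u hmild hu _ => FourierHerz.smoothingAndDecay_of_local hφ hν
      hp hq hs hs0 (Or.inl ⟨hsc, hq', hpq⟩) ENNReal.zero_lt_top hmild hu⟩
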